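/- Let $\mathbb S^1=\mathbb R/\mathbb Z$. For $\tau\in[0,1)$ and $l_1,l_2,l_3>0$ with $l_1+l_2+l_3=1$ put $a_0=0$, $a_1=l_1$, $a_2=l_1+l_2$, $a_3=1$, and let $F=F_{\tau,l_1,l_2,l_3}:\mathbb S^1\to\mathbb S^1$ be the fully flipped interval exchange given by $$F(x)=-x+a_{i-1}+a_i+\tau \mod 1\qquad\text{for }x\in[a_{i-1},a_i),\ i=1,2,3$$ (each of the three intervals is flipped and then shifted by $\tau$). The family of these maps is $\mathrm{CET}^3_\tau$. The points $a_0,a_1,a_2$ are the singularities; an orbit is called regular if its forward orbit avoids them. Cutting the circle at $0$, and cutting at $F^{-1}(0)$ the interval of continuity whose image contains $0$ in its interior (if there is one), one views $F$ as a fully flipped interval exchange of $[0,1)$. An interval exchange with or without flips, given by a top and a bottom word $\omega^{top},\omega^{bot}$ in the same letters (each occurring once in each word), flips $k$ and positive lengths $\lambda$, is simple if $\omega^{top}=\omega^{top}_1\cdots\omega^{top}_p$ and $\omega^{bot}=\omega^{bot}_1\cdots\omega^{bot}_p$, where for every $j$ the words are non-empty and either $\omega^{top}_j=\omega^{bot}_j$,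 or no letter of $\omega_j^{top}$ is flipped and $(\omega^{top}_j,\omega^{bot}_j)$ is $(xy,yx)$, $(xyz,zyx)$, $(xyz,zxy)$ or $(xyz,yzx)$ with non-empty words $x,y,z$. A map is integrable if it has a Poincaré section, that is, a finite union of disjoint intervals which meets every regular orbit, each of the intervals being invariant under the first-return map to the section, and the first-return map acting on each of them as a simple exchange (up to finitely many points). A circle map is minimal if each of its regular orbits is dense. The Poincaré–Rauzy section of an interval exchange is constructed recursively. If the exchange is simple, keep the whole interval. If it is reducible, unite the sections of its components. Otherwise run the modified Rauzy induction (as long as the last top interval and the last bottom interval have different lengths, pass to the first-return map to the interval shortened on the right by the shorter of the two). If it never stops, keep the whole interval. Suppose that it stops on $[0,\alpha)$, so that the last top and the last bottom interval are the same interval $J=[\beta,\alpha)$. If both carry the same letter (that is, $J$ is invariant), keep $J$ together with the section constructed in the same way for the first-return map on $[0,\beta)$; if the two letters differ, take the section constructed for the first-return map on $[0,\beta)$. **Proposition.** Let $F=F_{\tau,l_1,l_2,l_3}\in\mathrm{CET}^3_\tau$ with $\tau\neq\frac12$. 1. $F$ is integrable and $F$ is not minimal. 2. Suppose moreover that $l_1,l_2,l_3$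 are linearly independent over $\mathbb Q$. Then the Poincaré–Rauzy section of $F$ is a Poincaré section on which the first-return map is simple (as in the definition of integrability). The orbit of every periodic point of $F$ with regular orbit meets the Poincaré–Rauzy section, and each point of this orbit that lies in the section is contained in an open interval of continuity of the first-return map which that map flips onto itself. -/

import Mathlib

noncomputable section

namespace FlipExchange

/-! ### Interval exchange transformations with flips, given by their data -/

/-- The data `(σ, k, lam)` of an interval exchange transformation with or without flips on
`[0, |lam|)`: the two rows of the generalized permutation, as words in the alphabet `A`, the vector
of flips (`k a = -1` means that the interval labelled `a` is flipped) and the lengths. -/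
structure ExchangeData (A : Type) where
  top : List A
  bot : List A
  k : A → ℤˣ
  len : A → ℝ

/-- Total length of a word. -/
def wordLength {A : Type} (len : A → ℝ) (w : List A) : ℝ := (w.map len).sum

/-- Left end point of the interval labelled `a` when the intervals labelled by the letters of the
word `w` are put side by side, from left to right, starting at `0`. -/
def leftEnd {A : Type} [DecidableEq A] (len : A → ℝ) (w : List A) (a : A) : ℝ :=
  wordLength len (w.takeWhile (fun b => b ≠ a))

namespace ExchangeData

variable {A : Type}

/-- The two rows are permutations of the same set of letters, the lengths are positive. -/
structure Valid (D : ExchangeData A) : Prop where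
  nodup : D.top.Nodup
  perm : D.bot.Perm D.top
  pos : ∀ a ∈ D.top, 0 < D.len a

/-- Length of the interval on which the transformation acts. -/
def total (D : ExchangeData A) : ℝ := wordLength D.len D.top

/-- Left end point of the interval labelled `a` in the top partition. -/
def topLeft [DecidableEq A] (D : ExchangeData A) (a : A) : ℝ := leftEnd D.len D.top a

/-- Left end point of the interval labelled `a` in the bottom partition. -/
def botLeft [DecidableEq A] (D : ExchangeData A) (a : A) : ℝ := leftEnd D.len D.bot a

/-- The open top interval `a`. -/
def topInterval [DecidableEq A] (D : ExchangeData A) (a : A) : Set ℝ :=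
  Set.Ioo (D.topLeft a) (D.topLeft a + D.len a)

/-- The transformation on the top interval labelled `a`: this interval is carried onto the bottom
interval labelled `a`, by a translation if `k a = 1`, by a translation composed with a flip if
`k a = -1`. -/
def act [DecidableEq A] (D : ExchangeData A) (a : A) (x : ℝ) : ℝ :=
  if D.k a = 1 then D.botLeft a + (x - D.topLeft a)
  else D.botLeft a + D.len a - (x - D.topLeft a)

end ExchangeData

/-! ### Simple interval exchange transformations with flips -/

/-- The pairs of words `(ω_j^top, ω_j^bot)` allowed in a simple transformation: periodic cylinders,
cylinders of rotation, cylinders of rotation with a marked singularity. -/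
inductive IsSimpleBlock {A : Type} (k : A → ℤˣ) : List A → List A → Prop
  | periodic (w : List A) (hw : w ≠ []) : IsSimpleBlock k w w
  | rotation (x y : List A) (hx : x ≠ []) (hy : y ≠ []) (hk : ∀ a ∈ x ++ y, k a = 1) :
      IsSimpleBlock k (x ++ y) (y ++ x)
  | marked_zyx (x y z : List A) (hx : x ≠ []) (hy : y ≠ []) (hz : z ≠ [])
      (hk : ∀ a ∈ x ++ y ++ z, k a = 1) : IsSimpleBlock k (x ++ y ++ z) (z ++ y ++ x)
  | marked_zxy (x y z : List A) (hx : x ≠ []) (hy : y ≠ []) (hz : z ≠ [])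
      (hk : ∀ a ∈ x ++ y ++ z, k a = 1) : IsSimpleBlock k (x ++ y ++ z) (z ++ x ++ y)
  | marked_yzx (x y z : List A) (hx : x ≠ []) (hy : y ≠ []) (hz : z ≠ [])
      (hk : ∀ a ∈ x ++ y ++ z, k a = 1) : IsSimpleBlock k (x ++ y ++ z) (y ++ z ++ x)

/-- The two rows are concatenations of `p ≥ 1` pairs of words of the allowed kinds. -/
def ExchangeData.IsSimple {A : Type} (D : ExchangeData A) : Prop :=
  ∃ blocks : List (List A × List A), blocks ≠ [] ∧
    (∀ q ∈ blocks, IsSimpleBlock D.k q.1 q.2) ∧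
    D.top = (blocks.map Prod.fst).flatten ∧ D.bot = (blocks.map Prod.snd).flatten

/-! ### Poincaré sections and integrability -/

/-- The forward orbit of `x` under `f` avoids the set `S` (of singularities). -/
def OrbitAvoids {X : Type} (f : X → X) (S : Set X) (x : X) : Prop := ∀ n : ℕ, f^[n] x ∉ S

/-- The orbit of `x` under `f` comes back to `Sect` after time zero, and for the first time at the
point `y`. -/
def IsFirstReturn {X : Type} (f : X → X) (Sect : Set X) (x y : X) : Prop :=
  ∃ n : ℕ, 0 < n ∧ f^[n] x = y ∧ y ∈ Sect ∧ ∀ m : ℕ, 0 < m → m < n → f^[m] x ∉ Sect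

/-- An interval `[start, start + |data|)` together with the data of an exchange of that interval
(written in the coordinate `x - start`). -/
structure Piece (A : Type) where
  start : ℝ
  data : ExchangeData A

namespace Piece

variable {A : Type}

/-- The interval `[start, start + |data|)`. -/
def carrier (p : Piece A) : Set ℝ := Set.Ico p.start (p.start + p.data.total)

/-- The open interval of continuity labelled `a` of the exchange carried by `p`. -/
def interval [DecidableEq A] (p : Piece A) (a : A) : Set ℝ :=
  Set.Ioo (p.start + p.data.topLeft a) (p.start + p.data.topLeft a + p.data.len a)

/-- The exchange carried by `p` maps its interval labelled `a` onto itself and flips it. -/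
def FlipsOntoItself [DecidableEq A] (p : Piece A) (a : A) : Prop :=
  a ∈ p.data.top ∧ p.data.botLeft a = p.data.topLeft a ∧ p.data.k a = -1

end Piece

/-- The union of the intervals in a list of pieces. -/
def sectionSet {A : Type} (P : List (Piece A)) : Set ℝ := {x | ∃ p ∈ P, x ∈ p.carrier}

/-- The union of the disjoint intervals in the list `P` is a Poincaré section of the map `f` of
`[0,1)` with set of singularities `S` (every orbit that avoids the singularities meets it), each of
these intervals is invariant under the first return map of `f` to the section and, with finitely
many points left out, the first return map acts on it as the simple transformation given by the
data of the piece. (Side by side, these simple transformations form one simple transformation.) -/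
structure IsSimpleSection {A : Type} [DecidableEq A] (f : ℝ → ℝ) (S : Set ℝ)
    (P : List (Piece A)) : Prop where
  valid : ∀ p ∈ P, p.data.Valid
  simple : ∀ p ∈ P, p.data.IsSimple
  subset : ∀ p ∈ P, p.carrier ⊆ Set.Ico 0 1
  disjoint : P.Pairwise (fun p q => Disjoint p.carrier q.carrier)
  meets : ∀ x ∈ Set.Ico (0 : ℝ) 1, OrbitAvoids f S x → ∃ n : ℕ, f^[n] x ∈ sectionSet P
  firstReturn : ∃ E : Set ℝ, E.Finite ∧ ∀ p ∈ P, ∀ a ∈ p.data.top, ∀ x ∈ p.data.topInterval a,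
    p.start + x ∉ E → IsFirstReturn f (sectionSet P) (p.start + x) (p.start + p.data.act a x)

/-- A map `f` of `[0,1)` with set of singularities `S` is integrable if it has a Poincaré section on
which the first return map is a simple interval exchange transformation with or without flips. -/
def IsIntegrable (f : ℝ → ℝ) (S : Set ℝ) : Prop := ∃ P : List (Piece ℕ), IsSimpleSection f S P

/-! ### Maps of the circle `ℝ / ℤ` -/

/-- The representative in `[0,1)` of a point of the circle. -/
def rep (x : UnitAddCircle) : ℝ := (AddCircle.equivIco (1 : ℝ) 0 x : ℝ)

/-- The map of the interval `[0,1)` that corresponds to a map of the circle. -/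
def onInterval (F : UnitAddCircle → UnitAddCircle) : ℝ → ℝ := fun t => rep (F (t : UnitAddCircle))

/-- A map of the circle is integrable if the corresponding map of the interval is. -/
def IsIntegrableOnCircle (F : UnitAddCircle → UnitAddCircle) (S : Set UnitAddCircle) : Prop :=
  IsIntegrable (onInterval F) (rep '' S)

/-- A map of the circle with set of singularities `S` is minimal if every forward orbit that avoids
the singularities is dense. -/
def IsMinimalOnCircle (F : UnitAddCircle → UnitAddCircle) (S : Set UnitAddCircle) : Prop :=
  ∀ x : UnitAddCircle, OrbitAvoids F S x → Dense (Set.range fun n : ℕ => F^[n] x)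

/-! ### The fully flipped three-interval exchanges of the circle -/

/-- The map `F_{τ, l₁, l₂, l₃}` (with `l 0, l 1, l 2` for the three lengths): the circle is cut at
`a₀ = 0`, `a₁ = l₁`, `a₂ = l₁ + l₂`, and each of the three intervals `[a_{i-1}, a_i)` is flipped and
then shifted by `τ`, that is `x ↦ -x + a_{i-1} + a_i + τ` modulo `1`. -/
def cetMap (τ : ℝ) (l : Fin 3 → ℝ) (x : UnitAddCircle) : UnitAddCircle :=
  if rep x < l 0 then ((-rep x + l 0 + τ : ℝ) : UnitAddCircle)
  else if rep x < l 0 + l 1 then ((-rep x + l 0 + (l 0 + l 1) + τ : ℝ) : UnitAddCircle)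
  else ((-rep x + (l 0 + l 1) + (l 0 + l 1 + l 2) + τ : ℝ) : UnitAddCircle)

/-- The singularities `0`, `l₁`, `l₁ + l₂` of `F_{τ, l₁, l₂, l₃}`. -/
def cetSingularities (l : Fin 3 → ℝ) : Set UnitAddCircle :=
  {((0 : ℝ) : UnitAddCircle), ((l 0 : ℝ) : UnitAddCircle), ((l 0 + l 1 : ℝ) : UnitAddCircle)}

/-- The data of `F_{τ, l₁, l₂, l₃}` as a fully flipped interval exchange of `[0,1)`. The interval of
continuity whose image contains the marked point `0` in its interior, if there is one, is cut in
two at the preimage of `0`. The images of the three intervals are, modulo `1`, `(τ, τ + l₁)`,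
`(τ + l₁, τ + l₁ + l₂)` and `(τ + l₁ + l₂, τ + 1)`. -/
def cetData (τ : ℝ) (l : Fin 3 → ℝ) : ExchangeData (Fin 4) :=
  if τ = 0 then
    { top := [0, 1, 2], bot := [0, 1, 2], k := fun _ => -1, len := ![l 0, l 1, l 2, 0] }
  else if τ < l 2 then
    { top := [0, 1, 2, 3], bot := [2, 0, 1, 3], k := fun _ => -1,
      len := ![l 0, l 1, τ, l 2 - τ] }
  else if τ = l 2 then
    { top := [0, 1, 2], bot := [2, 0, 1], k := fun _ => -1, len := ![l 0, l 1, l 2, 0] }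
  else if τ < l 1 + l 2 then
    { top := [0, 1, 2, 3], bot := [1, 3, 0, 2], k := fun _ => -1,
      len := ![l 0, τ - l 2, l 1 + l 2 - τ, l 2] }
  else if τ = l 1 + l 2 then
    { top := [0, 1, 2], bot := [1, 2, 0], k := fun _ => -1, len := ![l 0, l 1, l 2, 0] }
  else
    { top := [0, 1, 2, 3], bot := [0, 2, 3, 1], k := fun _ => -1,
      len := ![τ - (l 1 + l 2), 1 - τ, l 1, l 2] }

/-! ### Modified Rauzy induction -/

namespace ExchangeData

variable {A : Type}

/-- A proper nonempty prefix of the top row and the prefix of the same length of the bottom row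
consist of the same letters. -/
def IsReducible (D : ExchangeData A) : Prop :=
  ∃ t₁ t₂ b₁ b₂ : List A, D.top = t₁ ++ t₂ ∧ D.bot = b₁ ++ b₂ ∧ t₁ ≠ [] ∧ t₂ ≠ [] ∧ b₁.Perm t₁

variable [DecidableEq A]

/-- One step of the modified Rauzy induction. `X` and `Y` are the last letters of the top and the
bottom row; the longer of the two intervals wins and loses the length of the loser. If the winner is
on top, the loser is moved, in the bottom row, next to the winner: just after it if the winner is
not flipped, just before it if the winner is flipped; likewise with the rows exchanged if the winner
is on the bottom. The flip of the loser is multiplied by the flip of the winner. -/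
inductive RauzyStep : ExchangeData A → ExchangeData A → Prop
  | top_keep (t b c : List A) (X Y : A) (k : A → ℤˣ) (len : A → ℝ)
      (hXY : X ≠ Y) (hlen : len Y < len X) (hk : k X = 1) :
      RauzyStep ⟨t ++ [X], b ++ X :: c ++ [Y], k, len⟩
        ⟨t ++ [X], b ++ X :: Y :: c, Function.update k Y (k Y * k X),
          Function.update len X (len X - len Y)⟩
  | top_flip (t b c : List A) (X Y : A) (k : A → ℤˣ) (len : A → ℝ)
      (hXY : X ≠ Y) (hlen : len Y < len X) (hk : k X = -1) :
      RauzyStep ⟨t ++ [X], b ++ X :: c ++ [Y], k, len⟩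
        ⟨t ++ [X], b ++ Y :: X :: c, Function.update k Y (k Y * k X),
          Function.update len X (len X - len Y)⟩
  | bot_keep (t s b : List A) (X Y : A) (k : A → ℤˣ) (len : A → ℝ)
      (hXY : X ≠ Y) (hlen : len X < len Y) (hk : k Y = 1) :
      RauzyStep ⟨t ++ Y :: s ++ [X], b ++ [Y], k, len⟩
        ⟨t ++ Y :: X :: s, b ++ [Y], Function.update k X (k X * k Y),
          Function.update len Y (len Y - len X)⟩
  | bot_flip (t s b : List A) (X Y : A) (k : A → ℤˣ) (len : A → ℝ)
      (hXY : X ≠ Y) (hlen : len X < len Y) (hk : k Y = -1) :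
      RauzyStep ⟨t ++ Y :: s ++ [X], b ++ [Y], k, len⟩
        ⟨t ++ X :: Y :: s, b ++ [Y], Function.update k X (k X * k Y),
          Function.update len Y (len Y - len X)⟩

end ExchangeData

/-- `IsPoincareRauzySection c D P`: the construction of the Poincaré-Rauzy section, applied to the
exchange with data `D` placed on the interval `[c, c + |D|)`, yields the list of pieces `P`; the
section is the union of their intervals, and the data of the pieces describe the Poincaré-Rauzy
map.

* If `D` is simple, the whole interval is kept.
* If `D` is reducible, the construction is applied to its components (the first component and the
  rest), and the results are united.
* Otherwise the modified Rauzy induction is run. If it never stops, the whole interval is kept.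
  Suppose that it stops on `[c, c + α)`, so that the last intervals of the top and of the bottom
  partition are one and the same interval `J = [c + β, c + α)`. If they carry the same letter, `J`
  is invariant: it is kept, and the construction goes on with the induced map on `[c, c + β)`. If
  they carry different letters `X` (top) and `Y` (bottom), which cannot happen when the lengths
  are rationally independent, the interval `Y` is mapped onto `J` and then as `X` is, and the
  construction goes on with the induced map on `[c, c + β)`. -/
inductive IsPoincareRauzySection {A : Type} [DecidableEq A] :
    ℝ → ExchangeData A → List (Piece A) → Prop
  | simple (c : ℝ) (D : ExchangeData A) (hs : D.IsSimple) :
      IsPoincareRauzySection c D [⟨c, D⟩]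
  | components (c : ℝ) (t₁ t₂ b₁ b₂ : List A) (k : A → ℤˣ) (len : A → ℝ)
      (P₁ P₂ : List (Piece A))
      (hs : ¬ (⟨t₁ ++ t₂, b₁ ++ b₂, k, len⟩ : ExchangeData A).IsSimple)
      (ht₁ : t₁ ≠ []) (ht₂ : t₂ ≠ []) (hperm : b₁.Perm t₁)
      (hirr : ¬ (⟨t₁, b₁, k, len⟩ : ExchangeData A).IsReducible)
      (h₁ : IsPoincareRauzySection c ⟨t₁, b₁, k, len⟩ P₁)
      (h₂ : IsPoincareRauzySection (c + wordLength len t₁) ⟨t₂, b₂, k, len⟩ P₂) :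
      IsPoincareRauzySection c ⟨t₁ ++ t₂, b₁ ++ b₂, k, len⟩ (P₁ ++ P₂)
  | infinite (c : ℝ) (D : ExchangeData A) (hs : ¬ D.IsSimple) (hirr : ¬ D.IsReducible)
      (R : ℕ → ExchangeData A) (hR : R 0 = D) (hstep : ∀ n, (R n).RauzyStep (R (n + 1))) :
      IsPoincareRauzySection c D [⟨c, D⟩]
  | stop_same (c : ℝ) (D : ExchangeData A) (hs : ¬ D.IsSimple) (hirr : ¬ D.IsReducible)
      (t b : List A) (X : A) (k : A → ℤˣ) (len : A → ℝ)
      (hR : Relation.ReflTransGen ExchangeData.RauzyStep D ⟨t ++ [X], b ++ [X], k, len⟩)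
      (P : List (Piece A)) (hP : IsPoincareRauzySection c ⟨t, b, k, len⟩ P) :
      IsPoincareRauzySection c D (P ++ [⟨c + wordLength len t, ⟨[X], [X], k, len⟩⟩])
  | stop_distinct (c : ℝ) (D : ExchangeData A) (hs : ¬ D.IsSimple) (hirr : ¬ D.IsReducible)
      (t b d : List A) (X Y : A) (k : A → ℤˣ) (len : A → ℝ) (hXY : X ≠ Y) (hlen : len X = len Y)
      (hR : Relation.ReflTransGen ExchangeData.RauzyStep D
        ⟨t ++ [X], b ++ X :: d ++ [Y], k, len⟩)
      (P : List (Piece A))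
      (hP : IsPoincareRauzySection c
        ⟨t, b ++ Y :: d, Function.update k Y (k Y * k X), len⟩ P) :
      IsPoincareRauzySection c D P

end FlipExchange

end

/-!
# Fully flipped exchanges of three intervals of the circle

The relation `Induces` says that the exchanges of a list of pieces are the first return maps of
those of another list. It is transitive and holds for each step of the construction of the
Poincaré-Rauzy section (`IsPoincareRauzySection.induces`). Since the exchange `cetData τ l` of
`[0,1)` is the map `cetMap τ l` (`presents_cetData`), it suffices to show that the construction,
applied to this exchange, ends with simple pieces of the right kind; this is
`exists_section_cetData`.

The construction is followed on the combinatorial level. The rows and the flips of an exchange are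
supplemented by two integers for each letter (`Mark`). The coefficients `d` define a linear form of
the lengths which the Rauzy induction conserves; at the start its value is `1 - 2 * τ` up to the
sign, which can be chosen such that the value is positive, because `τ ≠ 1 / 2`. The coefficients
`v` define a form that vanishes on no nontrivial integer relation between the lengths, provided
that `l 0`, `l 1` and `l 2` are linearly independent. With these marks only finitely many patterns
occur, and `Code.exists_search` enumerates them and verifies a condition, `Code.ok`, on each. What
it implies is the following.

* The Rauzy induction stops (`Stage.Ok.not_forall_step`). In an infinite run the losers become
  arbitrarily short. A step of the graph of patterns that is not bounded from below by the positive
  conserved form, and that involves a flipped winner, lies on no cycle of such steps; hence from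
  some time on the winners are not flipped, then neither are the losers, as the flipped letters
  keep their lengths, and the only cycles that are left are loops. So one letter wins all the time,
  and the losers, whose lengths are constant, cannot become short.
* The pieces at the end are simple, and one of them has an interval that is mapped onto itself
  (`Code.exists_isPoincareRauzySection`). The first return map or its square is the identity there,
  so that almost all points of this interval are periodic with a regular orbit, and the map is not
  minimal.
* If the lengths are linearly independent over the rational numbers, each interval of a piece is
  flipped onto itself or belongs to a rotation by two intervals whose lengths are independent
  (`ExchangeData.IsGood`). Such a rotation carries no regular periodic orbit
  (`Realizes.not_periodic_of_isFreeRotation`), so the points of periodic orbits lie in intervals of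
  the first kind (`Realizes.exists_flipsOntoItself`).
-/

noncomputable section

namespace FlipExchange

/-! ### Positions of letters in words -/

section Words

variable {A : Type} {len : A → ℝ}

@[simp] theorem wordLength_nil : wordLength len ([] : List A) = 0 := rfl

@[simp] theorem wordLength_cons (a : A) (w : List A) :
    wordLength len (a :: w) = len a + wordLength len w := by simp [wordLength]

@[simp] theorem wordLength_append (u w : List A) :
    wordLength len (u ++ w) = wordLength len u + wordLength len w := by simp [wordLength]

theorem wordLength_nonneg {w : List A} (h : ∀ a ∈ w, 0 < len a) : 0 ≤ wordLength len w := by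
  induction w with
  | nil => simp
  | cons a w ih =>
    have h₁ := h a (by simp)
    have h₂ := ih fun b hb => h b (by simp [hb])
    simp only [wordLength_cons]; linarith

theorem wordLength_perm {u w : List A} (h : u.Perm w) : wordLength len u = wordLength len w :=
  (h.map len).sum_eq

theorem wordLength_congr {len' : A → ℝ} {w : List A} (h : ∀ a ∈ w, len' a = len a) :
    wordLength len' w = wordLength len w := by
  unfold wordLength; rw [List.map_congr_left h]

variable [DecidableEq A]

@[simp] theorem leftEnd_cons_self (a : A) (w : List A) : leftEnd len (a :: w) a = 0 := by
  simp [leftEnd]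

theorem leftEnd_cons_of_ne {a b : A} (h : b ≠ a) (w : List A) :
    leftEnd len (b :: w) a = len b + leftEnd len w a := by
  simp [leftEnd, h]

theorem leftEnd_append_of_mem {a : A} {u : List A} (h : a ∈ u) (w : List A) :
    leftEnd len (u ++ w) a = leftEnd len u a := by
  induction u with
  | nil => simp at h
  | cons b u ih =>
    by_cases hb : b = a
    · subst hb; simp
    · have : a ∈ u := by simpa [Ne.symm hb] using h
      simp [leftEnd_cons_of_ne hb, ih this]

theorem leftEnd_append_of_notMem {a : A} {u : List A} (h : a ∉ u) (w : List A) :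
    leftEnd len (u ++ w) a = wordLength len u + leftEnd len w a := by
  induction u with
  | nil => simp
  | cons b u ih =>
    have hb : b ≠ a := fun e => h (by simp [e])
    have hu : a ∉ u := fun e => h (by simp [e])
    simp [leftEnd_cons_of_ne hb, ih hu, add_assoc]

theorem leftEnd_congr {len' : A → ℝ} {w : List A} (h : ∀ a ∈ w, len' a = len a) (a : A) :
    leftEnd len' w a = leftEnd len w a :=
  wordLength_congr fun b hb => h b ((List.takeWhile_sublist _).subset hb)

theorem leftEnd_nonneg {w : List A} (h : ∀ a ∈ w, 0 < len a) (a : A) : 0 ≤ leftEnd len w a :=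
  wordLength_nonneg fun b hb => h b ((List.takeWhile_sublist _).subset hb)

theorem leftEnd_add_le {w : List A} (h : ∀ a ∈ w, 0 < len a) {a : A} (ha : a ∈ w) :
    leftEnd len w a + len a ≤ wordLength len w := by
  induction w with
  | nil => simp at ha
  | cons b w ih =>
    have hw : ∀ c ∈ w, 0 < len c := fun c hc => h c (by simp [hc])
    by_cases hb : b = a
    · subst hb; simpa using wordLength_nonneg hw
    · have : a ∈ w := by simpa [Ne.symm hb] using ha
      have := ih hw this
      simp only [leftEnd_cons_of_ne hb, wordLength_cons]; linarith

/-- The intervals of a word cover the whole segment. -/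
theorem exists_letter_of_mem_Ico {w : List A} (hn : w.Nodup) {x : ℝ} (h₀ : 0 ≤ x)
    (h₁ : x < wordLength len w) :
    ∃ a ∈ w, leftEnd len w a ≤ x ∧ x < leftEnd len w a + len a := by
  induction w generalizing x with
  | nil => simp at h₁; linarith
  | cons b w ih =>
    rw [List.nodup_cons] at hn
    by_cases hx : x < len b
    · exact ⟨b, by simp, by simpa using h₀, by simpa using hx⟩
    · have h₁' : x - len b < wordLength len w := by
        simp only [wordLength_cons] at h₁; linarith
      obtain ⟨a, ha, h₂, h₃⟩ := ih hn.2 (x := x - len b) (by linarith) h₁'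
      have hb : b ≠ a := fun e => hn.1 (e ▸ ha)
      exact ⟨a, by simp [ha], by rw [leftEnd_cons_of_ne hb]; linarith,
        by rw [leftEnd_cons_of_ne hb]; linarith⟩

end Words

/-! ### Induced systems of exchanges -/

section Induced

variable {A : Type} [DecidableEq A]

/-- One step of the exchanges of the pieces in `Q`: the point `x` lies inside an interval of
continuity of one of the pieces and is carried to `y`. -/
def PStep (Q : List (Piece A)) (x y : ℝ) : Prop :=
  ∃ p ∈ Q, ∃ a ∈ p.data.top, x ∈ p.interval a ∧ y = p.start + p.data.act a (x - p.start)

/-- The cut points of the pieces in `Q`: the left end points of the intervals of continuity. -/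
def cutSet (Q : List (Piece A)) : Set ℝ :=
  {x | ∃ p ∈ Q, ∃ a ∈ p.data.top, x = p.start + p.data.topLeft a}

/-- The first point after time zero in `S` of the `R`-orbit of `x` is `y`. -/
inductive Returns (R : ℝ → ℝ → Prop) (S : Set ℝ) : ℝ → ℝ → Prop
  | last {x y : ℝ} (h : R x y) (hy : y ∈ S) : Returns R S x y
  | next {x z y : ℝ} (h : R x z) (hz : z ∉ S) (hr : Returns R S z y) : Returns R S x y

/-- Some point, possibly `x`, of the `R`-orbit of `x` lies in `T`. -/
def Hits (R : ℝ → ℝ → Prop) (T : Set ℝ) (x : ℝ) : Prop :=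
  ∃ y ∈ T, Relation.ReflTransGen R x y

/-- The exchanges of the pieces in `P` are the first return maps of the exchanges of the pieces in
`Q` to a smaller section, which every orbit meets unless it runs into a cut point. No cut points
appear except those whose `Q`-orbit runs into a cut point of `Q`. -/
structure Induces (Q P : List (Piece A)) : Prop where
  ret : ∀ x y, PStep P x y → Returns (PStep Q) (sectionSet P) x y
  meets : ∀ x ∈ sectionSet Q, Hits (PStep Q) (sectionSet P ∪ cutSet Q) x
  cut : ∀ x ∈ cutSet P, Hits (PStep Q) (cutSet Q) x
  sub : sectionSet P ⊆ sectionSet Q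

theorem Returns.reflTransGen {R : ℝ → ℝ → Prop} {S : Set ℝ} {x y : ℝ} (h : Returns R S x y) :
    Relation.ReflTransGen R x y := by
  induction h with
  | last h _ => exact .single h
  | next h _ _ ih => exact .head h ih

theorem Returns.mono {R R' : ℝ → ℝ → Prop} {S S' : Set ℝ} {x y : ℝ} (h : Returns R S x y)
    (hR : ∀ x y, R x y → R' x y) (hS : S ⊆ S') (hS' : ∀ x y, R x y → y ∈ S' → y ∈ S) :
    Returns R' S' x y := by
  induction h with
  | last h hy => exact .last (hR _ _ h) (hS hy)
  | next h hz _ ih => exact .next (hR _ _ h) (fun hz' => hz (hS' _ _ h hz')) ih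

/-- Returns to a smaller set, put together from returns to a larger one. -/
theorem Returns.trans_of_subset {R : ℝ → ℝ → Prop} {S S' : Set ℝ} (hS : S' ⊆ S) {x y : ℝ}
    (h : Returns (Returns R S) S' x y) : Returns R S' x y := by
  have key : ∀ {x y}, Returns R S x y → (y ∈ S' → Returns R S' x y) ∧
      (y ∉ S' → ∀ z, Returns R S' y z → Returns R S' x z) := by
    intro x y h
    induction h with
    | last h hy => exact ⟨fun h' => .last h h', fun h' z hz => .next h h' hz⟩
    | next h hz _ ih =>
      have hz' := fun h' => hz (hS h')
      exact ⟨fun h' => .next h hz' (ih.1 h'), fun h' z hr => .next h hz' (ih.2 h' z hr)⟩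
  induction h with
  | last h hy => exact (key h).1 hy
  | next h hz _ ih => exact (key h).2 hz _ ih

theorem Hits.head {R : ℝ → ℝ → Prop} {T : Set ℝ} {x y : ℝ} (h : Relation.ReflTransGen R x y)
    (hy : Hits R T y) : Hits R T x := by
  obtain ⟨z, hz, hr⟩ := hy
  exact ⟨z, hz, h.trans hr⟩

theorem Hits.of_mem {R : ℝ → ℝ → Prop} {T : Set ℝ} {x : ℝ} (h : x ∈ T) : Hits R T x :=
  ⟨x, h, .refl⟩

theorem Hits.mono {R R' : ℝ → ℝ → Prop} {T T' : Set ℝ} {x : ℝ} (h : Hits R T x)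
    (hR : ∀ x y, R x y → R' x y) (hT : T ⊆ T') : Hits R' T' x := by
  obtain ⟨y, hy, hr⟩ := h
  exact ⟨y, hT hy, Relation.ReflTransGen.mono hR _ _ hr⟩

theorem Induces.reflTransGen {Q P : List (Piece A)} (h : Induces Q P) {x y : ℝ}
    (hr : Relation.ReflTransGen (PStep P) x y) : Relation.ReflTransGen (PStep Q) x y := by
  induction hr with
  | refl => exact .refl
  | tail _ h' ih => exact ih.trans (h.ret _ _ h').reflTransGen

theorem Induces.trans {Q P P' : List (Piece A)} (h : Induces Q P) (h' : Induces P P') :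
    Induces Q P' where
  ret x y hxy := .trans_of_subset h'.sub
    ((h'.ret x y hxy).mono (fun x y => h.ret x y) subset_rfl fun _ _ _ h => h)
  meets x hx := by
    obtain ⟨y, hy | hy, hr⟩ := h.meets x hx
    · obtain ⟨z, hz | hz, hr'⟩ := h'.meets y hy
      · exact ⟨z, .inl hz, hr.trans (h.reflTransGen hr')⟩
      · exact ((h.cut z hz).head (hr.trans (h.reflTransGen hr'))).mono (fun _ _ h => h) (by simp)
    · exact ⟨y, .inr hy, hr⟩
  cut x hx := by
    obtain ⟨y, hy, hr⟩ := h'.cut x hx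
    exact (h.cut y hy).head (h.reflTransGen hr)
  sub := h'.sub.trans h.sub

omit [DecidableEq A] in
theorem sectionSet_append (P P' : List (Piece A)) :
    sectionSet (P ++ P') = sectionSet P ∪ sectionSet P' := by
  ext x; simp [sectionSet, or_and_right, exists_or]

theorem cutSet_append (P P' : List (Piece A)) : cutSet (P ++ P') = cutSet P ∪ cutSet P' := by
  ext x; simp [cutSet, or_and_right, exists_or]

theorem PStep_append {P P' : List (Piece A)} {x y : ℝ} :
    PStep (P ++ P') x y ↔ PStep P x y ∨ PStep P' x y := by
  simp [PStep, or_and_right, exists_or]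

omit [DecidableEq A] in
@[simp] theorem sectionSet_singleton (p : Piece A) : sectionSet [p] = p.carrier := by
  ext x; simp [sectionSet]

theorem ExchangeData.act_mem {D : ExchangeData A} {a : A} {x : ℝ}
    (hx : x ∈ D.topInterval a) : D.act a x ∈ Set.Ioo (D.botLeft a) (D.botLeft a + D.len a) := by
  obtain ⟨h₁, h₂⟩ := hx
  unfold ExchangeData.act
  split_ifs <;> constructor <;> linarith

theorem ExchangeData.botInterval_subset {D : ExchangeData A} (hD : D.Valid) {a : A}
    (ha : a ∈ D.top) : Set.Ioo (D.botLeft a) (D.botLeft a + D.len a) ⊆ Set.Ico 0 D.total := by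
  have hb : ∀ b ∈ D.bot, 0 < D.len b := fun b hb => hD.pos b (hD.perm.subset hb)
  have h₁ := leftEnd_nonneg hb a
  have h₂ := leftEnd_add_le hb (hD.perm.symm.subset ha)
  rw [wordLength_perm hD.perm] at h₂
  intro x hx
  exact ⟨by have := hx.1; unfold ExchangeData.botLeft at this; linarith,
    by have := hx.2; unfold ExchangeData.botLeft at this; unfold ExchangeData.total; linarith⟩

theorem Piece.mem_interval {p : Piece A} {a : A} {x : ℝ} :
    x ∈ p.interval a ↔ x - p.start ∈ p.data.topInterval a := by
  simp only [Piece.interval, ExchangeData.topInterval, Set.mem_Ioo]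
  constructor <;> rintro ⟨h₁, h₂⟩ <;> constructor <;> linarith

theorem PStep.target_mem {Q : List (Piece A)} (hQ : ∀ p ∈ Q, p.data.Valid) {x y : ℝ}
    (h : PStep Q x y) : y ∈ sectionSet Q := by
  obtain ⟨p, hp, a, ha, hx, rfl⟩ := h
  have := ExchangeData.botInterval_subset (hQ p hp) ha
    (ExchangeData.act_mem (Piece.mem_interval.1 hx))
  exact ⟨p, hp, by constructor <;> linarith [this.1, this.2]⟩

theorem Induces.append {Q Q' P P' : List (Piece A)} (h : Induces Q P) (h' : Induces Q' P')
    (hQ : ∀ p ∈ Q, p.data.Valid) (hQ' : ∀ p ∈ Q', p.data.Valid)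
    (hd : Disjoint (sectionSet Q) (sectionSet Q')) : Induces (Q ++ Q') (P ++ P') where
  ret x y hxy := by
    rw [sectionSet_append]
    rcases PStep_append.1 hxy with hxy | hxy
    · refine (h.ret x y hxy).mono (fun _ _ h => PStep_append.2 (.inl h)) (by simp) ?_
      rintro x y hxy (hy | hy)
      · exact hy
      · exact (Set.disjoint_left.1 hd (hxy.target_mem hQ) (h'.sub hy)).elim
    · refine (h'.ret x y hxy).mono (fun _ _ h => PStep_append.2 (.inr h)) (by simp) ?_
      rintro x y hxy (hy | hy)
      · exact (Set.disjoint_left.1 hd (h.sub hy) (hxy.target_mem hQ')).elim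
      · exact hy
  meets x hx := by
    rw [sectionSet_append] at hx
    rw [sectionSet_append, cutSet_append]
    rcases hx with hx | hx
    · exact (h.meets x hx).mono (fun _ _ h => PStep_append.2 (.inl h))
        (Set.union_subset_union (by simp) (by simp))
    · exact (h'.meets x hx).mono (fun _ _ h => PStep_append.2 (.inr h))
        (Set.union_subset_union (by simp) (by simp))
  cut x hx := by
    rw [cutSet_append] at hx ⊢
    rcases hx with hx | hx
    · exact (h.cut x hx).mono (fun _ _ h => PStep_append.2 (.inl h)) (by simp)
    · exact (h'.cut x hx).mono (fun _ _ h => PStep_append.2 (.inr h)) (by simp)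
  sub := by
    rw [sectionSet_append, sectionSet_append]
    exact Set.union_subset_union h.sub h'.sub

theorem Induces.refl {Q : List (Piece A)} (hQ : ∀ p ∈ Q, p.data.Valid) : Induces Q Q where
  ret _ _ h := .last h (h.target_mem hQ)
  meets _ h := .of_mem (.inl h)
  cut _ h := .of_mem h
  sub := subset_rfl

end Induced

/-! ### One step of the Rauzy induction -/

section Rauzy

variable {A : Type} [DecidableEq A]

/-- A criterion for one exchange to be induced by another one that acts on a longer interval with
the same left end, when the returns take at most two steps. -/
theorem Induces.of_two_steps {c : ℝ} {D D' : ExchangeData A} (hD : D.Valid) (hD' : D'.Valid)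
    (htot : D'.total ≤ D.total)
    (ret : ∀ a ∈ D'.top, ∀ x ∈ D'.topInterval a,
      (∃ b ∈ D.top, x ∈ D.topInterval b ∧ D'.act a x = D.act b x) ∨
      ∃ b ∈ D.top, ∃ b' ∈ D.top, x ∈ D.topInterval b ∧ D.act b x ∈ D.topInterval b' ∧
        D'.total ≤ D.act b x ∧ D'.act a x = D.act b' (D.act b x))
    (meets : ∀ x, D'.total ≤ x → x < D.total → (∃ b ∈ D.top, x = D.topLeft b) ∨
      ∃ b ∈ D.top, x ∈ D.topInterval b ∧ D.act b x < D'.total)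
    (cut : ∀ a ∈ D'.top, (∃ b ∈ D.top, D'.topLeft a = D.topLeft b) ∨
      ∃ b ∈ D.top, D'.topLeft a ∈ D.topInterval b ∧
        ∃ b' ∈ D.top, D.act b (D'.topLeft a) = D.topLeft b') :
    Induces [(⟨c, D⟩ : Piece A)] [⟨c, D'⟩] := by
  have step : ∀ {x : ℝ}, ∀ b ∈ D.top, x ∈ D.topInterval b →
      PStep [(⟨c, D⟩ : Piece A)] (c + x) (c + D.act b x) := fun {x} b hb hx =>
    ⟨⟨c, D⟩, by simp, b, hb, Piece.mem_interval.2 (by simpa using hx), by simp⟩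
  constructor
  · rintro x y ⟨p, hp, a, ha, hx, rfl⟩
    have htar : c + D'.act a (x - c) ∈ sectionSet [(⟨c, D'⟩ : Piece A)] := by
      simp only [List.mem_singleton] at hp; subst hp
      exact PStep.target_mem (Q := [(⟨c, D'⟩ : Piece A)]) (by simpa using hD')
        ⟨⟨c, D'⟩, by simp, a, ha, hx, rfl⟩
    simp only [List.mem_singleton] at hp; subst hp
    have hx' := Piece.mem_interval.1 hx
    obtain ⟨x, rfl⟩ : ∃ z, x = c + z := ⟨x - c, by ring⟩
    simp only [add_sub_cancel_left] at *
    rcases ret a ha x hx' with ⟨b, hb, h₁, h₂⟩ | ⟨b, hb, b', hb', h₁, h₂, h₃, h₄⟩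
    · rw [h₂] at htar ⊢
      exact .last (step b hb h₁) htar
    · rw [h₄] at htar ⊢
      refine .next (step b hb h₁) ?_ (.last (step b' hb' h₂) htar)
      simp only [sectionSet_singleton, Piece.carrier, Set.mem_Ico, not_and, not_lt]
      intro _; linarith
  · intro x hx
    by_cases hx' : x ∈ sectionSet [(⟨c, D'⟩ : Piece A)]
    · exact .of_mem (.inl hx')
    obtain ⟨x, rfl⟩ : ∃ z, x = c + z := ⟨x - c, by ring⟩
    simp only [sectionSet_singleton, Piece.carrier, Set.mem_Ico, not_and, not_lt] at hx hx'
    rcases meets x (by linarith [hx' hx.1]) (by linarith) with ⟨b, hb, rfl⟩ | ⟨b, hb, h₁, h₂⟩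
    · exact .of_mem (.inr ⟨⟨c, D⟩, by simp, b, hb, rfl⟩)
    · refine .head (.single (step b hb h₁)) (.of_mem (.inl ?_))
      have := ExchangeData.botInterval_subset hD hb (ExchangeData.act_mem h₁)
      simp only [sectionSet_singleton, Piece.carrier, Set.mem_Ico]
      constructor <;> linarith [this.1]
  · rintro x ⟨p, hp, a, ha, rfl⟩
    simp only [List.mem_singleton] at hp; subst hp
    rcases cut a ha with ⟨b, hb, h⟩ | ⟨b, hb, h₁, b', hb', h₂⟩
    · exact .of_mem ⟨⟨c, D⟩, by simp, b, hb, by simp [h]⟩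
    · refine .head (.single (step b hb h₁)) (.of_mem ⟨⟨c, D⟩, by simp, b', hb', by simp [h₂]⟩)
  · simp only [sectionSet_singleton, Piece.carrier]
    exact Set.Ico_subset_Ico_right (by simpa using htot)

/-- The induction step when the top interval is the longer one: the loser `Y` of the bottom row is
moved next to the winner `X`. -/
theorem induces_of_top_wins {base : ℝ} {t b c b' : List A} {X Y : A} {k : A → ℤˣ} {len : A → ℝ}
    (hXY : X ≠ Y) (hlen : len Y < len X)
    (hb' : (k X = 1 ∧ b' = b ++ X :: Y :: c) ∨ (k X = -1 ∧ b' = b ++ Y :: X :: c))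
    (hD : (⟨t ++ [X], b ++ X :: c ++ [Y], k, len⟩ : ExchangeData A).Valid) :
    (⟨t ++ [X], b', Function.update k Y (k Y * k X),
      Function.update len X (len X - len Y)⟩ : ExchangeData A).Valid ∧
    Induces [(⟨base, ⟨t ++ [X], b ++ X :: c ++ [Y], k, len⟩⟩ : Piece A)]
      [⟨base, ⟨t ++ [X], b', Function.update k Y (k Y * k X),
          Function.update len X (len X - len Y)⟩⟩] := by
  have hnt := hD.nodup
  have hnb : (b ++ X :: c ++ [Y]).Nodup := hD.perm.nodup_iff.2 hnt
  have hp := hD.perm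
  have hpos := hD.pos
  simp only at hnt hp hpos
  set len' := Function.update len X (len X - len Y) with hlen'
  have hXt : X ∉ t := by
    intro h; exact (List.nodup_append.1 hnt).2.2 X h X (by simp) rfl
  have hYt : Y ∈ t := by
    have : Y ∈ t ++ [X] := hp.subset (by simp)
    simpa [hXY.symm] using this
  have hnb' : (X :: Y :: (b ++ c)).Nodup := by
    refine (List.Perm.nodup_iff ?_).1 hnb
    refine (List.perm_append_comm.trans ?_)
    simpa using (List.Perm.cons Y (List.perm_middle (a := X) (l₁ := b) (l₂ := c))).trans
      (List.Perm.swap X Y _)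
  have hXb : X ∉ b := fun h => by simp [h] at hnb'
  have hXc : X ∉ c := fun h => by simp [h] at hnb'
  have hYb : Y ∉ b := fun h => by simp [h] at hnb'
  have hYc : Y ∉ c := fun h => by simp [h] at hnb'
  have hX' : len' X = len X - len Y := by simp [hlen']
  have hne : ∀ z, z ≠ X → len' z = len z := fun z hz => by simp [hlen', hz]
  have hpb' : b'.Perm (b ++ X :: c ++ [Y]) := by
    have h₁ : (b ++ X :: Y :: c).Perm (b ++ X :: c ++ [Y]) := by
      rw [List.append_assoc]
      refine List.Perm.append_left b ?_
      simpa using (List.perm_append_comm (l₁ := [Y]) (l₂ := c))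
    rcases hb' with ⟨_, rfl⟩ | ⟨_, rfl⟩
    · exact h₁
    · exact (List.Perm.append_left b (List.Perm.swap X Y c)).trans h₁
  have hD' : (⟨t ++ [X], b', Function.update k Y (k Y * k X), len'⟩ : ExchangeData A).Valid := by
    refine ⟨hnt, hpb'.trans hp, ?_⟩
    intro a ha
    by_cases h : a = X
    · subst h; simp only [hX']; linarith
    · simp only [hne a h]; exact hpos a ha
  have hYpos : 0 < len Y := hpos Y (by simp [hYt])
  have hct : ∀ z ∈ t, len' z = len z := fun z hz => hne z fun e => hXt (e ▸ hz)
  have hcb : ∀ z ∈ b, len' z = len z := fun z hz => hne z fun e => hXb (e ▸ hz)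
  have hcc : ∀ z ∈ c, len' z = len z := fun z hz => hne z fun e => hXc (e ▸ hz)
  have hwt : wordLength len' t = wordLength len t := wordLength_congr hct
  have hwb : wordLength len' b = wordLength len b := wordLength_congr hcb
  have hwbot : wordLength len (b ++ X :: c ++ [Y]) = wordLength len (t ++ [X]) :=
    wordLength_perm hp
  have hwc0 : 0 ≤ wordLength len c :=
    wordLength_nonneg fun a ha => hpos a (hp.subset (by simp [ha]))
  have hwb0 : 0 ≤ wordLength len b :=
    wordLength_nonneg fun a ha => hpos a (hp.subset (by simp [ha]))
  simp only [wordLength_append, wordLength_cons, wordLength_nil, add_zero] at hwbot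
  -- positions in the two top rows
  have tX : leftEnd len (t ++ [X]) X = wordLength len t := by
    simp [leftEnd_append_of_notMem hXt]
  have tX' : leftEnd len' (t ++ [X]) X = wordLength len t := by
    simp [leftEnd_append_of_notMem hXt, hwt]
  have tz : ∀ z ∈ t, leftEnd len' (t ++ [X]) z = leftEnd len (t ++ [X]) z := fun z hz => by
    rw [leftEnd_append_of_mem hz, leftEnd_append_of_mem hz, leftEnd_congr hct]
  -- positions in the two bottom rows
  have bX : leftEnd len (b ++ X :: c ++ [Y]) X = wordLength len b := by
    rw [List.append_assoc, leftEnd_append_of_notMem hXb]; simp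
  have bY : leftEnd len (b ++ X :: c ++ [Y]) Y = wordLength len t + len X - len Y := by
    rw [leftEnd_append_of_notMem (by simp [hYb, hYc, hXY.symm])]
    simp only [wordLength_append, wordLength_cons, leftEnd_cons_self]; linarith
  have bz : ∀ z ∈ t, z ≠ Y → leftEnd len' b' z = leftEnd len (b ++ X :: c ++ [Y]) z := by
    intro z hz hzY
    have hzX : z ≠ X := fun e => hXt (e ▸ hz)
    rw [List.append_assoc]
    by_cases hzb : z ∈ b
    · rw [leftEnd_append_of_mem hzb]
      rcases hb' with ⟨_, rfl⟩ | ⟨_, rfl⟩ <;>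
        rw [leftEnd_append_of_mem hzb, leftEnd_congr hcb]
    · have hzc : z ∈ c := by
        have : z ∈ b ++ X :: c ++ [Y] := hp.symm.subset (by simp [hz])
        simpa [hzb, hzX, hzY] using this
      rw [leftEnd_append_of_notMem hzb, List.cons_append, leftEnd_cons_of_ne hzX.symm,
        leftEnd_append_of_mem hzc]
      rcases hb' with ⟨_, rfl⟩ | ⟨_, rfl⟩ <;>
        rw [leftEnd_append_of_notMem hzb, leftEnd_cons_of_ne (by tauto),
          leftEnd_cons_of_ne (by tauto), leftEnd_congr hcc, hwb, hX', hne Y hXY.symm] <;> ring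
  have bX' : leftEnd len' b' X =
      if k X = 1 then wordLength len b else wordLength len b + len Y := by
    rcases hb' with ⟨h, rfl⟩ | ⟨h, rfl⟩
    · rw [leftEnd_append_of_notMem hXb]; simp [hwb, h]
    · rw [leftEnd_append_of_notMem hXb, leftEnd_cons_of_ne hXY.symm]
      simp [hwb, h, hne Y hXY.symm]
  have bY' : leftEnd len' b' Y = if k X = 1 then wordLength len b + (len X - len Y)
      else wordLength len b := by
    rcases hb' with ⟨h, rfl⟩ | ⟨h, rfl⟩
    · rw [leftEnd_append_of_notMem hYb, leftEnd_cons_of_ne hXY]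
      simp [hwb, h, hX']
    · rw [leftEnd_append_of_notMem hYb]; simp [hwb, h]
  have htotD : (⟨t ++ [X], b ++ X :: c ++ [Y], k, len⟩ : ExchangeData A).total
      = wordLength len t + len X := by simp [ExchangeData.total]
  have htotD' : (⟨t ++ [X], b', Function.update k Y (k Y * k X), len'⟩ : ExchangeData A).total
      = wordLength len t + (len X - len Y) := by
    simp only [ExchangeData.total, wordLength_append, wordLength_cons, wordLength_nil, hwt, hX']
    ring
  have hkX : k X = 1 ∨ k X = -1 := by tauto
  refine ⟨hD', Induces.of_two_steps hD hD' (by rw [htotD, htotD']; linarith) ?_ ?_ ?_⟩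
  · rintro a ha x hx
    rw [htotD']
    simp only [ExchangeData.topInterval, ExchangeData.act, ExchangeData.topLeft,
      ExchangeData.botLeft] at hx ⊢
    by_cases haX : a = X
    · subst haX
      left
      refine ⟨a, by simp, ?_, ?_⟩
      · rw [tX', hX'] at hx; rw [tX]; exact ⟨hx.1, by linarith [hx.2]⟩
      · rw [bX', bX, tX, tX']
        simp only [Function.update_of_ne hXY, hX']
        rcases hkX with h | h <;> simp [h]
    have hat : a ∈ t := by simpa [haX] using ha
    by_cases haY : a = Y
    · subst haY
      right
      rw [tz a hat, hne a haX] at hx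
      refine ⟨a, ha, X, by simp, hx, ?_, ?_, ?_⟩
      · rw [bY, tX]
        obtain ⟨hx1, hx2⟩ := hx
        split_ifs <;> constructor <;> linarith
      · rw [bY]
        obtain ⟨hx1, hx2⟩ := hx
        split_ifs <;> linarith
      · rw [bY', bY, bX, tX, tz a hat, hne a haX]
        simp only [Function.update_self]
        rcases hkX with h | h <;> rcases Int.units_eq_one_or (k a) with h' | h' <;>
          simp [h, h'] <;> ring
    · left
      refine ⟨a, ha, ?_, ?_⟩
      · rw [tz a hat, hne a haX] at hx; exact hx
      · rw [bz a hat haY, tz a hat, hne a haX]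
        simp only [Function.update_of_ne haY]
  · intro x h₁ h₂
    right
    rw [htotD'] at h₁ ⊢
    rw [htotD] at h₂
    refine ⟨X, by simp, ?_, ?_⟩
    · simp only [ExchangeData.topInterval, ExchangeData.topLeft, tX]
      constructor <;> linarith
    · simp only [ExchangeData.act, ExchangeData.topLeft, ExchangeData.botLeft, tX, bX]
      split_ifs <;> linarith
  · intro a ha
    left
    refine ⟨a, ha, ?_⟩
    simp only [ExchangeData.topLeft]
    by_cases haX : a = X
    · subst haX; rw [tX, tX']
    · exact tz a (by simpa [haX] using ha)

/-- The induction step when the bottom interval is the longer one: the loser `X` of the top row is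
moved next to the winner `Y`. -/
theorem induces_of_bot_wins {base : ℝ} {t s b t' : List A} {X Y : A} {k : A → ℤˣ} {len : A → ℝ}
    (hXY : X ≠ Y) (hlen : len X < len Y)
    (ht' : (k Y = 1 ∧ t' = t ++ Y :: X :: s) ∨ (k Y = -1 ∧ t' = t ++ X :: Y :: s))
    (hD : (⟨t ++ Y :: s ++ [X], b ++ [Y], k, len⟩ : ExchangeData A).Valid) :
    (⟨t', b ++ [Y], Function.update k X (k X * k Y),
      Function.update len Y (len Y - len X)⟩ : ExchangeData A).Valid ∧
    Induces [(⟨base, ⟨t ++ Y :: s ++ [X], b ++ [Y], k, len⟩⟩ : Piece A)]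
      [⟨base, ⟨t', b ++ [Y], Function.update k X (k X * k Y),
          Function.update len Y (len Y - len X)⟩⟩] := by
  have hnt := hD.nodup
  have hnb : (b ++ [Y]).Nodup := hD.perm.nodup_iff.2 hnt
  have hp := hD.perm
  have hpos := hD.pos
  simp only at hnt hp hpos
  set len' := Function.update len Y (len Y - len X) with hlen'
  have hYb : Y ∉ b := by
    intro h; exact (List.nodup_append.1 hnb).2.2 Y h Y (by simp) rfl
  have hXb : X ∈ b := by
    have : X ∈ b ++ [Y] := hp.symm.subset (by simp)
    simpa [hXY] using this
  have hnt' : (Y :: X :: (t ++ s)).Nodup := by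
    refine (List.Perm.nodup_iff ?_).1 hnt
    refine (List.perm_append_comm.trans ?_)
    simpa using (List.Perm.cons X (List.perm_middle (a := Y) (l₁ := t) (l₂ := s))).trans
      (List.Perm.swap Y X _)
  have hXt : X ∉ t := fun h => by simp [h] at hnt'
  have hXs : X ∉ s := fun h => by simp [h] at hnt'
  have hYt : Y ∉ t := fun h => by simp [h] at hnt'
  have hYs : Y ∉ s := fun h => by simp [h] at hnt'
  have hY' : len' Y = len Y - len X := by simp [hlen']
  have hne : ∀ z, z ≠ Y → len' z = len z := fun z hz => by simp [hlen', hz]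
  have hpt' : t'.Perm (t ++ Y :: s ++ [X]) := by
    have h₁ : (t ++ Y :: X :: s).Perm (t ++ Y :: s ++ [X]) := by
      rw [List.append_assoc]
      refine List.Perm.append_left t ?_
      simpa using (List.perm_append_comm (l₁ := [X]) (l₂ := s))
    rcases ht' with ⟨_, rfl⟩ | ⟨_, rfl⟩
    · exact h₁
    · exact (List.Perm.append_left t (List.Perm.swap Y X s)).trans h₁
  have hD' : (⟨t', b ++ [Y], Function.update k X (k X * k Y), len'⟩ : ExchangeData A).Valid := by
    refine ⟨hpt'.nodup_iff.2 hnt, hp.trans hpt'.symm, ?_⟩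
    intro a ha
    by_cases h : a = Y
    · subst h; simp only [hY']; linarith
    · simp only [hne a h]; exact hpos a (hpt'.subset ha)
  have hXpos : 0 < len X := hpos X (by simp)
  have hcb : ∀ z ∈ b, len' z = len z := fun z hz => hne z fun e => hYb (e ▸ hz)
  have hct : ∀ z ∈ t, len' z = len z := fun z hz => hne z fun e => hYt (e ▸ hz)
  have hcs : ∀ z ∈ s, len' z = len z := fun z hz => hne z fun e => hYs (e ▸ hz)
  have hwb : wordLength len' b = wordLength len b := wordLength_congr hcb
  have hwt : wordLength len' t = wordLength len t := wordLength_congr hct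
  have hws : wordLength len' s = wordLength len s := wordLength_congr hcs
  have hwtop := (wordLength_perm (len := len) hp)
  simp only [wordLength_append, wordLength_cons, wordLength_nil, add_zero] at hwtop
  have hws0 : 0 ≤ wordLength len s := wordLength_nonneg fun a ha => hpos a (by simp [ha])
  have hwt0 : 0 ≤ wordLength len t := wordLength_nonneg fun a ha => hpos a (by simp [ha])
  -- positions in the two top rows
  have tX : leftEnd len (t ++ Y :: s ++ [X]) X = wordLength len b + len Y - len X := by
    rw [leftEnd_append_of_notMem (by simp [hXt, hXs, hXY])]
    simp only [wordLength_append, wordLength_cons, leftEnd_cons_self]; linarith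
  have tY : leftEnd len (t ++ Y :: s ++ [X]) Y = wordLength len t := by
    rw [List.append_assoc, leftEnd_append_of_notMem hYt]; simp
  have tX' : leftEnd len' t' X = if k Y = 1 then wordLength len t + (len Y - len X)
      else wordLength len t := by
    rcases ht' with ⟨h, rfl⟩ | ⟨h, rfl⟩
    · rw [leftEnd_append_of_notMem hXt, leftEnd_cons_of_ne hXY.symm]
      simp [hwt, h, hY']
    · rw [leftEnd_append_of_notMem hXt]; simp [hwt, h]
  have tY' : leftEnd len' t' Y = if k Y = 1 then wordLength len t
      else wordLength len t + len X := by
    rcases ht' with ⟨h, rfl⟩ | ⟨h, rfl⟩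
    · rw [leftEnd_append_of_notMem hYt]; simp [hwt, h]
    · rw [leftEnd_append_of_notMem hYt, leftEnd_cons_of_ne hXY]
      simp [hwt, h, hne X hXY]
  have tz : ∀ z ∈ t', z ≠ X → z ≠ Y →
      leftEnd len' t' z = leftEnd len (t ++ Y :: s ++ [X]) z := by
    intro z hz hzX hzY
    rw [List.append_assoc]
    by_cases hzt : z ∈ t
    · rw [leftEnd_append_of_mem hzt]
      rcases ht' with ⟨_, rfl⟩ | ⟨_, rfl⟩ <;>
        rw [leftEnd_append_of_mem hzt, leftEnd_congr hct]
    · have hzs : z ∈ s := by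
        have : z ∈ t ++ Y :: s ++ [X] := hpt'.subset hz
        simpa [hzt, hzX, hzY] using this
      rw [leftEnd_append_of_notMem hzt, List.cons_append, leftEnd_cons_of_ne hzY.symm,
        leftEnd_append_of_mem hzs]
      rcases ht' with ⟨_, rfl⟩ | ⟨_, rfl⟩ <;>
        rw [leftEnd_append_of_notMem hzt, leftEnd_cons_of_ne (by tauto),
          leftEnd_cons_of_ne (by tauto), leftEnd_congr hcs, hwt, hY', hne X hXY] <;> ring
  -- positions in the two bottom rows
  have bY : leftEnd len (b ++ [Y]) Y = wordLength len b := by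
    simp [leftEnd_append_of_notMem hYb]
  have bY' : leftEnd len' (b ++ [Y]) Y = wordLength len b := by
    simp [leftEnd_append_of_notMem hYb, hwb]
  have bz : ∀ z ∈ b, leftEnd len' (b ++ [Y]) z = leftEnd len (b ++ [Y]) z := fun z hz => by
    rw [leftEnd_append_of_mem hz, leftEnd_append_of_mem hz, leftEnd_congr hcb]
  have bXle : leftEnd len (b ++ [Y]) X + len X ≤ wordLength len b := by
    rw [leftEnd_append_of_mem hXb]
    exact leftEnd_add_le (fun a ha => hpos a (hp.subset (by simp [ha]))) hXb
  have htotD : (⟨t ++ Y :: s ++ [X], b ++ [Y], k, len⟩ : ExchangeData A).total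
      = wordLength len b + len Y := by
    simp only [ExchangeData.total, wordLength_append, wordLength_cons, wordLength_nil]; linarith
  have htotD' : (⟨t', b ++ [Y], Function.update k X (k X * k Y), len'⟩ : ExchangeData A).total
      = wordLength len b + (len Y - len X) := by
    rw [ExchangeData.total, ← wordLength_perm hD'.perm]
    simp [hwb, hY']
  have hkY : k Y = 1 ∨ k Y = -1 := by tauto
  have hmem : ∀ a ∈ t', a ∈ t ++ Y :: s ++ [X] := fun a ha => hpt'.subset ha
  refine ⟨hD', Induces.of_two_steps hD hD' (by rw [htotD, htotD']; linarith) ?_ ?_ ?_⟩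
  · rintro a ha x hx
    rw [htotD']
    simp only [ExchangeData.topInterval, ExchangeData.act, ExchangeData.topLeft,
      ExchangeData.botLeft] at ha hx ⊢
    by_cases haY : a = Y
    · subst haY
      left
      refine ⟨a, by simp, ?_, ?_⟩
      · rw [tY', hY'] at hx; rw [tY]
        rcases hkY with h | h <;> simp [h] at hx <;> constructor <;> linarith [hx.1, hx.2]
      · rw [bY', bY, tY, tY']
        simp only [Function.update_of_ne hXY.symm, hY']
        rcases hkY with h | h <;> simp [h]; ring
    by_cases haX : a = X
    · subst haX
      right
      rw [tX', hne a haY] at hx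
      refine ⟨Y, by simp, a, by simp, ?_, ?_, ?_, ?_⟩
      · rw [tY]
        rcases hkY with h | h <;> simp [h] at hx <;> constructor <;> linarith [hx.1, hx.2]
      · rw [bY, tX, tY]
        rcases hkY with h | h <;> simp [h] at hx ⊢ <;> constructor <;> linarith [hx.1, hx.2]
      · rw [bY, tY]
        rcases hkY with h | h <;> simp [h] at hx ⊢ <;> linarith [hx.1, hx.2]
      · rw [bY, tX, tY, tX', bz a hXb, hne a haY]
        simp only [Function.update_self]
        rcases hkY with h | h <;> rcases Int.units_eq_one_or (k a) with h' | h' <;>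
          simp [h, h'] <;> ring
    · left
      have hab : a ∈ b := by
        have : a ∈ b ++ [Y] := hp.symm.subset (hmem a ha)
        simpa [haY] using this
      refine ⟨a, hmem a ha, ?_, ?_⟩
      · rw [tz a ha haX haY, hne a haY] at hx; exact hx
      · rw [bz a hab, tz a ha haX haY, hne a haY]
        simp only [Function.update_of_ne haX]
  · intro x h₁ h₂
    rw [htotD'] at h₁ ⊢
    rw [htotD] at h₂
    rcases h₁.eq_or_lt with h | h
    · exact .inl ⟨X, by simp, by simp only [ExchangeData.topLeft]; rw [tX]; linarith⟩
    right
    refine ⟨X, by simp, ?_, ?_⟩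
    · simp only [ExchangeData.topInterval, ExchangeData.topLeft]; rw [tX]
      constructor <;> linarith
    · simp only [ExchangeData.act, ExchangeData.topLeft, ExchangeData.botLeft]; rw [tX]
      split_ifs <;> linarith
  · intro a ha
    simp only [ExchangeData.topLeft, ExchangeData.topInterval, ExchangeData.act,
      ExchangeData.botLeft] at ha ⊢
    by_cases haX : a = X
    · subst haX
      rcases hkY with h | h
      · refine .inr ⟨Y, by simp, ?_, a, by simp, ?_⟩
        · rw [tX', tY]; simp [h]; constructor <;> linarith
        · rw [tX', tY, bY, tX]; simp [h]; ring
      · exact .inl ⟨Y, by simp, by rw [tX', tY]; simp [h]⟩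
    by_cases haY : a = Y
    · subst haY
      rcases hkY with h | h
      · exact .inl ⟨a, by simp, by rw [tY', tY]; simp [h]⟩
      · refine .inr ⟨a, by simp, ?_, X, by simp, ?_⟩
        · rw [tY', tY]; simp [h]; constructor <;> linarith
        · rw [tY', tY, bY, tX]; simp [h]
    · exact .inl ⟨a, hmem a ha, tz a ha haX haY⟩

theorem induces_of_rauzyStep {base : ℝ} {D D' : ExchangeData A} (hD : D.Valid)
    (h : D.RauzyStep D') :
    D'.Valid ∧ Induces [(⟨base, D⟩ : Piece A)] [⟨base, D'⟩] := by
  cases h with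
  | top_keep t b c X Y k len hXY hlen hk =>
    exact induces_of_top_wins hXY hlen (.inl ⟨hk, rfl⟩) hD
  | top_flip t b c X Y k len hXY hlen hk =>
    exact induces_of_top_wins hXY hlen (.inr ⟨hk, rfl⟩) hD
  | bot_keep t s b X Y k len hXY hlen hk =>
    exact induces_of_bot_wins hXY hlen (.inl ⟨hk, rfl⟩) hD
  | bot_flip t s b X Y k len hXY hlen hk =>
    exact induces_of_bot_wins hXY hlen (.inr ⟨hk, rfl⟩) hD

end Rauzy

/-! ### Sections of reducible and of stopped exchanges -/

section Section

variable {A : Type} [DecidableEq A]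

/-- The components of a reducible exchange are invariant. -/
theorem induces_components {base : ℝ} {t₁ t₂ b₁ b₂ : List A} {k : A → ℤˣ} {len : A → ℝ}
    (hperm : b₁.Perm t₁)
    (hD : (⟨t₁ ++ t₂, b₁ ++ b₂, k, len⟩ : ExchangeData A).Valid) :
    (⟨t₁, b₁, k, len⟩ : ExchangeData A).Valid ∧ (⟨t₂, b₂, k, len⟩ : ExchangeData A).Valid ∧
    Induces [(⟨base, ⟨t₁ ++ t₂, b₁ ++ b₂, k, len⟩⟩ : Piece A)]
      [⟨base, ⟨t₁, b₁, k, len⟩⟩, ⟨base + wordLength len t₁, ⟨t₂, b₂, k, len⟩⟩] := by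
  obtain ⟨hn, hp, hpos⟩ := hD
  simp only at hn hp hpos
  have hperm₂ : b₂.Perm t₂ := by
    have := (hperm.symm.append_right b₂).trans hp
    exact (List.perm_append_left_iff t₁).1 this
  have hD₁ : (⟨t₁, b₁, k, len⟩ : ExchangeData A).Valid :=
    ⟨(List.nodup_append.1 hn).1, hperm, fun a ha => hpos a (by simp [show a ∈ t₁ from ha])⟩
  have hD₂ : (⟨t₂, b₂, k, len⟩ : ExchangeData A).Valid :=
    ⟨(List.nodup_append.1 hn).2.1, hperm₂, fun a ha => hpos a (by simp [show a ∈ t₂ from ha])⟩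
  have hdis : ∀ a ∈ t₂, a ∉ t₁ := fun a ha h => (List.nodup_append.1 hn).2.2 a h a ha rfl
  have hw₁ : 0 ≤ wordLength len t₁ := wordLength_nonneg hD₁.pos
  have hw₂ : 0 ≤ wordLength len t₂ := wordLength_nonneg hD₂.pos
  refine ⟨hD₁, hD₂, ?_⟩
  have hval : ∀ p ∈ [(⟨base, ⟨t₁, b₁, k, len⟩⟩ : Piece A),
      ⟨base + wordLength len t₁, ⟨t₂, b₂, k, len⟩⟩], p.data.Valid := by
    intro p hp; simp only [List.mem_cons, List.not_mem_nil, or_false] at hp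
    rcases hp with rfl | rfl
    · exact hD₁
    · exact hD₂
  have hsec : sectionSet [(⟨base, ⟨t₁, b₁, k, len⟩⟩ : Piece A),
      ⟨base + wordLength len t₁, ⟨t₂, b₂, k, len⟩⟩]
      = sectionSet [(⟨base, ⟨t₁ ++ t₂, b₁ ++ b₂, k, len⟩⟩ : Piece A)] := by
    ext x
    simp only [sectionSet, List.mem_cons, List.not_mem_nil, or_false, exists_eq_or_imp,
      exists_eq_left, Piece.carrier, Set.mem_Ico, ExchangeData.total, wordLength_append,
      Set.mem_ofPred_eq]
    constructor
    · rintro (⟨h₁, h₂⟩ | ⟨h₁, h₂⟩) <;> constructor <;> linarith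
    · rintro ⟨h₁, h₂⟩
      by_cases h : x < base + wordLength len t₁
      · exact .inl ⟨h₁, h⟩
      · exact .inr ⟨by linarith, by linarith⟩
  have pos₁ : ∀ a ∈ t₁, leftEnd len (t₁ ++ t₂) a = leftEnd len t₁ a ∧
      leftEnd len (b₁ ++ b₂) a = leftEnd len b₁ a := fun a ha =>
    ⟨leftEnd_append_of_mem ha _, leftEnd_append_of_mem (hperm.symm.subset ha) _⟩
  have pos₂ : ∀ a ∈ t₂, leftEnd len (t₁ ++ t₂) a = wordLength len t₁ + leftEnd len t₂ a ∧
      leftEnd len (b₁ ++ b₂) a = wordLength len t₁ + leftEnd len b₂ a := fun a ha =>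
    ⟨leftEnd_append_of_notMem (hdis a ha) _, by
      rw [leftEnd_append_of_notMem fun h => hdis a ha (hperm.subset h), wordLength_perm hperm]⟩
  have hstep : ∀ x y, PStep [(⟨base, ⟨t₁, b₁, k, len⟩⟩ : Piece A),
      ⟨base + wordLength len t₁, ⟨t₂, b₂, k, len⟩⟩] x y →
      PStep [(⟨base, ⟨t₁ ++ t₂, b₁ ++ b₂, k, len⟩⟩ : Piece A)] x y := by
    rintro x y ⟨p, hp, a, ha, hx, rfl⟩
    simp only [List.mem_cons, List.not_mem_nil, or_false] at hp
    rcases hp with rfl | rfl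
    · refine ⟨_, List.mem_singleton_self _, a, List.mem_append_left _ ha, ?_, ?_⟩
      · simp only [Piece.interval, ExchangeData.topLeft, (pos₁ a ha).1] at hx ⊢; exact hx
      · simp only [ExchangeData.act, ExchangeData.topLeft, ExchangeData.botLeft, (pos₁ a ha).1,
          (pos₁ a ha).2]
    · refine ⟨_, List.mem_singleton_self _, a, List.mem_append_right _ ha, ?_, ?_⟩
      · simp only [Piece.interval, ExchangeData.topLeft, (pos₂ a ha).1] at hx ⊢
        rw [← add_assoc]; exact hx
      · simp only [ExchangeData.act, ExchangeData.topLeft, ExchangeData.botLeft, (pos₂ a ha).1,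
          (pos₂ a ha).2]
        split_ifs <;> ring
  refine ⟨fun x y h => .last (hstep x y h) (h.target_mem hval),
    fun x hx => .of_mem (.inl (hsec ▸ hx)), ?_, hsec.subset⟩
  rintro x ⟨p, hp, a, ha, rfl⟩
  simp only [List.mem_cons, List.not_mem_nil, or_false] at hp
  rcases hp with rfl | rfl
  · exact .of_mem ⟨_, List.mem_singleton_self _, a, List.mem_append_left _ ha, by
      simp only [ExchangeData.topLeft, (pos₁ a ha).1]⟩
  · exact .of_mem ⟨_, List.mem_singleton_self _, a, List.mem_append_right _ ha, by
      simp only [ExchangeData.topLeft, (pos₂ a ha).1]; ring⟩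

/-- When the last intervals have the same length and different letters, the interval `Y` is mapped
onto the last top interval `X`, and `X` can be left out. -/
theorem induces_of_equal_lengths {base : ℝ} {t b d : List A} {X Y : A} {k : A → ℤˣ} {len : A → ℝ}
    (hXY : X ≠ Y) (hlen : len X = len Y)
    (hD : (⟨t ++ [X], b ++ X :: d ++ [Y], k, len⟩ : ExchangeData A).Valid) :
    (⟨t, b ++ Y :: d, Function.update k Y (k Y * k X), len⟩ : ExchangeData A).Valid ∧
    Induces [(⟨base, ⟨t ++ [X], b ++ X :: d ++ [Y], k, len⟩⟩ : Piece A)]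
      [⟨base, ⟨t, b ++ Y :: d, Function.update k Y (k Y * k X), len⟩⟩] := by
  have hnt := hD.nodup
  have hnb : (b ++ X :: d ++ [Y]).Nodup := hD.perm.nodup_iff.2 hnt
  have hp := hD.perm
  have hpos := hD.pos
  simp only at hnt hp hpos
  have hXt : X ∉ t := by
    intro h; exact (List.nodup_append.1 hnt).2.2 X h X (by simp) rfl
  have hYt : Y ∈ t := by
    have : Y ∈ t ++ [X] := hp.subset (by simp)
    simpa [hXY.symm] using this
  have hpX : (X :: (b ++ Y :: d)).Perm (b ++ X :: d ++ [Y]) := by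
    rw [List.append_assoc]
    refine List.perm_middle.symm.trans (List.Perm.append_left b (List.Perm.cons X ?_))
    exact List.perm_append_comm (l₁ := [Y]) (l₂ := d)
  have hnb' := hpX.nodup_iff.2 hnb
  have hp' : (b ++ Y :: d).Perm t := by
    have := (hpX.trans hp).trans List.perm_append_comm
    exact List.Perm.cons_inv this
  rw [List.nodup_cons] at hnb'
  have hXb : X ∉ b := fun h => hnb'.1 (by simp [h])
  have hXd : X ∉ d := fun h => hnb'.1 (by simp [h])
  have hnY := (List.perm_middle.nodup_iff (α := A)).1 hnb'.2
  rw [List.nodup_cons] at hnY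
  have hYb : Y ∉ b := fun h => hnY.1 (by simp [h])
  have hYd : Y ∉ d := fun h => hnY.1 (by simp [h])
  have hD' : (⟨t, b ++ Y :: d, Function.update k Y (k Y * k X), len⟩ : ExchangeData A).Valid :=
    ⟨(List.nodup_append.1 hnt).1, hp', fun a ha => hpos a (by simp [show a ∈ t from ha])⟩
  have hwbot : wordLength len (b ++ X :: d ++ [Y]) = wordLength len (t ++ [X]) :=
    wordLength_perm hp
  simp only [wordLength_append, wordLength_cons, wordLength_nil, add_zero] at hwbot
  have hwd0 : 0 ≤ wordLength len d :=
    wordLength_nonneg fun a ha => hpos a (hp.subset (by simp [ha]))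
  have hXpos : 0 < len X := hpos X (by simp)
  have tX : leftEnd len (t ++ [X]) X = wordLength len t := by
    simp [leftEnd_append_of_notMem hXt]
  have tz : ∀ z ∈ t, leftEnd len t z = leftEnd len (t ++ [X]) z := fun z hz => by
    rw [leftEnd_append_of_mem hz]
  have bX : leftEnd len (b ++ X :: d ++ [Y]) X = wordLength len b := by
    rw [List.append_assoc, leftEnd_append_of_notMem hXb]; simp
  have bY : leftEnd len (b ++ X :: d ++ [Y]) Y = wordLength len t := by
    rw [leftEnd_append_of_notMem (by simp [hYb, hYd, hXY.symm])]
    simp only [wordLength_append, wordLength_cons, leftEnd_cons_self]; linarith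
  have bY' : leftEnd len (b ++ Y :: d) Y = wordLength len b := by
    rw [leftEnd_append_of_notMem hYb]; simp
  have bz : ∀ z ∈ t, z ≠ Y →
      leftEnd len (b ++ Y :: d) z = leftEnd len (b ++ X :: d ++ [Y]) z := by
    intro z hz hzY
    have hzX : z ≠ X := fun e => hXt (e ▸ hz)
    rw [List.append_assoc]
    by_cases hzb : z ∈ b
    · rw [leftEnd_append_of_mem hzb, leftEnd_append_of_mem hzb]
    · have hzd : z ∈ d := by
        have : z ∈ b ++ X :: d ++ [Y] := hp.symm.subset (by simp [hz])
        simpa [hzb, hzX, hzY] using this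
      rw [leftEnd_append_of_notMem hzb, leftEnd_cons_of_ne hzY.symm, leftEnd_append_of_notMem hzb,
        List.cons_append, leftEnd_cons_of_ne hzX.symm, leftEnd_append_of_mem hzd, hlen]
  have htotD : (⟨t ++ [X], b ++ X :: d ++ [Y], k, len⟩ : ExchangeData A).total
      = wordLength len t + len X := by simp [ExchangeData.total]
  have htotD' : (⟨t, b ++ Y :: d, Function.update k Y (k Y * k X), len⟩ : ExchangeData A).total
      = wordLength len t := rfl
  refine ⟨hD', Induces.of_two_steps hD hD' (by rw [htotD, htotD']; linarith) ?_ ?_ ?_⟩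
  · rintro a ha x hx
    rw [htotD']
    simp only [ExchangeData.topInterval, ExchangeData.act, ExchangeData.topLeft,
      ExchangeData.botLeft] at ha hx ⊢
    rw [tz a ha] at hx
    by_cases haY : a = Y
    · subst haY
      right
      refine ⟨a, by simp [ha], X, by simp, hx, ?_, ?_, ?_⟩
      · rw [bY, tX]
        obtain ⟨hx1, hx2⟩ := hx
        split_ifs <;> constructor <;> linarith
      · rw [bY]
        obtain ⟨hx1, hx2⟩ := hx
        split_ifs <;> linarith
      · rw [bY', bY, bX, tX, tz a ha]
        simp only [Function.update_self]
        rcases Int.units_eq_one_or (k X) with h | h <;>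
          rcases Int.units_eq_one_or (k a) with h' | h' <;> simp [h, h'] <;> linarith
    · left
      refine ⟨a, by simp [ha], hx, ?_⟩
      rw [bz a ha haY, tz a ha]
      simp only [Function.update_of_ne haY]
  · intro x h₁ h₂
    rw [htotD'] at h₁ ⊢
    rw [htotD] at h₂
    rcases h₁.eq_or_lt with h | h
    · exact .inl ⟨X, by simp, by simp only [ExchangeData.topLeft]; rw [tX, h]⟩
    right
    refine ⟨X, by simp, ?_, ?_⟩
    · simp only [ExchangeData.topInterval, ExchangeData.topLeft, tX]
      constructor <;> linarith
    · simp only [ExchangeData.act, ExchangeData.topLeft, ExchangeData.botLeft, tX, bX]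
      split_ifs <;> linarith
  · intro a ha
    simp only [ExchangeData.topLeft] at ha ⊢
    exact .inl ⟨a, by simp [ha], tz a ha⟩

theorem induces_of_rauzySteps {base : ℝ} {D D' : ExchangeData A} (hD : D.Valid)
    (h : Relation.ReflTransGen ExchangeData.RauzyStep D D') :
    D'.Valid ∧ Induces [(⟨base, D⟩ : Piece A)] [⟨base, D'⟩] := by
  induction h with
  | refl => exact ⟨hD, .refl (by simpa using hD)⟩
  | tail _ h ih =>
    obtain ⟨h₁, h₂⟩ := induces_of_rauzyStep (base := base) ih.1 h
    exact ⟨h₁, ih.2.trans h₂⟩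

omit [DecidableEq A] in
theorem disjoint_carrier_of_components {base : ℝ} {t₁ t₂ b₁ b₂ : List A} {k : A → ℤˣ}
    {len : A → ℝ} :
    Disjoint (sectionSet [(⟨base, ⟨t₁, b₁, k, len⟩⟩ : Piece A)])
      (sectionSet [(⟨base + wordLength len t₁, ⟨t₂, b₂, k, len⟩⟩ : Piece A)]) := by
  rw [sectionSet_singleton, sectionSet_singleton, Set.disjoint_left]
  intro x hx hx'
  exact absurd hx.2 (not_lt.2 hx'.1)

omit [DecidableEq A] in
theorem pairwise_disjoint_append {P P' : List (Piece A)} {S S' : Set ℝ}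
    (h : P.Pairwise fun p q => Disjoint p.carrier q.carrier)
    (h' : P'.Pairwise fun p q => Disjoint p.carrier q.carrier) (hS : sectionSet P ⊆ S)
    (hS' : sectionSet P' ⊆ S') (hd : Disjoint S S') :
    (P ++ P').Pairwise fun p q => Disjoint p.carrier q.carrier := by
  refine List.pairwise_append.2 ⟨h, h', fun p hp q hq => ?_⟩
  exact Set.disjoint_of_subset (fun x hx => hS ⟨p, hp, hx⟩) (fun x hx => hS' ⟨q, hq, hx⟩) hd

/-- The Poincaré-Rauzy construction yields a section of the exchange it starts from, and the data of
the pieces describe the first return map. -/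
theorem IsPoincareRauzySection.induces {base : ℝ} {D : ExchangeData A} {P : List (Piece A)}
    (h : IsPoincareRauzySection base D P) (hD : D.Valid) :
    (∀ p ∈ P, p.data.Valid) ∧ (P.Pairwise fun p q => Disjoint p.carrier q.carrier) ∧
      Induces [(⟨base, D⟩ : Piece A)] P := by
  induction h with
  | simple c D hs => exact ⟨by simpa using hD, by simp, .refl (by simpa using hD)⟩
  | infinite c D hs hirr R hR hstep =>
    exact ⟨by simpa using hD, by simp, .refl (by simpa using hD)⟩
  | components c t₁ t₂ b₁ b₂ k len P₁ P₂ hs ht₁ ht₂ hperm hirr h₁ h₂ ih₁ ih₂ =>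
    obtain ⟨hD₁, hD₂, hi⟩ := induces_components (base := c) hperm hD
    obtain ⟨v₁, d₁, i₁⟩ := ih₁ hD₁
    obtain ⟨v₂, d₂, i₂⟩ := ih₂ hD₂
    refine ⟨fun p hp => ?_, pairwise_disjoint_append d₁ d₂ i₁.sub i₂.sub
      disjoint_carrier_of_components, ?_⟩
    · rcases List.mem_append.1 hp with hp | hp
      · exact v₁ p hp
      · exact v₂ p hp
    · exact hi.trans (i₁.append i₂ (by simpa using hD₁) (by simpa using hD₂)
        disjoint_carrier_of_components)
  | stop_same c D hs hirr t b X k len hR P hP ih =>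
    obtain ⟨hD', hi'⟩ := induces_of_rauzySteps (base := c) hD hR
    obtain ⟨hD₁, hD₂, hi⟩ := induces_components (base := c)
      ((List.perm_append_right_iff [X]).1 hD'.perm) hD'
    obtain ⟨v₁, d₁, i₁⟩ := ih hD₁
    refine ⟨fun p hp => ?_, pairwise_disjoint_append d₁ (by simp) i₁.sub subset_rfl
      disjoint_carrier_of_components, ?_⟩
    · rcases List.mem_append.1 hp with hp | hp
      · exact v₁ p hp
      · simp only [List.mem_singleton] at hp; subst hp; exact hD₂
    · exact hi'.trans (hi.trans (i₁.append (.refl (by simpa using hD₂)) (by simpa using hD₁)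
        (by simpa using hD₂) disjoint_carrier_of_components))
  | stop_distinct c D hs hirr t b d X Y k len hXY hlen hR P hP ih =>
    obtain ⟨hD', hi'⟩ := induces_of_rauzySteps (base := c) hD hR
    obtain ⟨hD₁, hi⟩ := induces_of_equal_lengths (base := c) hXY hlen hD'
    obtain ⟨v₁, d₁, i₁⟩ := ih hD₁
    exact ⟨v₁, d₁, hi'.trans (hi.trans i₁)⟩

end Section

/-! ### Patterns of exchanges -/

/-- A letter of a pattern is marked with its flip and with two integers: `v`, its coefficient in a
linear form that detects the integer relations between the lengths (see `Pattern.Independent`), and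
`d`, its coefficient in a linear form of the lengths that the Rauzy induction conserves (see
`Pattern.form`). -/
structure Mark where
  flip : Bool
  v : ℤ
  d : ℤ
deriving BEq, ReflBEq, LawfulBEq

/-- The combinatorial part of an exchange. The flag `ind` records that every integer relation `r`
between the lengths with `∑ r i * v i = 0` is trivial, and `prev` is the letter that lost the
preceding step of the Rauzy induction; it is recorded only if the conserved form is not zero. -/
structure Pattern where
  top : List ℕ
  bot : List ℕ
  mark : ℕ → Mark
  ind : Bool
  prev : Option ℕ

/-- A pattern whose letters are numbered `0, 1, …` along the top row. -/
structure Code where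
  bot : List ℕ
  marks : List Mark
  ind : Bool
  prev : Option ℕ
deriving BEq, ReflBEq, LawfulBEq

/-- Insert `y` next to `x`: before it if `f` holds, after it otherwise. -/
def insertBeside (f : Bool) (x y : ℕ) : List ℕ → List ℕ
  | [] => []
  | z :: w => if z = x then (if f then y :: z :: w else z :: y :: w)
      else z :: insertBeside f x y w

namespace Pattern

/-- Exchange the two rows. -/
def swap (s : Pattern) : Pattern := ⟨s.bot, s.top, s.mark, s.ind, s.prev⟩

/-- Some coefficient of the conserved form does not vanish. -/
def alive (s : Pattern) : Bool := s.top.any fun i => (s.mark i).d ≠ 0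

/-- The last letter of the top row. -/
def lastTop (s : Pattern) : ℕ := s.top.getLastD 0

/-- The last letter of the bottom row. -/
def lastBot (s : Pattern) : ℕ := s.bot.getLastD 0

/-- The marks after a step of the Rauzy induction in which `w` beats `x`. As the length of `w`
decreases by that of `x`, so does its coefficient `v`, whereas the coefficients `d` change
contragrediently, so that the form they define keeps its value. -/
def stepMark (m : ℕ → Mark) (w x : ℕ) : ℕ → Mark :=
  Function.update
    (Function.update m x ⟨xor (m x).flip (m w).flip, (m x).v, (m x).d + (m w).d⟩)
    w ⟨(m w).flip, (m w).v - (m x).v, (m w).d⟩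

/-- The step of the Rauzy induction won by the last top letter. -/
def moveTop (s : Pattern) : Pattern :=
  ⟨s.top, insertBeside (s.mark s.lastTop).flip s.lastTop s.lastBot s.bot.dropLast,
    stepMark s.mark s.lastTop s.lastBot, s.ind, if s.alive then some s.lastBot else none⟩

/-- The step of the Rauzy induction won by the last bottom letter. -/
def moveBot (s : Pattern) : Pattern := s.swap.moveTop.swap

/-- Restriction to some of the letters; the conserved form is forgotten. -/
def restrict (s : Pattern) (t b : List ℕ) : Pattern :=
  ⟨t, b, fun i => ⟨(s.mark i).flip, (s.mark i).v, 0⟩, s.ind, none⟩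

/-- The pattern that is left when the last letters `x` (top) and `y` (bottom) differ and have the
same length: `x` is left out and `y` takes its place in the bottom row. If `v x ≠ v y`, the equality
of the two lengths is a relation on which the form `v` does not vanish. As `v` is injective on the
relations, these have rank one; hence the remaining lengths are independent, and `v` can be put
to `0`. -/
def merge (s : Pattern) : Pattern :=
  let x := s.lastTop
  let y := s.lastBot
  ⟨s.top.dropLast, s.bot.dropLast.map fun z => if z = x then y else z,
    fun i => if i = y then ⟨xor (s.mark y).flip (s.mark x).flip, 0, (s.mark y).d + (s.mark x).d⟩
      else ⟨(s.mark i).flip, 0, (s.mark i).d⟩,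
    s.ind && (s.mark x).v ≠ (s.mark y).v, none⟩

/-- Some coefficient of the conserved form is positive. -/
def hasPos (s : Pattern) : Bool := s.top.any fun i => 0 < (s.mark i).d

/-- Renumber the letters along the top row. -/
def code (s : Pattern) : Code :=
  ⟨s.bot.map fun i => s.top.idxOf i, s.top.map s.mark, s.ind, s.prev.map fun i => s.top.idxOf i⟩

/-- If `w` beats `x` and `big` holds, the conserved form is at most the length of `x` or at most the
length of the preceding loser. -/
def big (s : Pattern) (w x : ℕ) : Bool :=
  ((s.mark x).d == 1 && s.top.all fun i => i == x || (s.mark i).d ≤ 0) ||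
  match s.prev with
  | none => false
  | some p => p != x && p != w && (s.mark p).d == 1 && (s.mark x).d == 1 && (s.mark w).d == -1 &&
      s.top.all fun i => i == x || i == p || (s.mark i).d ≤ 0

end Pattern

namespace Code

/-- The number of letters. -/
def size (c : Code) : ℕ := c.marks.length

/-- The pattern with a given code. -/
def pattern (c : Code) : Pattern :=
  ⟨List.range c.size, c.bot, fun i => c.marks.getD i ⟨false, 0, 0⟩, c.ind, c.prev⟩

/-- The step of the Rauzy induction won by the last top letter. -/
def nextTop (c : Code) : Code := c.pattern.moveTop.code

/-- The step of the Rauzy induction won by the last bottom letter. -/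
def nextBot (c : Code) : Code := c.pattern.moveBot.code

/-- The first `i` letters of the bottom row are the first `i` letters of the top row. -/
def splits (c : Code) (i : ℕ) : Bool := (c.bot.take i).all (· < i)

/-- The pattern is reducible, with a first component of `i` letters. -/
def isCut (c : Code) (i : ℕ) : Bool := 0 < i && i < c.size && c.splits i

/-- The part of the pattern to the left of a cut. -/
def left (c : Code) (i : ℕ) : Code :=
  (c.pattern.restrict ((List.range c.size).take i) (c.bot.take i)).code

/-- The part of the pattern to the right of a cut. -/
def right (c : Code) (i : ℕ) : Code :=
  (c.pattern.restrict ((List.range c.size).drop i) (c.bot.drop i)).code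

/-- What is left when both rows end with the same letter. -/
def stopSame (c : Code) : Code :=
  (c.pattern.restrict (List.range c.size).dropLast c.bot.dropLast).code

/-- What is left when the last letters differ and have the same length. -/
def stopDistinct (c : Code) : Code := c.pattern.merge.code

/-- The letter `i` occupies the same place in the two rows. -/
def fixed (c : Code) (i : ℕ) : Bool := c.splits i && c.bot[i]? == some i

/-- The letter `i` is flipped. -/
def fl (c : Code) (i : ℕ) : Bool := (c.pattern.mark i).flip

/-- The letters `i` and `i + 1` are exchanged by a rotation with independent lengths. -/
def rot (c : Code) (i : ℕ) : Bool :=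
  i + 1 < c.size && !c.fl i && !c.fl (i + 1) && c.splits i && c.bot[i]? == some (i + 1) &&
    c.bot[i + 1]? == some i && (c.pattern.mark i).v == 0 && (c.pattern.mark (i + 1)).v == 0

/-- The letters, in the order of the top row. -/
def letters (c : Code) : List ℕ := List.range c.size

/-- A condition that every simple pattern satisfies. -/
def maybeSimple (c : Code) : Bool := c.letters.all fun i => !c.fl i || c.fixed i

/-- A condition that implies simplicity. -/
def surelySimple (c : Code) : Bool :=
  c.bot == c.letters || (c.bot == [1, 0] && c.letters == [0, 1] && !c.fl 0 && !c.fl 1)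

/-- Every letter is fixed and flipped or belongs to a rotation of two letters. -/
def good (c : Code) : Bool :=
  c.letters.all fun i => (c.fl i && c.fixed i) || c.rot i || (0 < i && c.rot (i - 1))

/-- Both rows end with the same letter. -/
def done (c : Code) : Bool := c.pattern.lastTop == c.pattern.lastBot

/-- The last letters cannot have the same length, since the positive conserved form would have no
positive coefficient after they are merged. -/
def skip (c : Code) : Bool := c.pattern.alive && !c.pattern.merge.hasPos

/-- The edges of the Rauzy graph along which no loser is known to be long. The flag tells whether
the top letter wins. -/
def weak (c : Code) : List (Bool × Code) :=
  if c.done then [] else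
  (if c.pattern.big c.pattern.lastTop c.pattern.lastBot then [] else [(true, c.nextTop)]) ++
  (if c.pattern.big c.pattern.lastBot c.pattern.lastTop then [] else [(false, c.nextBot)])

end Code

/-! ### A finite verification -/

/-- Search for the elements that can be reached from those in `todo`. The search fails if it meets
an element that violates `ok`, or if it takes more than the given number of steps. Elements are
compared through their keys first, since equality of numbers is decided fast. -/
def search {α : Type} [BEq α] (key : α → ℕ) (next : α → List α) (ok : α → Bool) :
    ℕ → List α → List α → Option (List α)
  | 0, _, _ => none
  | _ + 1, seen, [] => some seen
  | n + 1, seen, x :: todo =>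
      if seen.any fun y => Nat.beq (key x) (key y) && x == y then
        search key next ok n seen todo
      else bif ok x then search key next ok n (x :: seen) (next x ++ todo) else none

/-- What a successful search yields is closed under `next`. -/
theorem search_spec {α : Type} [BEq α] [LawfulBEq α] {key : α → ℕ} {next : α → List α}
    {ok : α → Bool} {n : ℕ} {seen todo L : List α} (h : search key next ok n seen todo = some L)
    (hs : ∀ x ∈ seen, ok x = true ∧ ∀ y ∈ next x, y ∈ seen ∨ y ∈ todo) :
    todo ⊆ L ∧ seen ⊆ L ∧ ∀ x ∈ L, ok x = true ∧ ∀ y ∈ next x, y ∈ L := by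
  induction n generalizing seen todo with
  | zero => simp [search] at h
  | succ n ih =>
    cases todo with
    | nil =>
      simp only [search, Option.some.injEq] at h
      subst h
      exact ⟨List.nil_subset _, fun _ h => h, by simpa using hs⟩
    | cons x todo =>
      rw [search] at h
      split_ifs at h with hx
      · have hx' : x ∈ seen := by
          obtain ⟨y, hy, hxy⟩ := List.any_eq_true.1 hx
          rw [Bool.and_eq_true, beq_iff_eq] at hxy
          exact hxy.2 ▸ hy
        obtain ⟨h₁, h₂, h₃⟩ := ih h fun z hz => ⟨(hs z hz).1, fun y hy => by
          rcases (hs z hz).2 y hy with h | h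
          · exact .inl h
          · rcases List.mem_cons.1 h with rfl | h
            · exact .inl hx'
            · exact .inr h⟩
        exact ⟨List.cons_subset.2 ⟨h₂ hx', h₁⟩, h₂, h₃⟩
      · cases hok : ok x with
        | false => simp [hok] at h
        | true =>
          rw [hok, cond_true] at h
          obtain ⟨h₁, h₂, h₃⟩ := ih h fun z hz => by
            rcases List.mem_cons.1 hz with rfl | hz
            · exact ⟨hok, fun y hy => .inr (by simp [hy])⟩
            · refine ⟨(hs z hz).1, fun y hy => ?_⟩
              rcases (hs z hz).2 y hy with h | h
              · exact .inl (by simp [h])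
              · rcases List.mem_cons.1 h with rfl | h
                · exact .inl (by simp)
                · exact .inr (by simp [h])
          exact ⟨List.cons_subset.2 ⟨h₂ (by simp), (List.append_subset.1 h₁).2⟩,
            (List.cons_subset.1 h₂).2, h₃⟩

namespace Code

/-- A number to compare codes by. Different codes may have the same key. -/
def key (c : Code) : ℕ :=
  c.marks.foldl (fun n m => 50 * n + ((m.d + 3).toNat * 5 + (m.v + 2).toNat) * 2 + m.flip.toNat)
    (c.bot.foldl (fun n i => 5 * n + i) ((c.prev.getD 7) * 2 + c.ind.toNat))

/-- The number of codes that can be reached from `c`. -/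
def reach (next : Code → List Code) (c : Code) : ℕ :=
  ((search key next (fun _ => true) 1000 [] [c]).getD []).length

/-- The number of codes that can be reached along weak edges. It does not increase along a weak
edge, and it decreases unless the edge lies on a cycle. Only the instances of this that occur in
`edgeOK` are used, and these are verified by computation. -/
def rank (c : Code) : ℕ := reach (fun c => c.weak.map Prod.snd) c

/-- Neither the winner nor the loser is flipped. -/
def plain (c : Code) : Bool := !c.fl c.pattern.lastTop && !c.fl c.pattern.lastBot

/-- The number of codes that can be reached along weak edges without flips. -/
def rank' (c : Code) : ℕ :=
  reach (fun c => if c.plain then c.weak.map Prod.snd else []) c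

/-- The condition on an edge from `c` to `c'` along which `w` beats `x`: the loser or the preceding
loser is long, or else `rank` does not increase; moreover, it decreases if the winner is flipped,
and if neither letter is flipped, then `rank'` decreases or the edge is a loop. -/
def edgeOK (c c' : Code) (w x : ℕ) : Bool :=
  c.pattern.big w x ||
    (c'.rank ≤ c.rank && (!c.fl w || c'.rank < c.rank) &&
      (!c.plain || c'.rank' < c.rank' || c' == c))

/-- `(false, c)` stands for: apply the construction of the section to `c`. `(true, c)` stands for:
continue the Rauzy induction at `c`. -/
abbrev Task := Bool × Code

/-- What a task may lead to, whatever the lengths are. -/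
def succ : Task → List Task
  | (false, c) =>
      if c.surelySimple then [] else
      if c.letters.any c.isCut then
        (c.letters.filter c.isCut).flatMap fun i => [(false, c.left i), (false, c.right i)]
      else [(true, c)]
  | (true, c) =>
      if c.done then [(false, c.stopSame)] else
        [(true, c.nextTop), (true, c.nextBot)] ++ if c.skip then [] else [(false, c.stopDistinct)]

/-- The conditions that the tasks are checked for. A pattern that may be simple has to be good if
its lengths are independent, and to have a fixed letter if its form can be positive; a reducible
pattern whose form can be positive splits off a single letter; the letter on which the Rauzy
induction stops is flipped if the lengths are independent; the edges of the Rauzy graph satisfy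
`edgeOK`, and no vertex has two loops. -/
def ok : Task → Bool
  | (false, c) =>
      0 < c.size &&
      (!c.maybeSimple || ((!c.ind || c.good) &&
        (!(c.pattern.hasPos || c.size == 1) || c.letters.any c.fixed))) &&
      (c.surelySimple || !c.pattern.hasPos ||
        c.letters.all fun i => !c.isCut i || i == 1 || i + 1 == c.size)
  | (true, c) => bif c.done then !c.ind || c.fl c.pattern.lastTop else
      (c.edgeOK c.nextTop c.pattern.lastTop c.pattern.lastBot &&
        c.edgeOK c.nextBot c.pattern.lastBot c.pattern.lastTop &&
        !(c.nextTop == c && c.nextBot == c))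

/-- A fully flipped pattern. -/
def start (bot : List ℕ) (v d : List ℤ) (σ : ℤ) : Task :=
  (false, ⟨bot, List.zipWith (fun v d => ⟨true, v, σ * d⟩) v d, true, none⟩)

/-- The patterns of the exchanges of the family, for `τ ≠ 0`. Of four lengths, the two that arise by
cutting an interval of the circle at the preimage of `0` carry the numbers `v = ± 1`: if `l 0`,
`l 1` and `l 2` are independent, a relation with equal coefficients at these two letters is trivial.
Up to the sign `σ`, the form `∑ d i * λ i` is `± (1 - 2 τ)`. -/
def starts : List Task := [1, -1].flatMap fun σ =>
  [start [2, 0, 1, 3] [0, 0, 1, -1] [1, 1, -1, 1] σ,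
    start [1, 3, 0, 2] [0, 1, -1, 0] [1, -1, 1, -1] σ,
    start [0, 2, 3, 1] [1, -1, 0, 0] [-1, 1, -1, -1] σ, start [2, 0, 1] [0, 0, 0] [1, 1, -1] σ,
    start [1, 2, 0] [0, 0, 0] [1, -1, -1] σ]

/-- The task `x` occurs in the construction, started from the exchanges of the family. -/
def Reachable (x : Task) : Prop :=
  ∃ L, search (fun x => 2 * x.2.key + x.1.toNat) succ ok 2000 [] starts = some L ∧ x ∈ L

/-- Evaluation of the search, which meets 291 tasks. -/
theorem exists_search :
    (search (fun x => 2 * x.2.key + x.1.toNat) succ ok 2000 [] starts).isSome = true := by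
  decide +kernel

theorem Reachable.ok {x : Task} (h : Reachable x) : ok x = true := by
  obtain ⟨L, hL, hx⟩ := h
  exact ((search_spec hL (by simp)).2.2 x hx).1

theorem Reachable.succ {x y : Task} (h : Reachable x) (hy : y ∈ succ x) : Reachable y := by
  obtain ⟨L, hL, hx⟩ := h
  exact ⟨L, hL, ((search_spec hL (by simp)).2.2 x hx).2 y hy⟩

theorem reachable_of_mem_starts {x : Task} (h : x ∈ starts) : Reachable x := by
  obtain ⟨L, hL⟩ := Option.isSome_iff_exists.1 exists_search
  exact ⟨L, hL, (search_spec hL (by simp)).1 h⟩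

end Code

/-! ### Exchanges with a given pattern -/

section Tracking

variable {A : Type}

namespace Pattern

variable {s : Pattern} {e : ℕ → A} {D : ExchangeData A} {H : Prop}

/-- The pattern `s` is that of the exchange `D`, with the letter `i` of `s` standing for `e i`. -/
structure Labels (s : Pattern) (e : ℕ → A) (D : ExchangeData A) : Prop where
  nodup : s.top.Nodup
  perm : s.bot.Perm s.top
  inj : ∀ i ∈ s.top, ∀ j ∈ s.top, e i = e j → i = j
  top : D.top = s.top.map e
  bot : D.bot = s.bot.map e
  flip : ∀ i ∈ s.top, D.k (e i) = if (s.mark i).flip then -1 else 1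
  pos : ∀ i ∈ s.top, 0 < D.len (e i)

/-- The linear form in the lengths `x` with coefficients `d`. -/
def form (s : Pattern) (x : ℕ → ℝ) : ℝ := ∑ i ∈ s.top.toFinset, ((s.mark i).d : ℝ) * x i

/-- Every integer relation `r` between the lengths `x` with `∑ r i * v i = 0` is trivial. -/
def Independent (s : Pattern) (x : ℕ → ℝ) : Prop :=
  ∀ r : ℕ → ℤ, ∑ i ∈ s.top.toFinset, r i * (s.mark i).v = 0 →
    ∑ i ∈ s.top.toFinset, (r i : ℝ) * x i = 0 → ∀ i ∈ s.top, r i = 0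

/-- The pattern `s` is that of `D`, its linear form is positive at the lengths of `D` unless it is
zero, and the lengths have the independence claimed by the pattern under the assumption `H`. -/
structure Tracks (H : Prop) (s : Pattern) (e : ℕ → A) (D : ExchangeData A) : Prop
    extends Labels s e D where
  form : 0 < s.form (fun i => D.len (e i)) ∨ ∀ i ∈ s.top, (s.mark i).d = 0
  ind : s.ind = true → H → s.Independent fun i => D.len (e i)

theorem Labels.valid (h : Labels s e D) : D.Valid := by
  refine ⟨?_, ?_, ?_⟩
  · rw [h.top]
    exact h.nodup.map_on h.inj
  · rw [h.top, h.bot]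
    exact h.perm.map e
  · rw [h.top]
    rintro a ha
    obtain ⟨i, hi, rfl⟩ := List.mem_map.1 ha
    exact h.pos i hi

theorem sum_map_toFinset {M : Type} [AddCommMonoid M] {g : ℕ → ℕ} {w : List ℕ}
    (hn : (w.map g).Nodup) (f : ℕ → M) :
    ∑ i ∈ (w.map g).toFinset, f i = ∑ i ∈ w.toFinset, f (g i) := by
  rw [List.sum_toFinset _ hn, List.sum_toFinset _ (List.Nodup.of_map g hn), List.map_map]
  rfl

/-- Renaming of the letters of a pattern. -/
theorem Tracks.relabel (h : Tracks H s e D) {g : ℕ → ℕ} {s' : Pattern}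
    (ht : s'.top.map g = s.top) (hb : s'.bot.map g = s.bot) (hp : s'.bot.Perm s'.top)
    (hm : ∀ i ∈ s'.top, s'.mark i = s.mark (g i)) (hind : s'.ind = s.ind) :
    Tracks H s' (e ∘ g) D ∧
      s'.form (fun i => D.len ((e ∘ g) i)) = s.form fun i => D.len (e i) := by
  have hg : ∀ i ∈ s'.top, g i ∈ s.top := fun i hi => ht ▸ List.mem_map_of_mem hi
  have hn := h.nodup
  have hsum : ∀ {M : Type} [AddCommMonoid M] (f : ℕ → M),
      ∑ i ∈ s.top.toFinset, f i = ∑ i ∈ s'.top.toFinset, f (g i) := fun f => by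
    rw [← ht] at hn ⊢; exact sum_map_toFinset hn f
  have hinj : ∀ i ∈ s'.top, ∀ j ∈ s'.top, g i = g j → i = j := by
    rw [← ht] at hn
    exact fun i hi j hj => List.inj_on_of_nodup_map hn hi hj
  have hform : s'.form (fun i => D.len ((e ∘ g) i)) = s.form fun i => D.len (e i) := by
    rw [Pattern.form, Pattern.form, hsum]
    exact Finset.sum_congr rfl fun i hi => by rw [hm i (by simpa using hi)]; rfl
  refine ⟨⟨⟨?_, hp, ?_, ?_, ?_, ?_, ?_⟩, ?_, ?_⟩, hform⟩
  · rw [← ht] at hn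
    exact hn.of_map g
  · exact fun i hi j hj hij => hinj i hi j hj (h.inj _ (hg i hi) _ (hg j hj) hij)
  · rw [h.top, ← ht, List.map_map]
  · rw [h.bot, ← hb, List.map_map]
  · exact fun i hi => by rw [hm i hi]; exact h.flip _ (hg i hi)
  · exact fun i hi => h.pos _ (hg i hi)
  · rw [hform]
    exact h.form.imp_right fun h' i hi => by rw [hm i hi]; exact h' _ (hg i hi)
  · intro hi' hH r hr hx i hi
    -- transport the relation `r` along the renaming
    have hr' : ∀ j ∈ s'.top,
        (if h : ∃ j' ∈ s'.top, g j' = g j then r h.choose else 0) = r j := by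
      intro j hj
      have hex : ∃ j' ∈ s'.top, g j' = g j := ⟨j, hj, rfl⟩
      rw [dif_pos hex, hinj _ hex.choose_spec.1 j hj hex.choose_spec.2]
    have := h.ind (hind ▸ hi') hH
      (fun j => if h : ∃ j' ∈ s'.top, g j' = j then r h.choose else 0) ?_ ?_ (g i) (hg i hi)
    · rw [← hr' i hi]; exact this
    · rw [hsum]
      refine Eq.trans ?_ hr
      exact Finset.sum_congr rfl fun j hj => by
        rw [hr' j (by simpa using hj), hm j (by simpa using hj)]
    · rw [hsum]
      refine Eq.trans ?_ hx
      exact Finset.sum_congr rfl fun j hj => by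
        rw [hr' j (by simpa using hj)]; rfl

theorem map_getD_range (w : List ℕ) :
    (List.range w.length).map (fun i => w.getD i 0) = w := by
  refine List.ext_getElem (by simp) fun i h _ => ?_
  simp at h
  simp [h]

theorem map_getD_idxOf {u w : List ℕ} (h : u ⊆ w) :
    (u.map fun i => w.idxOf i).map (fun i => w.getD i 0) = u := by
  rw [List.map_map]
  conv_rhs => rw [← List.map_id u]
  refine List.map_congr_left fun a ha => ?_
  have hlt : w.idxOf a < w.length := List.idxOf_lt_length_of_mem (h ha)
  simp [hlt]

/-- If a pattern tracks an exchange, so does its code, and the forms have the same value. -/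
theorem Tracks.code (h : Tracks H s e D) :
    Tracks H s.code.pattern (fun i => e (s.top.getD i 0)) D ∧
      s.code.pattern.form (fun i => D.len (e (s.top.getD i 0))) = s.form fun i => D.len (e i) := by
  have hl : s.code.size = s.top.length := by simp [Code.size, Pattern.code]
  refine h.relabel (g := fun i => s.top.getD i 0) (s' := s.code.pattern) ?_ ?_ ?_ ?_ rfl
  · simp only [Code.pattern, hl]
    exact map_getD_range _
  · exact map_getD_idxOf h.perm.subset
  · have hr : s.code.pattern.top = List.range s.top.length := by simp only [Code.pattern, hl]
    rw [hr]
    refine (h.perm.map _).trans (List.Perm.of_eq ?_)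
    refine List.ext_getElem (by simp) fun i h₁ h₂ => ?_
    simp only [List.getElem_map, List.getElem_range]
    exact h.nodup.idxOf_getElem _ _
  · intro i hi
    simp only [Code.pattern, hl, List.mem_range] at hi
    simp [Code.pattern, Pattern.code, hi]

theorem Tracks.swap (h : Tracks H s e D) :
    Tracks H s.swap e ⟨D.bot, D.top, D.k, D.len⟩ := by
  have hm : ∀ i, i ∈ s.swap.top ↔ i ∈ s.top := fun i => h.perm.mem_iff
  have hf : s.swap.top.toFinset = s.top.toFinset := by ext; simp [hm]
  refine ⟨⟨h.perm.nodup_iff.2 h.nodup, h.perm.symm, ?_, h.bot, h.top, ?_, ?_⟩, ?_, ?_⟩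
  · simp only [hm]; exact h.inj
  · simp only [hm]; exact h.flip
  · simp only [hm]; exact h.pos
  · simp only [hm, Pattern.form, hf]; exact h.form
  · simp only [hm, Independent, hf]; exact h.ind

theorem form_swap (h : s.bot.Perm s.top) (x : ℕ → ℝ) : s.swap.form x = s.form x := by
  have hm : ∀ i, i ∈ s.swap.top ↔ i ∈ s.top := fun i => h.mem_iff
  have hf : s.swap.top.toFinset = s.top.toFinset := by ext; simp [hm]
  rw [Pattern.form, Pattern.form, hf]; rfl

end Pattern

end Tracking

/-! ### Steps of the construction on patterns -/

theorem insertBeside_append {x y : ℕ} {b c : List ℕ} (f : Bool) (h : x ∉ b) :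
    insertBeside f x y (b ++ x :: c) = b ++ if f then y :: x :: c else x :: y :: c := by
  induction b with
  | nil => simp [insertBeside]
  | cons z b ih =>
    simp only [List.mem_cons, not_or] at h
    simp [insertBeside, Ne.symm h.1, ih h.2]

/-- The coefficients of a linear form change contragrediently to its arguments. -/
theorem sum_update_mul_update {R : Type} [CommRing R] {S : Finset ℕ} {w x : ℕ} (hw : w ∈ S)
    (hx : x ∈ S) (hne : w ≠ x) (f g : ℕ → R) :
    ∑ i ∈ S, Function.update f x (f x + f w) i * Function.update g w (g w - g x) i
      = ∑ i ∈ S, f i * g i := by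
  have h₁ : ∀ i, Function.update f x (f x + f w) i = f i + if i = x then f w else 0 := fun i => by
    by_cases h : i = x
    · subst h; simp
    · simp [h]
  have h₂ : ∀ i, Function.update g w (g w - g x) i = g i - if i = w then g x else 0 := fun i => by
    by_cases h : i = w
    · subst h; simp
    · simp [h]
  have h₃ : ∀ i, Function.update f x (f x + f w) i * Function.update g w (g w - g x) i =
      f i * g i + (if i = x then f w * g i else 0) - if i = w then f i * g x else 0 := fun i => by
    rw [h₁, h₂]
    by_cases h : i = x
    · subst h; simp [hne.symm]; ring
    · by_cases h' : i = w
      · subst h'; simp [hne]; ring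
      · simp [h, h']
  rw [Finset.sum_congr rfl fun i _ => h₃ i, Finset.sum_sub_distrib, Finset.sum_add_distrib]
  simp [hw, hx]

section Tracking

variable {A : Type}

namespace Pattern

variable {s : Pattern} {e : ℕ → A} {D : ExchangeData A} {H : Prop}

theorem stepMark_d (m : ℕ → Mark) {w x : ℕ} (h : w ≠ x) (i : ℕ) :
    (stepMark m w x i).d = Function.update (fun i => (m i).d) x ((m x).d + (m w).d) i := by
  unfold stepMark
  by_cases hw : i = w
  · subst hw; simp [h]
  · by_cases hx : i = x
    · subst hx; simp [hw]
    · simp [hw, hx]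

theorem stepMark_v (m : ℕ → Mark) {w x : ℕ} (h : w ≠ x) (i : ℕ) :
    (stepMark m w x i).v = Function.update (fun i => (m i).v) w ((m w).v - (m x).v) i := by
  unfold stepMark
  by_cases hw : i = w
  · subst hw; simp
  · by_cases hx : i = x
    · subst hx; simp [hw]
    · simp [hw, hx]

theorem stepMark_flip (m : ℕ → Mark) {w x : ℕ} (h : w ≠ x) (i : ℕ) :
    (stepMark m w x i).flip
      = Function.update (fun i => (m i).flip) x (xor (m x).flip (m w).flip) i := by
  unfold stepMark
  by_cases hw : i = w
  · subst hw; simp [h]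
  · by_cases hx : i = x
    · subst hx; simp [hw]
    · simp [hw, hx]

theorem eq_append_lastTop (h : s.top ≠ []) : ∃ t, s.top = t ++ [s.lastTop] := by
  rcases List.eq_nil_or_concat s.top with h' | ⟨t, x, h'⟩
  · exact absurd h' h
  · refine ⟨t, ?_⟩
    simp [lastTop, h']

theorem eq_append_lastBot (h : s.bot ≠ []) : ∃ b, s.bot = b ++ [s.lastBot] :=
  eq_append_lastTop (s := s.swap) h

theorem Labels.sign_mul (h : Labels s e D) {i j : ℕ} (hi : i ∈ s.top) (hj : j ∈ s.top) :
    D.k (e i) * D.k (e j) = if xor (s.mark i).flip (s.mark j).flip then -1 else 1 := by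
  rw [h.flip i hi, h.flip j hj]
  cases (s.mark i).flip <;> cases (s.mark j).flip <;> rfl

/-- Updating a function on the letters of an exchange amounts to updating it on their numbers. -/
theorem update_comp_of_inj {B : Type} [DecidableEq A] {S : ℕ → Prop}
    (inj : ∀ i, S i → ∀ j, S j → e i = e j → i = j) {j : ℕ} (hj : S j) (f : A → B) (z : B) {i : ℕ}
    (hi : S i) : Function.update f (e j) z (e i) = Function.update (fun i => f (e i)) j z i := by
  by_cases h : i = j
  · subst h; simp
  · rw [Function.update_of_ne h, Function.update_of_ne fun h' => h (inj i hi j hj h')]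

/-- A relation between the shortened lengths is one between the old lengths, and conversely. -/
theorem independent_update {x : ℕ → ℝ} (h : s.Independent x) {w y : ℕ} (hw : w ∈ s.top)
    (hy : y ∈ s.top) (hne : w ≠ y) (r : ℕ → ℤ)
    (hr : ∑ i ∈ s.top.toFinset, r i * Function.update (fun i => (s.mark i).v) w
      ((s.mark w).v - (s.mark y).v) i = 0)
    (hx : ∑ i ∈ s.top.toFinset, (r i : ℝ) * Function.update x w (x w - x y) i = 0) :
    ∀ i ∈ s.top, r i = 0 := by
  have hw' : w ∈ s.top.toFinset := by simpa using hw
  have hy' : y ∈ s.top.toFinset := by simpa using hy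
  have hrr : ∀ i, r i = Function.update (Function.update r y (r y - r w)) y
      (Function.update r y (r y - r w) y + Function.update r y (r y - r w) w) i := fun i => by
    by_cases hi : i = y
    · subst hi; simp [hne]
    · simp [hi]
  have h0 := h (Function.update r y (r y - r w)) ?_ ?_
  · have h1 := h0 w hw
    rw [Function.update_of_ne hne] at h1
    intro i hi
    have := h0 i hi
    by_cases hiy : i = y
    · subst hiy
      rw [Function.update_self, h1] at this
      simpa using this
    · rwa [Function.update_of_ne hiy] at this
  · rw [← sum_update_mul_update hw' hy' hne]
    refine Eq.trans (Finset.sum_congr rfl fun i _ => ?_) hr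
    rw [← hrr]
  · rw [← sum_update_mul_update hw' hy' hne]
    refine Eq.trans (Finset.sum_congr rfl fun i _ => ?_) hx
    congr 1
    rw [hrr i]
    by_cases hi : i = y
    · subst hi; simp
    · simp [hi]

/-- A step of the Rauzy induction won by the last top letter, on the level of patterns. -/
theorem Tracks.moveTop [DecidableEq A] (h : Tracks H s e D) (h₀ : s.top ≠ [])
    (hne : s.lastTop ≠ s.lastBot) (hlt : D.len (e s.lastBot) < D.len (e s.lastTop)) :
    ∃ D', D.RauzyStep D' ∧ Tracks H s.moveTop e D' ∧
      s.moveTop.form (fun i => D'.len (e i)) = s.form (fun i => D.len (e i)) ∧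
      D'.top = D.top ∧
      D'.len = Function.update D.len (e s.lastTop)
        (D.len (e s.lastTop) - D.len (e s.lastBot)) ∧
      D'.k = Function.update D.k (e s.lastBot) (D.k (e s.lastBot) * D.k (e s.lastTop)) := by
  set X := s.lastTop with hX
  set Y := s.lastBot with hY
  obtain ⟨t, ht⟩ := eq_append_lastTop h₀
  have hb0 : s.bot ≠ [] := fun h' => h₀ (by
    have := h.perm; rw [h'] at this; exact this.nil_eq.symm)
  obtain ⟨b', hb⟩ := eq_append_lastBot hb0
  rw [← hX] at ht
  rw [← hY] at hb
  have hXt : X ∈ s.top := by simp [ht]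
  have hYt : Y ∈ s.top := h.perm.subset (by simp [hb])
  have hnb : s.bot.Nodup := h.perm.nodup_iff.2 h.nodup
  have hXb : X ∈ b' := by
    have : X ∈ s.bot := h.perm.symm.subset hXt
    rw [hb] at this
    simpa [hne] using this
  obtain ⟨b, c, rfl⟩ := List.append_of_mem hXb
  have hXnb : X ∉ b := by
    rw [hb, List.append_assoc] at hnb
    exact fun h' => (List.nodup_append.1 hnb).2.2 X h' X (by simp) rfl
  set len' := Function.update D.len (e X) (D.len (e X) - D.len (e Y)) with hlen'
  set k' := Function.update D.k (e Y) (D.k (e Y) * D.k (e X)) with hk'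
  have heXY : e X ≠ e Y := fun h' => hne (h.inj X hXt Y hYt h')
  have hlen : ∀ i ∈ s.top,
      len' (e i) = Function.update (fun i => D.len (e i)) X (D.len (e X) - D.len (e Y)) i :=
    fun i hi => update_comp_of_inj (S := (· ∈ s.top)) h.inj hXt _ _ hi
  have hbot : s.moveTop.bot
      = b ++ if (s.mark X).flip then Y :: X :: c else X :: Y :: c := by
    have : s.bot.dropLast = b ++ X :: c := by rw [hb, List.dropLast_concat]
    rw [Pattern.moveTop, this]
    exact insertBeside_append _ hXnb
  have hperm : s.moveTop.bot.Perm s.top := by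
    refine List.Perm.trans ?_ h.perm
    rw [hbot, hb, List.append_assoc]
    refine List.Perm.append_left b ?_
    split_ifs
    · exact (List.perm_append_comm (l₁ := [Y]) (l₂ := X :: c))
    · exact List.Perm.cons X (List.perm_append_comm (l₁ := [Y]) (l₂ := c))
  have hform : s.moveTop.form (fun i => len' (e i)) = s.form (fun i => D.len (e i)) := by
    simp only [Pattern.form, Pattern.moveTop, ← hX, ← hY]
    refine Eq.trans (Finset.sum_congr rfl fun i hi => ?_)
      (sum_update_mul_update (by simpa using hXt) (by simpa using hYt) hne
        (fun i => ((s.mark i).d : ℝ)) fun i => D.len (e i))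
    rw [hlen i (by simpa using hi), stepMark_d _ hne]
    congr 1
    by_cases hiY : i = Y
    · subst hiY; simp
    · simp [hiY]
  have htracks : Tracks H s.moveTop e ⟨D.top, s.moveTop.bot.map e, k', len'⟩ := by
    refine ⟨⟨h.nodup, hperm, h.inj, h.top, rfl, ?_, ?_⟩, ?_, ?_⟩
    · intro i hi
      change k' (e i) = if (stepMark s.mark X Y i).flip then -1 else 1
      rw [stepMark_flip _ hne, hk', update_comp_of_inj (S := (· ∈ s.top)) h.inj hYt _ _ hi]
      by_cases hiY : i = Y
      · subst hiY
        simp only [Function.update_self]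
        exact h.sign_mul hYt hXt
      · simp only [Function.update_of_ne hiY]
        exact h.flip i hi
    · intro i hi
      change 0 < len' (e i)
      rw [hlen i hi]
      by_cases hiX : i = X
      · subst hiX; simpa using hlt
      · rw [Function.update_of_ne hiX]; exact h.pos i hi
    · change 0 < s.moveTop.form (fun i => len' (e i)) ∨
        ∀ i ∈ s.top, (stepMark s.mark X Y i).d = 0
      rw [hform]
      refine h.form.imp_right fun h' i hi => ?_
      rw [stepMark_d _ hne]
      by_cases hiY : i = Y
      · subst hiY; simp [h' _ hXt, h' _ hYt]
      · rw [Function.update_of_ne hiY]; exact h' i hi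
    · intro hi hH r hr hx
      refine independent_update (h.ind hi hH) hXt hYt hne r ?_ ?_
      · refine Eq.trans (Finset.sum_congr rfl fun i _ => ?_) hr
        rw [← stepMark_v _ hne]; rfl
      · refine Eq.trans (Finset.sum_congr rfl fun i hi => ?_) hx
        congr 1
        exact (hlen i (by simpa using hi)).symm
  refine ⟨_, ?_, htracks, hform, rfl, rfl, rfl⟩
  have hDt : D.top = t.map e ++ [e X] := by rw [h.top, ht]; simp
  have hDb : D.bot = b.map e ++ e X :: c.map e ++ [e Y] := by rw [h.bot, hb]; simp
  have hkX := h.flip X hXt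
  obtain ⟨Dt, Db, Dk, Dl⟩ := D
  simp only at hDt hDb
  subst hDt hDb
  by_cases hf : (s.mark X).flip = true
  · rw [if_pos hf] at hkX hbot
    rw [hbot]
    simp only [List.map_append, List.map_cons]
    exact .top_flip _ _ _ _ _ _ _ heXY hlt hkX
  · rw [if_neg hf] at hkX hbot
    rw [hbot]
    simp only [List.map_append, List.map_cons]
    exact .top_keep _ _ _ _ _ _ _ heXY hlt hkX

end Pattern

/-- The Rauzy induction is symmetric in the two rows. -/
theorem ExchangeData.RauzyStep.swap [DecidableEq A] {D D' : ExchangeData A} (h : D.RauzyStep D') :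
    RauzyStep ⟨D.bot, D.top, D.k, D.len⟩ ⟨D'.bot, D'.top, D'.k, D'.len⟩ := by
  cases h with
  | top_keep t b c X Y k len hXY hlen hk => exact .bot_keep _ _ _ _ _ _ _ hXY.symm hlen hk
  | top_flip t b c X Y k len hXY hlen hk => exact .bot_flip _ _ _ _ _ _ _ hXY.symm hlen hk
  | bot_keep t b c X Y k len hXY hlen hk => exact .top_keep _ _ _ _ _ _ _ hXY.symm hlen hk
  | bot_flip t b c X Y k len hXY hlen hk => exact .top_flip _ _ _ _ _ _ _ hXY.symm hlen hk

namespace Pattern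

variable {s : Pattern} {e : ℕ → A} {D : ExchangeData A} {H : Prop}

/-- A step of the Rauzy induction won by the last bottom letter, on the level of patterns. -/
theorem Tracks.moveBot [DecidableEq A] (h : Tracks H s e D) (h₀ : s.top ≠ [])
    (hne : s.lastTop ≠ s.lastBot) (hlt : D.len (e s.lastTop) < D.len (e s.lastBot)) :
    ∃ D', D.RauzyStep D' ∧ Tracks H s.moveBot e D' ∧
      s.moveBot.form (fun i => D'.len (e i)) = s.form (fun i => D.len (e i)) ∧
      D'.bot = D.bot ∧
      D'.len = Function.update D.len (e s.lastBot)
        (D.len (e s.lastBot) - D.len (e s.lastTop)) ∧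
      D'.k = Function.update D.k (e s.lastTop) (D.k (e s.lastTop) * D.k (e s.lastBot)) := by
  have h₀' : s.swap.top ≠ [] := fun h' => h₀ (by
    have := h.perm; rw [show s.bot = [] from h'] at this; exact this.nil_eq.symm)
  obtain ⟨D', h₁, h₂, h₃, h₄, h₅, h₆⟩ := h.swap.moveTop h₀' hne.symm hlt
  refine ⟨_, h₁.swap, h₂.swap, ?_, h₄, h₅, h₆⟩
  have := form_swap h₂.perm fun i => D'.len (e i)
  rw [← form_swap h.perm, ← h₃, ← this]
  rfl

theorem sum_subset {M : Type} [AddCommMonoid M] {t : List ℕ} (ht : t ⊆ s.top) {f : ℕ → M}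
    (hf : ∀ i, i ∉ t → f i = 0) :
    ∑ i ∈ s.top.toFinset, f i = ∑ i ∈ t.toFinset, f i := by
  refine (Finset.sum_subset (fun i hi => ?_) fun i _ hi => hf i (by simpa using hi)).symm
  simpa using ht (by simpa using hi)

theorem Tracks.restrict (h : Tracks H s e D) {t b : List ℕ} (ht : t ⊆ s.top) (hn : t.Nodup)
    (hp : b.Perm t) : Tracks H (s.restrict t b) e ⟨t.map e, b.map e, D.k, D.len⟩ := by
  refine ⟨⟨hn, hp, fun i hi j hj => h.inj i (ht hi) j (ht hj), rfl, rfl,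
    fun i hi => h.flip i (ht hi), fun i hi => h.pos i (ht hi)⟩, .inr fun i _ => rfl, ?_⟩
  intro hi hH r hr hx i hit
  have := h.ind hi hH (fun j => if j ∈ t then r j else 0) ?_ ?_ i (ht hit)
  · rwa [if_pos (show i ∈ t from hit)] at this
  · rw [sum_subset ht fun i hi => by simp [hi]]
    refine Eq.trans (Finset.sum_congr rfl fun j hj => ?_) hr
    rw [if_pos (by simpa using hj)]; rfl
  · rw [sum_subset ht fun i hi => by simp [hi]]
    refine Eq.trans (Finset.sum_congr rfl fun j hj => ?_) hx
    rw [if_pos (by simpa using hj)]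

theorem sum_indicator_sub {S : List ℕ} {x y : ℕ} (hx : x ∈ S) (hy : y ∈ S) {R : Type} [CommRing R]
    (f : ℕ → R) :
    ∑ i ∈ S.toFinset, ((if i = x then (1 : R) else 0) - if i = y then 1 else 0) * f i
      = f x - f y := by
  simp [sub_mul, Finset.sum_sub_distrib, hx, hy]

/-- The equality of two lengths is a nontrivial relation, so `v` does not vanish on it. -/
theorem Independent.v_ne {x : ℕ → ℝ} (h : s.Independent x) {i j : ℕ} (hi : i ∈ s.top)
    (hj : j ∈ s.top) (hij : i ≠ j) (hx : x i = x j) : (s.mark i).v ≠ (s.mark j).v := by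
  intro hv
  have := h (fun l => (if l = i then 1 else 0) - if l = j then 1 else 0) ?_ ?_ i hi
  · simp [hij] at this
  · rw [sum_indicator_sub hi hj, hv, sub_self]
  · have := sum_indicator_sub hi hj x
    rw [hx, sub_self] at this
    exact_mod_cast this

/-- If two lengths coincide, the relations between the other lengths are trivial: a relation and the
equality of the two lengths can be combined to one that `v` annihilates. -/
theorem Independent.eq_zero_of_eq {x : ℕ → ℝ} (h : s.Independent x) {i j : ℕ} (hi : i ∈ s.top)
    (hj : j ∈ s.top) (hij : i ≠ j) (hx : x i = x j) {t : List ℕ} (ht : t ⊆ s.top) (hit : i ∉ t)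
    {r : ℕ → ℤ} (hr : ∑ l ∈ t.toFinset, (r l : ℝ) * x l = 0) : ∀ l ∈ t, r l = 0 := by
  set r' : ℕ → ℤ := fun l => if l ∈ t then r l else 0 with hr'
  set q : ℤ := ∑ l ∈ s.top.toFinset, r' l * (s.mark l).v with hq
  have hr'x : ∑ l ∈ s.top.toFinset, (r' l : ℝ) * x l = 0 := by
    rw [sum_subset ht fun l hl => by simp [hr', hl]]
    refine Eq.trans (Finset.sum_congr rfl fun l hl => ?_) hr
    simp only [hr', if_pos (show l ∈ t by simpa using hl)]
  have hq0 : q = 0 := by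
    have h1 := sum_indicator_sub hi hj fun l => (s.mark l).v
    have h2 := sum_indicator_sub hi hj x
    have := h (fun l => ((s.mark i).v - (s.mark j).v) * r' l -
      q * ((if l = i then 1 else 0) - if l = j then 1 else 0)) ?_ ?_ i hi
    · simpa [hr', hit, hij] using this
    · simp only [sub_mul _ (q * _), mul_assoc, Finset.sum_sub_distrib, ← Finset.mul_sum, h1, ← hq]
      ring
    · rw [hx, sub_self] at h2
      push_cast
      simp only [sub_mul _ ((q : ℝ) * _), mul_assoc, Finset.sum_sub_distrib, ← Finset.mul_sum, h2,
        hr'x]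
      ring
  intro l hl
  simpa [hr', hl] using h r' (hq ▸ hq0) hr'x l (ht hl)

theorem Tracks.v_ne_of_eq (h : Tracks H s e D) (hi : s.ind = true) (hH : H) {i j : ℕ}
    (hit : i ∈ s.top) (hjt : j ∈ s.top) (hij : i ≠ j) (hx : D.len (e i) = D.len (e j)) :
    (s.mark i).v ≠ (s.mark j).v :=
  (h.ind hi hH).v_ne hit hjt hij hx

/-- Leaving out the last top interval when it is as long as the last bottom interval. -/
theorem Tracks.merge [DecidableEq A] (h : Tracks H s e D) (h₀ : s.top ≠ [])
    (hne : s.lastTop ≠ s.lastBot) (hlen : D.len (e s.lastTop) = D.len (e s.lastBot)) :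
    ∃ t b d, D = ⟨t ++ [e s.lastTop], b ++ e s.lastTop :: d ++ [e s.lastBot], D.k, D.len⟩ ∧
      e s.lastTop ≠ e s.lastBot ∧
      Tracks H s.merge e ⟨t, b ++ e s.lastBot :: d,
        Function.update D.k (e s.lastBot) (D.k (e s.lastBot) * D.k (e s.lastTop)), D.len⟩ ∧
      s.merge.form (fun i => D.len (e i)) = s.form (fun i => D.len (e i)) ∧
      (s.ind = true → H → s.merge.ind = true) := by
  set X := s.lastTop with hX
  set Y := s.lastBot with hY
  obtain ⟨t, ht⟩ := eq_append_lastTop h₀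
  have hb0 : s.bot ≠ [] := fun h' => h₀ (by
    have := h.perm; rw [h'] at this; exact this.nil_eq.symm)
  obtain ⟨b', hb⟩ := eq_append_lastBot hb0
  rw [← hX] at ht
  rw [← hY] at hb
  have hXt : X ∈ s.top := by simp [ht]
  have hYt : Y ∈ s.top := h.perm.subset (by simp [hb])
  have hnb : s.bot.Nodup := h.perm.nodup_iff.2 h.nodup
  have hXb : X ∈ b' := by
    have : X ∈ s.bot := h.perm.symm.subset hXt
    rw [hb] at this
    simpa [hne] using this
  obtain ⟨b, c, rfl⟩ := List.append_of_mem hXb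
  have hpX : (X :: (b ++ c)).Nodup := by
    rw [hb, List.append_assoc] at hnb
    have := (List.perm_middle.nodup_iff (α := ℕ)).1 hnb
    exact this.sublist ((List.append_sublist_append_left b).2 (List.sublist_append_left c [Y])
      |>.cons_cons X)
  rw [List.nodup_cons, List.mem_append, not_or] at hpX
  have heXY : e X ≠ e Y := fun h' => hne (h.inj X hXt Y hYt h')
  have hnt : (t ++ [X]).Nodup := ht ▸ h.nodup
  have hXnt : X ∉ t := fun h' => (List.nodup_append.1 hnt).2.2 X h' X (by simp) rfl
  have htop : s.merge.top = t := by rw [Pattern.merge, ht, List.dropLast_concat]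
  have htsub : t ⊆ s.top := by rw [ht]; exact List.subset_append_left _ _
  have hsub : ∀ w : List ℕ, X ∉ w → w.map (fun z => if z = X then Y else z) = w := fun w hw => by
    conv_rhs => rw [← List.map_id w]
    exact List.map_congr_left fun z hz => if_neg fun h' : z = X => hw (h' ▸ hz)
  have hbot : s.merge.bot = b ++ Y :: c := by
    have : s.bot.dropLast = b ++ X :: c := by rw [hb, List.dropLast_concat]
    rw [Pattern.merge, this, List.map_append, List.map_cons]
    simp only [← hX, ← hY, if_true]
    rw [hsub b hpX.1.1, hsub c hpX.1.2]
  have hperm : s.merge.bot.Perm s.merge.top := by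
    rw [htop, hbot]
    have h1 : (X :: (b ++ Y :: c)).Perm (b ++ X :: c ++ [Y]) := by
      rw [List.append_assoc]
      refine List.perm_middle.symm.trans (List.Perm.append_left b (List.Perm.cons X ?_))
      exact List.perm_append_comm (l₁ := [Y]) (l₂ := c)
    have h2 := (h1.trans (hb ▸ ht ▸ h.perm)).trans List.perm_append_comm
    exact List.Perm.cons_inv h2
  have hYnt : Y ∈ t := by
    have := hYt
    rw [ht] at this
    simpa [hne.symm] using this
  have hform : s.merge.form (fun i => D.len (e i)) = s.form (fun i => D.len (e i)) := by
    have h1 : s.top.toFinset = insert X t.toFinset := by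
      ext i; simp [ht, or_comm]
    rw [Pattern.form, Pattern.form, htop, h1, Finset.sum_insert (by simpa using hXnt),
      ← Finset.add_sum_erase _ _ (show Y ∈ t.toFinset by simpa using hYnt),
      ← Finset.add_sum_erase _ _ (show Y ∈ t.toFinset by simpa using hYnt), hlen, ← add_assoc]
    congr 1
    · simp only [Pattern.merge, ← hX, ← hY, if_true]
      push_cast
      ring
    · refine Finset.sum_congr rfl fun i hi => ?_
      rw [Finset.mem_erase] at hi
      simp only [Pattern.merge, ← hX, ← hY, if_neg hi.1]
  refine ⟨t.map e, b.map e, c.map e, ?_, heXY, ?_, hform, ?_⟩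
  · have hDt : D.top = t.map e ++ [e X] := by rw [h.top, ht]; simp
    have hDb : D.bot = b.map e ++ e X :: c.map e ++ [e Y] := by rw [h.bot, hb]; simp
    rw [← hDt, ← hDb]
  · refine ⟨⟨?_, hperm, ?_, ?_, ?_, ?_, ?_⟩, ?_, ?_⟩
    · rw [htop]; exact (List.nodup_append.1 hnt).1
    · rw [htop]; exact fun i hi j hj => h.inj i (htsub hi) j (htsub hj)
    · rw [htop]
    · rw [hbot]; simp
    · intro i hi
      rw [htop] at hi
      simp only [Pattern.merge, ← hX, ← hY]
      rw [update_comp_of_inj (S := (· ∈ s.top)) h.inj hYt _ _ (htsub hi)]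
      by_cases hiY : i = Y
      · subst hiY
        simp only [Function.update_self, if_true]
        exact h.sign_mul hYt hXt
      · simp only [Function.update_of_ne hiY, if_neg hiY]
        exact h.flip i (htsub hi)
    · intro i hi
      exact h.pos i (htsub (htop ▸ hi))
    · change 0 < s.merge.form (fun i => D.len (e i)) ∨ _
      rw [hform]
      refine h.form.imp_right fun h' i hi => ?_
      simp only [Pattern.merge, ← hX, ← hY]
      split_ifs with hiY
      · simp [h' X hXt, h' Y hYt]
      · exact h' i (htsub (htop ▸ hi))
    · intro hi hH r _ hx
      rw [htop] at hx ⊢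
      simp only [Pattern.merge, Bool.and_eq_true] at hi
      exact (h.ind hi.1 hH).eq_zero_of_eq hXt hYt hne hlen htsub hXnt hx
  · intro hi hH
    simp only [Pattern.merge, hi, Bool.true_and, decide_eq_true_eq]
    exact h.v_ne_of_eq hi hH hXt hYt hne hlen

end Pattern

end Tracking

/-! ### The Rauzy induction stops -/

open Filter Topology

section Limits

variable {A : Type} [DecidableEq A]

theorem exists_forall_eq_of_le {f : ℕ → ℕ} {N : ℕ} (h : ∀ n ≥ N, f (n + 1) ≤ f n) :
    ∃ M ≥ N, ∀ n ≥ M, f (n + 1) = f n := by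
  have hne : ∃ v, ∃ n ≥ N, f n = v := ⟨_, N, le_rfl, rfl⟩
  classical
  obtain ⟨M, hM, hv⟩ := Nat.find_spec hne
  have hmin : ∀ n ≥ M, f n = f M := by
    intro n hn
    induction n, hn using Nat.le_induction with
    | base => rfl
    | succ n hn ih =>
      refine le_antisymm ((h n (hM.trans hn)).trans ih.le) ?_
      rw [hv]
      exact Nat.find_min' hne ⟨n + 1, by omega, rfl⟩
  exact ⟨M, hM, fun n hn => by rw [hmin n hn, hmin _ (by omega)]⟩

/-- Lengths from which the length of a loser is subtracted from that of a winner again and again. -/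
structure IsSubtractive (S : Finset A) (len : ℕ → A → ℝ) (w x : ℕ → A) : Prop where
  winner_mem : ∀ n, w n ∈ S
  loser_mem : ∀ n, x n ∈ S
  pos : ∀ n, ∀ a ∈ S, 0 < len n a
  step : ∀ n, len (n + 1) = Function.update (len n) (w n) (len n (w n) - len n (x n))

variable {S : Finset A} {len : ℕ → A → ℝ} {w x : ℕ → A}

/-- The total length decreases by what the losers measure, and it stays positive. -/
theorem IsSubtractive.tendsto (h : IsSubtractive S len w x) :
    Tendsto (fun n => len n (x n)) atTop (𝓝 0) := by
  set T : ℕ → ℝ := fun n => ∑ a ∈ S, len n a with hT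
  have hstep : ∀ n, T n - T (n + 1) = len n (x n) := fun n => by
    simp only [hT, h.step n]
    rw [Finset.sum_update_of_mem (h.winner_mem n),
      ← Finset.add_sum_erase S _ (h.winner_mem n), Finset.sdiff_singleton_eq_erase]
    ring
  have hanti : Antitone T := antitone_nat_of_succ_le fun n => by
    have := hstep n
    have := h.pos n _ (h.loser_mem n)
    linarith
  have hbdd : BddBelow (Set.range T) :=
    ⟨0, by rintro _ ⟨n, rfl⟩; exact Finset.sum_nonneg fun a ha => (h.pos n a ha).le⟩
  have hlim := tendsto_atTop_ciInf hanti hbdd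
  have := hlim.sub (hlim.comp (tendsto_add_atTop_nat 1))
  rw [sub_self] at this
  exact this.congr fun n => hstep n

/-- Letters that do not win keep their length, so from some time on they do not lose: in the end all
losers belong to any set to which the winners belong. -/
theorem IsSubtractive.eventually_loser (h : IsSubtractive S len w x) {W : A → Prop} {N : ℕ}
    (hW : ∀ n ≥ N, W (w n)) : ∃ M ≥ N, ∀ n ≥ M, W (x n) := by
  classical
  have hconst : ∀ n ≥ N, ∀ a, ¬ W a → len n a = len N a := by
    intro n hn a ha
    induction n, hn using Nat.le_induction with
    | base => rfl
    | succ n hn ih =>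
      rw [h.step, Function.update_of_ne fun h' : a = w n => ha (h' ▸ hW n hn), ih]
  have hev : ∀ᶠ n in atTop, ∀ a ∈ S, len n (x n) < len N a :=
    (Filter.eventually_all_finset S).2 fun a ha =>
      (h.tendsto).eventually (gt_mem_nhds (h.pos N a ha))
  obtain ⟨M, hM⟩ := eventually_atTop.1 hev
  refine ⟨max M N, le_max_right _ _, fun n hn => ?_⟩
  by_contra hx
  have h1 := hM n (le_of_max_le_left hn) _ (h.loser_mem n)
  rw [hconst n (le_of_max_le_right hn) _ hx] at h1
  exact lt_irrefl _ h1

end Limits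

section Runs

variable {A : Type}

namespace Pattern

variable {s : Pattern} {e : ℕ → A} {D : ExchangeData A} {H : Prop}

theorem prev_moveTop (s : Pattern) :
    s.moveTop.prev = some s.lastBot ∨ s.moveTop.prev = none := by
  rw [moveTop]
  split_ifs
  · exact .inl rfl
  · exact .inr rfl

theorem prev_moveBot (s : Pattern) :
    s.moveBot.prev = some s.lastTop ∨ s.moveBot.prev = none :=
  s.swap.prev_moveTop

/-- The estimates of the conserved form that `big` stands for. -/
theorem form_le_of_big {x : ℕ → ℝ} (hpos : ∀ i ∈ s.top, 0 < x i) {w l : ℕ} (hw : w ∈ s.top)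
    (hl : l ∈ s.top) (hwl : w ≠ l) (hlt : x l < x w)
    (hm : ∀ i, i ∉ s.top → (s.mark i).d = 0) (h : s.big w l = true) :
    (s.mark l).d ≠ 0 ∧
      (s.form x ≤ x l ∨ ∃ p ∈ s.top, s.prev = some p ∧ s.form x ≤ x p) := by
  have hS : ∀ i, i ∈ s.top.toFinset ↔ i ∈ s.top := fun i => by simp
  have hle : ∀ {T : Finset ℕ}, (∀ i ∈ T, i ∈ s.top ∧ (s.mark i).d ≤ 0) →
      ∑ i ∈ T, ((s.mark i).d : ℝ) * x i ≤ 0 := fun hT =>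
    Finset.sum_nonpos fun i hi => mul_nonpos_of_nonpos_of_nonneg
      (by exact_mod_cast (hT i hi).2) (hpos i (hT i hi).1).le
  rw [big, Bool.or_eq_true] at h
  rcases h with h | h
  · simp only [Bool.and_eq_true, beq_iff_eq, List.all_eq_true, Bool.or_eq_true,
      decide_eq_true_eq] at h
    refine ⟨by rw [h.1]; norm_num, .inl ?_⟩
    rw [form, ← Finset.add_sum_erase _ _ ((hS l).2 hl), h.1]
    have := hle (T := s.top.toFinset.erase l) fun i hi => by
      rw [Finset.mem_erase, hS] at hi
      exact ⟨hi.2, (h.2 i hi.2).resolve_left hi.1⟩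
    push_cast
    linarith
  · cases hp : s.prev with
    | none => simp [hp] at h
    | some p =>
      simp only [hp, Bool.and_eq_true, beq_iff_eq, List.all_eq_true, Bool.or_eq_true,
        decide_eq_true_eq, bne_iff_ne, ne_eq] at h
      obtain ⟨⟨⟨⟨⟨hpl, hpw⟩, hdp⟩, hdl⟩, hdw⟩, hd⟩ := h
      have hpt : p ∈ s.top := by
        by_contra hn
        rw [hm p hn] at hdp
        exact absurd hdp (by norm_num)
      refine ⟨by rw [hdl]; norm_num, .inr ⟨p, hpt, rfl, ?_⟩⟩
      rw [form, ← Finset.add_sum_erase _ _ ((hS p).2 hpt),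
        ← Finset.add_sum_erase _ _ (Finset.mem_erase.2 ⟨Ne.symm hpl, (hS l).2 hl⟩),
        ← Finset.add_sum_erase _ _
          (Finset.mem_erase.2 ⟨hwl, Finset.mem_erase.2 ⟨Ne.symm hpw, (hS w).2 hw⟩⟩),
        hdp, hdl, hdw]
      have := hle (T := ((s.top.toFinset.erase p).erase l).erase w) fun i hi => by
        simp only [Finset.mem_erase, hS] at hi
        rcases hd i hi.2.2.2 with h' | h'
        · exact absurd h' (by tauto)
        · exact ⟨hi.2.2.2, h'⟩
      push_cast
      linarith

end Pattern

/-- A stage of the Rauzy induction; `loss` is the length of the last loser. -/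
structure Stage (A : Type) where
  code : Code
  letter : ℕ → A
  data : ExchangeData A
  loss : ℝ

namespace Stage

variable {H : Prop} {δ : ℝ}

/-- The code of the stage occurs in the construction and tracks its exchange, and the conserved form
has the value `δ`. The letter that the code records as the last loser is at most as long as the last
loser was: a loser keeps its length, but a stage that starts the induction has no last loser. -/
structure Ok (H : Prop) (δ : ℝ) (x : Stage A) : Prop where
  reachable : Code.Reachable (true, x.code)
  tracks : Pattern.Tracks H x.code.pattern x.letter x.data
  form : x.code.pattern.form (fun i => x.data.len (x.letter i)) = δ
  size : 0 < x.code.size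
  loss : ∀ p, x.code.prev = some p → p < x.code.size → x.data.len (x.letter p) ≤ x.loss

variable [DecidableEq A]

/-- One step of the Rauzy induction between two stages: `w` beats `l`. The field `edge` is what
`Code.edgeOK` says about the step, and `kind` tells which of the last letters has won. -/
structure Step (δ : ℝ) (x y : Stage A) (w l : A) : Prop where
  step : x.data.RauzyStep y.data
  not_done : x.code.done = false
  winner_mem : w ∈ x.data.top
  loser_mem : l ∈ x.data.top
  ne : w ≠ l
  mem_iff : ∀ a, a ∈ y.data.top ↔ a ∈ x.data.top
  size : y.code.size = x.code.size
  ind : y.code.ind = x.code.ind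
  len : y.data.len = Function.update x.data.len w (x.data.len w - x.data.len l)
  k : y.data.k = Function.update x.data.k l (x.data.k l * x.data.k w)
  loss : y.loss = x.data.len l
  edge : (0 < δ ∧ (δ ≤ x.loss ∨ δ ≤ y.loss)) ∨
    (y.code.rank ≤ x.code.rank ∧ (x.data.k w ≠ 1 → y.code.rank < x.code.rank) ∧
      (x.data.k w = 1 → x.data.k l = 1 → y.code.rank' < x.code.rank' ∨ y.code = x.code))
  kind : (y.code = x.code.nextTop ∧ y.data.top = x.data.top ∧ x.data.top.getLast? = some w) ∨
    (y.code = x.code.nextBot ∧ y.data.bot = x.data.bot ∧ x.data.bot.getLast? = some w)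

omit [DecidableEq A] in
/-- The condition `Code.edgeOK` in terms of the exchanges. -/
theorem Ok.edge {x y : Stage A} (hx : x.Ok H δ) {w l : ℕ} (hw : w ∈ x.code.pattern.top)
    (hl : l ∈ x.code.pattern.top) (hne : w ≠ l)
    (hlt : x.data.len (x.letter l) < x.data.len (x.letter w))
    (hloss : y.loss = x.data.len (x.letter l))
    (hplain : x.code.plain = (!x.code.fl w && !x.code.fl l))
    (h : x.code.edgeOK y.code w l = true) :
    (0 < δ ∧ (δ ≤ x.loss ∨ δ ≤ y.loss)) ∨
    (y.code.rank ≤ x.code.rank ∧ (x.data.k (x.letter w) ≠ 1 → y.code.rank < x.code.rank) ∧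
      (x.data.k (x.letter w) = 1 → x.data.k (x.letter l) = 1 →
        y.code.rank' < x.code.rank' ∨ y.code = x.code)) := by
  have hfl : ∀ i ∈ x.code.pattern.top, x.data.k (x.letter i) = 1 ↔ x.code.fl i = false := by
    intro i hi
    rw [hx.tracks.flip i hi, Code.fl]
    cases (x.code.pattern.mark i).flip <;> simp
  rw [Code.edgeOK, Bool.or_eq_true] at h
  rcases h with h | h
  · left
    have hm : ∀ i, i ∉ x.code.pattern.top → (x.code.pattern.mark i).d = 0 := by
      intro i hi
      have : x.code.size ≤ i := by simpa [Code.pattern] using hi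
      simp only [Code.pattern]
      rw [List.getD_eq_default _ _ this]
    obtain ⟨hd, hb⟩ := Pattern.form_le_of_big (x := fun i => x.data.len (x.letter i))
      hx.tracks.pos hw hl hne hlt hm h
    rw [hx.form] at hb
    refine ⟨?_, ?_⟩
    · rcases hx.tracks.form with h' | h'
      · rwa [hx.form] at h'
      · exact absurd (h' l hl) hd
    · rcases hb with hb | ⟨p, hp, hprev, hb⟩
      · exact .inr (hloss ▸ hb)
      · exact .inl (hb.trans (hx.loss p hprev (by simpa [Code.pattern] using hp)))
  · right
    simp only [Bool.and_eq_true, decide_eq_true_eq, Bool.or_eq_true, Bool.not_eq_true',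
      beq_iff_eq] at h
    refine ⟨h.1.1, fun hk => ?_, fun hk hk' => ?_⟩
    · exact h.1.2.resolve_left fun h' => hk ((hfl w hw).2 h')
    · have := h.2
      rw [hplain, (hfl w hw).1 hk, (hfl l hl).1 hk'] at this
      simpa using this

/-- As long as the last intervals have different lengths, a reachable stage has a successor. -/
theorem Ok.exists_step {x : Stage A} (hx : x.Ok H δ)
    (hne : x.data.len (x.letter x.code.pattern.lastTop)
      ≠ x.data.len (x.letter x.code.pattern.lastBot)) :
    ∃ y : Stage A, y.Ok H δ ∧ ∃ w l, x.Step δ y w l := by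
  have h := hx.tracks
  set s := x.code.pattern with hs
  have htop : s.top = List.range x.code.size := rfl
  have h₀ : s.top ≠ [] := by
    rw [htop]; simp; exact hx.size.ne'
  have hXY : s.lastTop ≠ s.lastBot := fun h' => hne (by rw [h'])
  have hdone : x.code.done = false := by simpa [Code.done] using hXY
  have hok := hx.reachable.ok
  simp only [Code.ok, hdone, cond_false, Bool.and_eq_true] at hok
  have hb0 : s.bot ≠ [] := fun h' => h₀ (by
    have := h.perm; rw [h'] at this; exact this.nil_eq.symm)
  obtain ⟨t, ht⟩ := Pattern.eq_append_lastTop h₀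
  obtain ⟨b, hb⟩ := Pattern.eq_append_lastBot hb0
  have hXt : s.lastTop ∈ s.top := by
    have : s.lastTop ∈ t ++ [s.lastTop] := by simp
    rwa [← ht] at this
  have hYt : s.lastBot ∈ s.top := h.perm.subset (by
    have : s.lastBot ∈ b ++ [s.lastBot] := by simp
    rwa [← hb] at this)
  have hXl : x.data.top.getLast? = some (x.letter s.lastTop) := by
    rw [h.top, ht]; simp
  have hYl : x.data.bot.getLast? = some (x.letter s.lastBot) := by
    rw [h.bot, hb]; simp
  have mem : ∀ i ∈ s.top, x.letter i ∈ x.data.top := fun i hi => by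
    rw [h.top]; exact List.mem_map_of_mem hi
  have hsucc : ∀ c', c' = x.code.nextTop ∨ c' = x.code.nextBot → Code.Reachable (true, c') :=
    fun c' hc' => hx.reachable.succ (by
      rcases hc' with rfl | rfl <;> simp [Code.succ, hdone])
  -- the letter that lost, in the numbering of the new code
  have hprev : ∀ {s' : Pattern} {p q : ℕ}, s'.prev = some q ∨ s'.prev = none →
      s'.code.prev = some p → p < s'.code.size → s'.top.getD p 0 = q := by
    intro s' p q h1 h2 h3
    rcases h1 with h1 | h1
    · simp only [Pattern.code, h1, Option.map_some, Option.some.injEq] at h2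
      subst h2
      have h4 : s'.top.idxOf q < s'.top.length := by simpa [Code.size, Pattern.code] using h3
      simp [h4]
    · simp [Pattern.code, h1] at h2
  rcases lt_or_gt_of_ne hne with hlt | hlt
  · obtain ⟨D', hstep, htr, hform, hbot, hlen, hk⟩ := h.moveBot h₀ hXY hlt
    obtain ⟨htr', hform'⟩ := htr.code
    have hmem : ∀ a, a ∈ D'.top ↔ a ∈ x.data.top := fun a => by
      rw [← htr.valid.perm.mem_iff, hbot, h.valid.perm.mem_iff]
    have hsize : x.code.nextBot.size = x.code.size := by
      have h1 : (Pattern.moveBot s).top.length = s.top.length := by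
        rw [← htr.perm.length_eq, ← h.perm.length_eq]; rfl
      simpa [Code.nextBot, Code.size, Pattern.code, htop] using h1
    refine ⟨⟨x.code.nextBot, _, D', x.data.len (x.letter s.lastTop)⟩,
      ⟨hsucc _ (.inr rfl), htr', ?_, ?_, ?_⟩, _, _, ⟨hstep, hdone, mem _ hYt, mem _ hXt,
      fun h' => hXY (h.inj _ hXt _ hYt h'.symm), hmem, hsize, rfl, hlen, hk, rfl, ?_,
      .inr ⟨rfl, hbot, hYl⟩⟩⟩
    · rw [← hx.form, ← hform]; exact hform'
    · rw [hsize]; exact hx.size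
    · intro p hp hps
      simp only at hp hps ⊢
      rw [hprev s.prev_moveBot hp hps, hlen,
        Function.update_of_ne fun h' => hXY (h.inj _ hXt _ hYt h')]
    · exact hx.edge hYt hXt hXY.symm hlt rfl (by rw [Code.plain, Bool.and_comm]) hok.1.2
  · obtain ⟨D', hstep, htr, hform, htop', hlen, hk⟩ := h.moveTop h₀ hXY hlt
    obtain ⟨htr', hform'⟩ := htr.code
    have hsize : x.code.nextTop.size = x.code.size := by
      simp [Code.nextTop, Code.size, Pattern.code, Pattern.moveTop, Code.pattern]
    refine ⟨⟨x.code.nextTop, _, D', x.data.len (x.letter s.lastBot)⟩,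
      ⟨hsucc _ (.inl rfl), htr', ?_, ?_, ?_⟩, _, _, ⟨hstep, hdone, mem _ hXt, mem _ hYt,
      fun h' => hXY (h.inj _ hXt _ hYt h'), fun a => by rw [htop'], hsize, rfl, hlen, hk, rfl, ?_,
      .inl ⟨rfl, htop', hXl⟩⟩⟩
    · rw [← hx.form, ← hform]; exact hform'
    · rw [hsize]; exact hx.size
    · intro p hp hps
      simp only at hp hps ⊢
      rw [hprev s.prev_moveTop hp hps, hlen,
        Function.update_of_ne fun h' => hXY (h.inj _ hXt _ hYt h'.symm)]
    · exact hx.edge hXt hYt hXY hlt rfl rfl hok.1.1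

/-- The modified Rauzy induction, started from a reachable code, stops. Otherwise the losers become
arbitrarily short; hence the steps whose loser, or the loser before, is at least as long as the
positive conserved form occur finitely often, and so do those that lower one of the ranks. Therefore
in the end no flipped letter takes part, the code does not change, and one letter beats all the
others for ever, which the lengths of the others do not allow. -/
theorem Ok.not_forall_step {X : ℕ → Stage A} (hX : ∀ n, (X n).Ok H δ) {w l : ℕ → A}
    (h : ∀ n, (X n).Step δ (X (n + 1)) (w n) (l n)) : False := by
  have hmem : ∀ n a, a ∈ (X n).data.top ↔ a ∈ (X 0).data.top := by
    intro n a
    induction n with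
    | zero => rfl
    | succ n ih => rw [(h n).mem_iff, ih]
  have hsub : IsSubtractive (X 0).data.top.toFinset (fun n => (X n).data.len) w l := by
    refine ⟨fun n => ?_, fun n => ?_, fun n a ha => ?_, fun n => (h n).len⟩
    · simpa using (hmem n _).1 (h n).winner_mem
    · simpa using (hmem n _).1 (h n).loser_mem
    · exact (hX n).tracks.valid.pos a ((hmem n a).2 (by simpa using ha))
  -- eventually the edges are not bounded from below
  obtain ⟨N₀, hN₀⟩ : ∃ N, ∀ n ≥ N, ¬ (0 < δ ∧ (δ ≤ (X n).loss ∨ δ ≤ (X (n + 1)).loss)) := by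
    by_cases hδ : 0 < δ
    · obtain ⟨N, hN⟩ := eventually_atTop.1 (hsub.tendsto.eventually (gt_mem_nhds hδ))
      refine ⟨N + 1, fun n hn => ?_⟩
      rintro ⟨-, h' | h'⟩
      · obtain ⟨m, rfl⟩ : ∃ m, n = m + 1 := ⟨n - 1, by omega⟩
        rw [(h m).loss] at h'
        exact absurd (hN m (by omega)) (not_lt.2 h')
      · rw [(h n).loss] at h'
        exact absurd (hN n (by omega)) (not_lt.2 h')
    · exact ⟨0, fun n _ h' => hδ h'.1⟩
  have he : ∀ n ≥ N₀, _ := fun n hn => (h n).edge.resolve_left (hN₀ n hn)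
  -- eventually the winners are not flipped
  obtain ⟨N₁, hN₁, hr⟩ := exists_forall_eq_of_le (f := fun n => (X n).code.rank)
    fun n hn => (he n hn).1
  have hkw : ∀ n ≥ N₁, (X n).data.k (w n) = 1 := fun n hn => by
    by_contra hk
    exact (((he n (hN₁.trans hn)).2.1 hk).ne (hr n hn))
  have hk : ∀ n ≥ N₁, (X n).data.k = (X N₁).data.k := by
    intro n hn
    induction n, hn using Nat.le_induction with
    | base => rfl
    | succ n hn ih =>
      rw [(h n).k, hkw n hn, mul_one, Function.update_eq_self, ih]
  -- eventually the losers are not flipped either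
  obtain ⟨N₂, hN₂, hkl⟩ := hsub.eventually_loser (W := fun a => (X N₁).data.k a = 1) (N := N₁)
    fun n hn => by rw [← hk n hn]; exact hkw n hn
  have he' : ∀ n ≥ N₂, (X (n + 1)).code.rank' < (X n).code.rank' ∨
      (X (n + 1)).code = (X n).code := fun n hn =>
    (he n (hN₁.trans (hN₂.trans hn))).2.2 (hkw n (hN₂.trans hn))
      (by rw [hk n (hN₂.trans hn)]; exact hkl n hn)
  obtain ⟨N₃, hN₃, hr'⟩ := exists_forall_eq_of_le (f := fun n => (X n).code.rank') (N := N₂)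
    fun n hn => by
      rcases he' n hn with h' | h'
      · exact h'.le
      · exact (congrArg Code.rank' h').le
  -- eventually the code does not change
  have hc' : ∀ n ≥ N₃, (X (n + 1)).code = (X n).code := fun n hn =>
    (he' n (hN₃.trans hn)).resolve_left fun h' => h'.ne (hr' n hn)
  have hc : ∀ n ≥ N₃, (X n).code = (X N₃).code := by
    intro n hn
    induction n, hn using Nat.le_induction with
    | base => rfl
    | succ n hn ih => rw [hc' n hn, ih]
  -- hence the winner does not change
  have hw : ∀ n ≥ N₃, w n = w N₃ := by
    have hok := (hX N₃).reachable.ok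
    have hnot : ¬ ((X N₃).code.nextTop = (X N₃).code ∧ (X N₃).code.nextBot = (X N₃).code) := by
      simp only [Code.ok, (h N₃).not_done, cond_false, Bool.and_eq_true,
        Bool.not_eq_true', Bool.and_eq_false_iff, beq_eq_false_iff_ne] at hok
      tauto
    by_cases htop : (X N₃).code.nextTop = (X N₃).code
    · have hkind : ∀ n ≥ N₃, (X (n + 1)).data.top = (X n).data.top ∧
          (X n).data.top.getLast? = some (w n) := fun n hn => by
        rcases (h n).kind with h' | h'
        · exact h'.2
        · refine absurd ⟨htop, ?_⟩ hnot
          rw [← hc n hn, ← h'.1, hc' n hn]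
      have hconst : ∀ n ≥ N₃, (X n).data.top = (X N₃).data.top := by
        intro n hn
        induction n, hn using Nat.le_induction with
        | base => rfl
        | succ n hn ih => rw [(hkind n hn).1, ih]
      intro n hn
      have h1 := (hkind n hn).2
      rw [hconst n hn, (hkind N₃ le_rfl).2] at h1
      exact (Option.some.inj h1).symm
    · have hkind : ∀ n ≥ N₃, (X (n + 1)).data.bot = (X n).data.bot ∧
          (X n).data.bot.getLast? = some (w n) := fun n hn => by
        rcases (h n).kind with h' | h'
        · refine absurd ?_ htop
          rw [← hc n hn, ← h'.1, hc' n hn]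
        · exact h'.2
      have hconst : ∀ n ≥ N₃, (X n).data.bot = (X N₃).data.bot := by
        intro n hn
        induction n, hn using Nat.le_induction with
        | base => rfl
        | succ n hn ih => rw [(hkind n hn).1, ih]
      intro n hn
      have h1 := (hkind n hn).2
      rw [hconst n hn, (hkind N₃ le_rfl).2] at h1
      exact (Option.some.inj h1).symm
  obtain ⟨M, hM, hl⟩ := hsub.eventually_loser (W := fun a => a = w N₃) (N := N₃) hw
  exact (h M).ne ((hw M hM).trans (hl M le_rfl).symm)

/-- From a reachable code the modified Rauzy induction leads to an exchange whose last intervals are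
equal. -/
theorem Ok.exists_stop {x : Stage A} (hx : x.Ok H δ) :
    ∃ y : Stage A, y.Ok H δ ∧ Relation.ReflTransGen ExchangeData.RauzyStep x.data y.data ∧
      y.code.size = x.code.size ∧ y.code.ind = x.code.ind ∧
      y.data.len (y.letter y.code.pattern.lastTop)
        = y.data.len (y.letter y.code.pattern.lastBot) := by
  by_contra hcon
  let T := {y : Stage A // y.Ok H δ ∧
    Relation.ReflTransGen ExchangeData.RauzyStep x.data y.data ∧ y.code.size = x.code.size ∧
    y.code.ind = x.code.ind}
  have hstep : ∀ y : T, ∃ z : T, ∃ w l, y.1.Step δ z.1 w l := by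
    rintro ⟨y, hy, hxy, hs, hi⟩
    obtain ⟨z, hz, w, l, h⟩ := hy.exists_step fun h' => hcon ⟨y, hy, hxy, hs, hi, h'⟩
    exact ⟨⟨z, hz, hxy.tail h.step, h.size.trans hs, h.ind.trans hi⟩, w, l, h⟩
  choose f w l hf using hstep
  let X : ℕ → T := fun n => f^[n] ⟨x, hx, .refl, rfl, rfl⟩
  refine Ok.not_forall_step (X := fun n => (X n).1) (w := fun n => w (X n)) (l := fun n => l (X n))
    (fun n => (X n).2.1) fun n => ?_
  have : X (n + 1) = f (X n) := Function.iterate_succ_apply' _ _ _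
  rw [this]
  exact hf _

end Stage

end Runs

/-! ### The construction ends with simple pieces -/

section Fixed

variable {A : Type} [DecidableEq A]

theorem leftEnd_append_cons {len : A → ℝ} {w w' : List A} {a : A} (h : a ∉ w) :
    leftEnd len (w ++ a :: w') a = wordLength len w := by
  rw [leftEnd_append_of_notMem h, leftEnd_cons_self, add_zero]

namespace ExchangeData

/-- The letters `x` and `y` form a rotation whose two lengths have no integer relation. -/
structure IsFreeRotation (D : ExchangeData A) (x y : A) : Prop where
  left_mem : x ∈ D.top
  right_mem : y ∈ D.top
  left_sign : D.k x = 1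
  right_sign : D.k y = 1
  topLeft : D.topLeft y = D.topLeft x + D.len x
  botLeft_right : D.botLeft y = D.topLeft x
  botLeft_left : D.botLeft x = D.topLeft x + D.len y
  free : ∀ r s : ℤ, (r : ℝ) * D.len x + s * D.len y = 0 → r = 0 ∧ s = 0

/-- Every letter is flipped onto itself or belongs to a rotation by an irrational angle. -/
def IsGood (D : ExchangeData A) : Prop :=
  ∀ a ∈ D.top, (D.botLeft a = D.topLeft a ∧ D.k a = -1) ∨
    ∃ x y, (a = x ∨ a = y) ∧ D.IsFreeRotation x y

/-- Some interval is mapped onto itself. -/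
def HasFixed (D : ExchangeData A) : Prop := ∃ a ∈ D.top, D.botLeft a = D.topLeft a

theorem botLeft_eq_topLeft {D : ExchangeData A} (hn : D.top.Nodup) {t₁ t₂ b₁ b₂ : List A} {a : A}
    (ht : D.top = t₁ ++ a :: t₂) (hb : D.bot = b₁ ++ a :: b₂) (hp : b₁.Perm t₁) :
    D.botLeft a = D.topLeft a := by
  rw [ht] at hn
  have ha : a ∉ t₁ := fun h => (List.nodup_append.1 hn).2.2 a h a (by simp) rfl
  rw [botLeft, topLeft, ht, hb, leftEnd_append_cons ha,
    leftEnd_append_cons fun h => ha (hp.subset h), wordLength_perm hp]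

omit [DecidableEq A] in
theorem _root_.FlipExchange.IsSimpleBlock.perm {k : A → ℤˣ} {u w : List A}
    (h : IsSimpleBlock k u w) : w.Perm u := by
  cases h with
  | periodic => exact .refl _
  | rotation => exact List.perm_append_comm
  | marked_zyx x y z =>
    rw [List.append_assoc, List.append_assoc]
    exact (List.perm_append_comm (l₁ := z)).trans
      ((List.perm_append_comm.append_right z).trans (by rw [List.append_assoc]))
  | marked_zxy x y z =>
    rw [List.append_assoc]
    exact List.perm_append_comm
  | marked_yzx x y z =>
    rw [List.append_assoc x]
    exact List.perm_append_comm

omit [DecidableEq A] in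
/-- In a simple exchange every flipped letter occupies the same place in the two rows. -/
theorem IsSimple.exists_split {D : ExchangeData A} (h : D.IsSimple) {a : A} (ha : a ∈ D.top)
    (hk : D.k a ≠ 1) : ∃ t₁ t₂ b₁ b₂, D.top = t₁ ++ a :: t₂ ∧ D.bot = b₁ ++ a :: b₂ ∧
      b₁.Perm t₁ := by
  obtain ⟨blocks, -, hs, ht, hb⟩ := h
  rw [ht] at ha
  rw [ht, hb]
  clear ht hb
  induction blocks with
  | nil => simp at ha
  | cons q blocks ih =>
    rw [List.map_cons, List.flatten_cons, List.mem_append] at ha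
    simp only [List.map_cons, List.flatten_cons]
    have hq := hs q (by simp)
    by_cases haq : a ∈ q.1
    · have : q.2 = q.1 := by
        obtain ⟨u, w⟩ := q
        cases hq with
        | periodic => rfl
        | rotation x y _ _ h => exact absurd (h a haq) hk
        | marked_zyx x y z _ _ _ h => exact absurd (h a haq) hk
        | marked_zxy x y z _ _ _ h => exact absurd (h a haq) hk
        | marked_yzx x y z _ _ _ h => exact absurd (h a haq) hk
      rw [this]
      obtain ⟨u, w, h⟩ := List.append_of_mem haq
      exact ⟨u, w ++ _, u, w ++ _, by rw [h, List.append_assoc, List.cons_append],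
        by rw [h, List.append_assoc, List.cons_append], .refl _⟩
    · obtain ⟨t₁, t₂, b₁, b₂, h₁, h₂, h₃⟩ := ih (ha.resolve_left haq)
        fun q hq => hs q (by simp [hq])
      exact ⟨q.1 ++ t₁, t₂, q.2 ++ b₁, b₂, by rw [h₁, List.append_assoc],
        by rw [h₂, List.append_assoc], hq.perm.append h₃⟩

end ExchangeData

end Fixed

namespace Code

variable {A : Type} {c : Code} {e : ℕ → A} {D : ExchangeData A} {H : Prop}

theorem _root_.FlipExchange.Pattern.Labels.bot_length (h : c.pattern.Labels e D) :
    c.bot.length = c.size := by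
  simpa [Code.pattern] using h.perm.length_eq

theorem _root_.FlipExchange.Pattern.Labels.top_eq (h : c.pattern.Labels e D) :
    D.top = (List.range c.size).map e := h.top

theorem _root_.FlipExchange.Pattern.Labels.bot_eq (h : c.pattern.Labels e D) :
    D.bot = c.bot.map e := h.bot

theorem _root_.FlipExchange.Pattern.Labels.injOn (h : c.pattern.Labels e D) {i j : ℕ}
    (hi : i < c.size) (hj : j < c.size) (hij : e i = e j) : i = j :=
  h.inj i (List.mem_range.2 hi) j (List.mem_range.2 hj) hij

theorem _root_.FlipExchange.Pattern.Labels.bot_lt (h : c.pattern.Labels e D) {i : ℕ}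
    (hi : i ∈ c.bot) : i < c.size := List.mem_range.1 (h.perm.subset hi)

/-- In terms of the numbering by the top row, `splits` is a comparison of the letters with `i`; as
the letters of the bottom row are distinct, it says that its first `i` letters are those of the top
row. -/
theorem perm_of_splits (h : c.pattern.Labels e D) {i : ℕ} (hi : i ≤ c.size)
    (hs : c.splits i = true) : (c.bot.take i).Perm (List.range i) := by
  have hn : c.bot.Nodup := h.perm.nodup_iff.2 h.nodup
  have hsub : c.bot.take i ⊆ List.range i := fun j hj => by
    have := List.all_eq_true.1 hs j hj
    simpa using this
  have := (hn.sublist (List.take_sublist i c.bot)).subperm hsub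
  refine this.perm_of_length_le ?_
  rw [List.length_range, List.length_take, h.bot_length, min_eq_left hi]

theorem splits_of_perm (h : c.pattern.Labels e D) {t₁ t₂ b₁ b₂ : List A} (ht : D.top = t₁ ++ t₂)
    (hb : D.bot = b₁ ++ b₂) (hp : b₁.Perm t₁) : c.splits t₁.length = true := by
  rw [Code.splits, List.all_eq_true]
  intro j hj
  have hle : t₁.length ≤ c.size := by
    have := congrArg List.length (h.top_eq.symm.trans ht)
    simp at this
    omega
  have h₁ : t₁ = (List.range t₁.length).map e := by
    have := congrArg (List.take t₁.length) (h.top_eq.symm.trans ht)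
    rwa [List.take_left, ← List.map_take, List.take_range, min_eq_left hle, eq_comm] at this
  have h₂ : b₁ = (c.bot.take t₁.length).map e := by
    have := congrArg (List.take b₁.length) (h.bot_eq.symm.trans hb)
    rwa [List.take_left, ← List.map_take, eq_comm, hp.length_eq] at this
  have h₃ : e j ∈ t₁ := hp.subset (by rw [h₂]; exact List.mem_map_of_mem hj)
  rw [h₁] at h₃
  obtain ⟨i, hi, hij⟩ := List.mem_map.1 h₃
  rw [List.mem_range] at hi
  have := h.injOn (hi.trans_le hle) (h.bot_lt (List.mem_of_mem_take hj)) hij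
  simpa [← this] using hi

theorem range_eq_append {i n : ℕ} (h : i < n) :
    ∃ w, List.range n = List.range i ++ i :: w := by
  refine ⟨(List.range n).drop (i + 1), ?_⟩
  conv_lhs => rw [← List.take_append_drop i (List.range n)]
  rw [List.take_range, min_eq_left h.le, List.drop_eq_getElem_cons (by simpa using h)]
  simp

theorem eq_take_append {w : List ℕ} {i j : ℕ} (h : w[i]? = some j) :
    w = w.take i ++ j :: w.drop (i + 1) := by
  obtain ⟨hi, rfl⟩ := List.getElem?_eq_some_iff.1 h
  conv_lhs => rw [← List.take_append_drop i w, List.drop_eq_getElem_cons hi]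

theorem botLeft_eq_of_fixed [DecidableEq A] (h : c.pattern.Labels e D) {i : ℕ} (hi : i < c.size)
    (hf : c.fixed i = true) : D.botLeft (e i) = D.topLeft (e i) := by
  rw [fixed, Bool.and_eq_true, beq_iff_eq] at hf
  obtain ⟨w, hw⟩ := range_eq_append hi
  refine ExchangeData.botLeft_eq_topLeft h.valid.nodup (t₁ := (List.range i).map e)
    (t₂ := w.map e) (b₁ := (c.bot.take i).map e) (b₂ := (c.bot.drop (i + 1)).map e) ?_ ?_
    ((perm_of_splits h hi.le hf.1).map e)
  · rw [h.top_eq, hw, List.map_append, List.map_cons]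
  · rw [h.bot_eq, ← List.map_cons, ← List.map_append, ← eq_take_append hf.2]

theorem flip_eq (h : c.pattern.Labels e D) {i : ℕ} (hi : i < c.size) :
    D.k (e i) = if c.fl i then -1 else 1 := h.flip i (List.mem_range.2 hi)

theorem isFreeRotation_of_rot [DecidableEq A] (h : Pattern.Tracks H c.pattern e D)
    (hind : c.ind = true) (hH : H) {i : ℕ} (hr : c.rot i = true) :
    D.IsFreeRotation (e i) (e (i + 1)) := by
  simp only [rot, Bool.and_eq_true, Bool.not_eq_true', decide_eq_true_eq, beq_iff_eq] at hr
  obtain ⟨⟨⟨⟨⟨⟨⟨hi, hf⟩, hf'⟩, hs⟩, hb⟩, hb'⟩, hv⟩, hv'⟩ := hr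
  have hl := h.toLabels
  have hi' : i < c.size := by omega
  obtain ⟨w, hw⟩ : ∃ w, List.range c.size = List.range i ++ i :: (i + 1) :: w := by
    obtain ⟨w, hw⟩ := range_eq_append hi
    exact ⟨w, by rw [hw, List.range_succ, List.append_assoc]; rfl⟩
  have hbot : c.bot = c.bot.take i ++ (i + 1) :: i :: c.bot.drop (i + 2) := by
    conv_lhs => rw [eq_take_append hb]
    congr 2
    obtain ⟨hlt, he⟩ := List.getElem?_eq_some_iff.1 hb'
    rw [List.drop_eq_getElem_cons hlt, he]
  have hT : D.top = (List.range i).map e ++ e i :: e (i + 1) :: w.map e := by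
    rw [hl.top_eq, hw]; simp
  have hB : D.bot = (c.bot.take i).map e ++ e (i + 1) :: e i :: (c.bot.drop (i + 2)).map e := by
    rw [hl.bot_eq]
    refine (congrArg (List.map e) hbot).trans ?_
    simp only [List.map_append, List.map_cons]
  have hp := (perm_of_splits hl hi'.le hs).map e
  have hnot : ∀ j, i ≤ j → j < c.size → e j ∉ (List.range i).map e := by
    rintro j hij hj hm
    obtain ⟨m, hm, he⟩ := List.mem_map.1 hm
    rw [List.mem_range] at hm
    have := hl.injOn (by omega) hj he
    omega
  have hne : e i ≠ e (i + 1) := fun h' => by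
    have := hl.injOn hi' hi h'
    omega
  have hnot' : ∀ j, i ≤ j → j < c.size → e j ∉ (c.bot.take i).map e := fun j h₁ h₂ h₃ =>
    hnot j h₁ h₂ (hp.subset h₃)
  refine ⟨?_, ?_, ?_, ?_, ?_, ?_, ?_, ?_⟩
  · rw [hT]; simp
  · rw [hT]; simp
  · rw [flip_eq hl hi', hf]; rfl
  · rw [flip_eq hl hi, hf']; rfl
  · rw [ExchangeData.topLeft, ExchangeData.topLeft, hT, leftEnd_append_cons (hnot i le_rfl hi'),
      leftEnd_append_of_notMem (hnot (i + 1) (by omega) hi), leftEnd_cons_of_ne hne,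
      leftEnd_cons_self, add_zero]
  · rw [ExchangeData.topLeft, ExchangeData.botLeft, hT, hB,
      leftEnd_append_cons (hnot i le_rfl hi'), leftEnd_append_cons (hnot' (i + 1) (by omega) hi),
      wordLength_perm hp]
  · rw [ExchangeData.topLeft, ExchangeData.botLeft, hT, hB,
      leftEnd_append_cons (hnot i le_rfl hi'), leftEnd_append_of_notMem (hnot' i le_rfl hi'),
      leftEnd_cons_of_ne hne.symm, leftEnd_cons_self, add_zero, wordLength_perm hp]
  · intro r s hrs
    have hsum : ∀ {M : Type} [CommRing M] (f g : ℕ → M),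
        (∀ j, f j = (if j = i then f i else 0) + if j = i + 1 then f (i + 1) else 0) →
        ∑ j ∈ c.pattern.top.toFinset, f j * g j = f i * g i + f (i + 1) * g (i + 1) := by
      intro M _ f g hf
      rw [Finset.sum_congr rfl fun j _ => by rw [hf j, add_mul, ite_mul, ite_mul, zero_mul],
        Finset.sum_add_distrib]
      simp [Code.pattern, hi, hi']
    have := h.ind hind hH (fun j => if j = i then r else if j = i + 1 then s else 0) ?_ ?_
    · have h1 := this i (List.mem_range.2 hi')
      have h2 := this (i + 1) (List.mem_range.2 hi)
      simp at h1 h2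
      exact ⟨h1, h2⟩
    · rw [hsum _ _ fun j => ?_, hv, hv']
      · simp
      · by_cases h1 : j = i
        · subst h1; simp
        · simp [h1]
    · push_cast
      rw [hsum _ _ fun j => ?_]
      · simpa using hrs
      · by_cases h1 : j = i
        · subst h1; simp
        · simp [h1]

theorem isGood_of_good [DecidableEq A] (h : Pattern.Tracks H c.pattern e D)
    (hind : c.ind = true) (hH : H) (hg : c.good = true) : D.IsGood := by
  intro a ha
  rw [h.top_eq] at ha
  obtain ⟨i, hi, rfl⟩ := List.mem_map.1 ha
  have hi' := List.mem_range.1 hi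
  have := List.all_eq_true.1 hg i hi
  simp only [Bool.or_eq_true, Bool.and_eq_true, decide_eq_true_eq] at this
  rcases this with (h' | h') | h'
  · exact .inl ⟨botLeft_eq_of_fixed h.toLabels hi' h'.2, by rw [flip_eq h.toLabels hi', h'.1]; rfl⟩
  · exact .inr ⟨_, _, .inl rfl, isFreeRotation_of_rot h hind hH h'⟩
  · refine .inr ⟨_, _, .inr ?_, isFreeRotation_of_rot h hind hH h'.2⟩
    rw [Nat.sub_add_cancel h'.1]

theorem maybeSimple_of_isSimple (h : c.pattern.Labels e D) (hs : D.IsSimple) :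
    c.maybeSimple = true := by
  rw [maybeSimple, List.all_eq_true]
  intro i hi
  have hi' := List.mem_range.1 hi
  cases hf : c.fl i with
  | false => rfl
  | true =>
    obtain ⟨t₁, t₂, b₁, b₂, h₁, h₂, h₃⟩ := hs.exists_split (a := e i)
      (by rw [h.top_eq]; exact List.mem_map_of_mem hi) (by rw [flip_eq h hi', hf]; decide)
    have hlt : t₁.length < c.size := by
      have := congrArg List.length (h.top_eq.symm.trans h₁)
      simp at this
      omega
    have hti : t₁.length = i := by
      have := congrArg (fun w => w[t₁.length]?) (h.top_eq.symm.trans h₁)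
      simp [hlt] at this
      exact h.injOn hlt hi' this
    have hbi : c.bot[i]? = some i := by
      have : (c.bot.map e)[i]? = some (e i) := by
        rw [← h.bot_eq, h₂, List.getElem?_append_right (by rw [h₃.length_eq, hti]), h₃.length_eq,
          hti]
        simp
      rw [List.getElem?_map, Option.map_eq_some_iff] at this
      obtain ⟨j, hj, hji⟩ := this
      rw [hj, h.injOn (h.bot_lt (List.mem_of_getElem? hj)) hi' hji]
    have := splits_of_perm h h₁ h₂ h₃
    rw [hti] at this
    simp [fixed, this, hbi]

theorem isSimple_of_surelySimple (h : c.pattern.Labels e D) (h₀ : 0 < c.size)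
    (hs : c.surelySimple = true) : D.IsSimple := by
  simp only [surelySimple, letters, Bool.or_eq_true, Bool.and_eq_true, beq_iff_eq,
    Bool.not_eq_true'] at hs
  rcases hs with hs | ⟨⟨⟨hb, ht⟩, hf⟩, hf'⟩
  · refine ⟨[(D.top, D.bot)], by simp, ?_, by simp, by simp⟩
    have : D.bot = D.top := by rw [h.bot_eq, h.top_eq, hs]
    simp only [List.mem_singleton, forall_eq, this]
    exact .periodic _ (by rw [h.top_eq]; simp; omega)
  · have hsz : c.size = 2 := by simpa using congrArg List.length ht
    refine ⟨[(D.top, D.bot)], by simp, ?_, by simp, by simp⟩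
    have h1 := flip_eq h (i := 0) (by omega)
    have h2 := flip_eq h (i := 1) (by omega)
    rw [hf] at h1
    rw [hf'] at h2
    simp only [List.mem_singleton, forall_eq, h.bot_eq, h.top_eq, ht, hb]
    exact .rotation [e 0] [e 1] (by simp) (by simp) (by simpa using ⟨h1, h2⟩)

theorem exists_isCut_of_isReducible (h : c.pattern.Labels e D) {t₁ t₂ b₁ b₂ : List A}
    (ht : D.top = t₁ ++ t₂) (hb : D.bot = b₁ ++ b₂) (h₁ : t₁ ≠ []) (h₂ : t₂ ≠ [])
    (hp : b₁.Perm t₁) : c.isCut t₁.length = true := by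
  have := congrArg List.length (h.top_eq.symm.trans ht)
  have h₁' := List.length_pos_of_ne_nil h₁
  have h₂' := List.length_pos_of_ne_nil h₂
  simp at this
  simp only [isCut, Bool.and_eq_true, decide_eq_true_eq]
  exact ⟨⟨h₁', by omega⟩, splits_of_perm h ht hb hp⟩

theorem hasPos_of_form_pos {s : Pattern} {x : ℕ → ℝ} (hx : ∀ i ∈ s.top, 0 < x i)
    (h : 0 < s.form x) : s.hasPos = true := by
  by_contra hn
  simp only [Pattern.hasPos, List.any_eq_true, decide_eq_true_eq, not_exists, not_and,
    not_lt] at hn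
  refine absurd h (not_lt.2 (Finset.sum_nonpos fun i hi => ?_))
  have hi' : i ∈ s.top := by simpa using hi
  exact mul_nonpos_of_nonpos_of_nonneg (by exact_mod_cast hn i hi') (hx i hi').le

/-- From a reachable code, the construction of the Poincaré-Rauzy section ends with simple pieces.
Some interval of a piece is mapped onto itself if the conserved form is positive; if the lengths are
independent, all pieces are good. The proof is by induction on the number of letters. -/
theorem exists_isPoincareRauzySection [DecidableEq A] (n : ℕ) :
    ∀ (c : Code) (e : ℕ → A) (D : ExchangeData A) (base : ℝ), c.size = n →
      Reachable (false, c) → Pattern.Tracks H c.pattern e D →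
      ∃ P, IsPoincareRauzySection base D P ∧ (∀ p ∈ P, p.data.IsSimple) ∧
        (0 < c.pattern.form (fun i => D.len (e i)) ∨ c.size = 1 → ∃ p ∈ P, p.data.HasFixed) ∧
        (c.ind = true → H → ∀ p ∈ P, p.data.IsGood) := by
  induction n using Nat.strong_induction_on with
  | _ n ih =>
  intro c e D base hn hreach h
  have hok := hreach.ok
  simp only [ok, Bool.and_eq_true, Bool.or_eq_true, Bool.not_eq_true', decide_eq_true_eq,
    beq_iff_eq, List.any_eq_true, List.all_eq_true] at hok
  obtain ⟨⟨hsize, hsimp⟩, hred⟩ := hok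
  have hl := h.toLabels
  by_cases hS : D.IsSimple
  · have hm := maybeSimple_of_isSimple hl hS
    rw [hm] at hsimp
    refine ⟨[⟨base, D⟩], .simple _ _ hS, by simpa using hS, fun hpos => ?_, fun hi hH => ?_⟩
    · have h1 : c.pattern.hasPos = true ∨ c.size = 1 :=
        hpos.imp_left (hasPos_of_form_pos h.pos)
      simp only [Bool.true_eq_false, false_or] at hsimp
      obtain ⟨i, hi, hf⟩ := hsimp.2.resolve_left (by
        rw [Bool.or_eq_false_iff, beq_eq_false_iff_ne]
        rintro ⟨h2, h3⟩
        rcases h1 with h1 | h1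
        · rw [h1] at h2; exact absurd h2 (by simp)
        · exact h3 h1)
      refine ⟨_, List.mem_singleton_self _, e i, ?_, ?_⟩
      · rw [hl.top_eq]; exact List.mem_map_of_mem hi
      · exact botLeft_eq_of_fixed hl (List.mem_range.1 hi) hf
    · simp only [Bool.true_eq_false, false_or, hi] at hsimp
      simpa using isGood_of_good h hi hH hsimp.1
  have hS' : c.surelySimple = false := by
    by_contra hcon
    exact hS (isSimple_of_surelySimple hl hsize (by simpa using hcon))
  -- a reducible exchange is cut off at its first component, which is irreducible
  by_cases hcut : ∃ i, c.isCut i = true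
  · classical
    set i := Nat.find hcut with hi
    have hcuti : c.isCut i = true := Nat.find_spec hcut
    have hcuti' := hcuti
    simp only [isCut, Bool.and_eq_true, decide_eq_true_eq] at hcuti'
    obtain ⟨⟨hi0, hin⟩, hsp⟩ := hcuti'
    set T₁ := (List.range c.size).take i with hT₁
    set T₂ := (List.range c.size).drop i with hT₂
    set B₁ := c.bot.take i with hB₁
    set B₂ := c.bot.drop i with hB₂
    have hT : List.range c.size = T₁ ++ T₂ := (List.take_append_drop i _).symm
    have hB : c.bot = B₁ ++ B₂ := (List.take_append_drop i _).symm
    have hnd : (T₁ ++ T₂).Nodup := hT ▸ List.nodup_range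
    have hp₁ : B₁.Perm T₁ := by
      rw [hT₁, List.take_range, min_eq_left hin.le]
      exact perm_of_splits hl hin.le hsp
    have hp₂ : B₂.Perm T₂ := by
      have : (B₁ ++ B₂).Perm (T₁ ++ T₂) := hB ▸ hT ▸ hl.perm
      exact (List.perm_append_left_iff T₁).1 ((hp₁.symm.append_right B₂).trans this)
    have hD : D = ⟨T₁.map e ++ T₂.map e, B₁.map e ++ B₂.map e, D.k, D.len⟩ := by
      rw [← List.map_append, ← List.map_append, ← hT, ← hB, ← hl.top_eq, ← hl.bot_eq]
    have hlen : T₁.length = i := by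
      rw [hT₁, List.length_take, List.length_range, min_eq_left hin.le]
    have hlen' : T₂.length = c.size - i := by rw [hT₂, List.length_drop, List.length_range]
    have hs₁ : (c.left i).size = i := by
      rw [← hlen]
      simp [left, Pattern.code, Pattern.restrict, size, hT₁]
    have hs₂ : (c.right i).size = c.size - i := by
      rw [← hlen']
      simp [right, Pattern.code, Pattern.restrict, size, hT₂]
    have hmem : i ∈ c.letters.filter c.isCut :=
      List.mem_filter.2 ⟨List.mem_range.2 hin, hcuti⟩
    have hany : c.letters.any c.isCut = true :=
      List.any_eq_true.2 ⟨i, List.mem_range.2 hin, hcuti⟩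
    have hr : ∀ c', c' = c.left i ∨ c' = c.right i → Reachable (false, c') := fun c' hc' =>
      hreach.succ (by
        simp only [succ, hS', hany, if_true, List.mem_flatMap, Bool.false_eq_true, if_false]
        refine ⟨i, hmem, ?_⟩
        rcases hc' with rfl | rfl <;> simp)
    have htr₁ : Pattern.Tracks H (c.pattern.restrict T₁ B₁) e ⟨T₁.map e, B₁.map e, D.k, D.len⟩ :=
      h.restrict (List.take_subset _ _) (List.nodup_append.1 hnd).1 hp₁
    have htr₂ : Pattern.Tracks H (c.pattern.restrict T₂ B₂) e ⟨T₂.map e, B₂.map e, D.k, D.len⟩ :=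
      h.restrict (List.drop_subset _ _) (List.nodup_append.1 hnd).2.1 hp₂
    obtain ⟨P₁, hP₁, hsP₁, hf₁, hg₁⟩ := ih i (hn ▸ hin) (c.left i) _ _ base hs₁ (hr _ (.inl rfl))
      htr₁.code.1
    obtain ⟨P₂, hP₂, hsP₂, hf₂, hg₂⟩ := ih (c.size - i) (by omega) (c.right i) _ _
      (base + wordLength D.len (T₁.map e)) hs₂ (hr _ (.inr rfl)) htr₂.code.1
    refine ⟨P₁ ++ P₂, ?_, fun p hp => ?_, fun hpos => ?_, fun hi hH p hp => ?_⟩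
    · rw [hD]
      refine .components base _ _ _ _ _ _ _ _ (by rw [← hD]; exact hS) ?_ ?_ (hp₁.map e) ?_ hP₁ hP₂
      · exact List.ne_nil_of_length_pos (by rw [List.length_map, hlen]; exact hi0)
      · exact List.ne_nil_of_length_pos (by rw [List.length_map, hlen']; omega)
      · rintro ⟨t₁, t₂, b₁, b₂, h₁, h₂, h₃, h₄, h₅⟩
        simp only at h₁ h₂
        have hc := exists_isCut_of_isReducible hl (t₁ := t₁) (t₂ := t₂ ++ T₂.map e) (b₁ := b₁)
          (b₂ := b₂ ++ B₂.map e) (by rw [← List.append_assoc, ← h₁]; exact congrArg (·.top) hD)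
          (by rw [← List.append_assoc, ← h₂]; exact congrArg (·.bot) hD) h₃ (by simp [h₄]) h₅
        refine Nat.find_min hcut ?_ hc
        rw [← hi]
        have := congrArg List.length h₁
        rw [List.length_map, hlen, List.length_append] at this
        have := List.length_pos_of_ne_nil h₄
        omega
    · exact (List.mem_append.1 hp).elim (hsP₁ p) (hsP₂ p)
    · have hpos' : c.pattern.hasPos = true := by
        rcases hpos with h' | h'
        · exact hasPos_of_form_pos h.pos h'
        · omega
      simp only [hS', hpos', Bool.false_eq_true, Bool.true_eq_false, false_or] at hred
      rcases hred i (List.mem_range.2 hin) with (h' | h') | h'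
      · rw [hcuti] at h'; exact absurd h' (by simp)
      · obtain ⟨p, hp, hp'⟩ := hf₁ (.inr (hs₁.trans h'))
        exact ⟨p, List.mem_append_left _ hp, hp'⟩
      · obtain ⟨p, hp, hp'⟩ := hf₂ (.inr (hs₂.trans (by omega)))
        exact ⟨p, List.mem_append_right _ hp, hp'⟩
    · exact (List.mem_append.1 hp).elim (hg₁ hi hH p) (hg₂ hi hH p)
  -- otherwise the Rauzy induction is run until it stops
  have hirr : ¬ D.IsReducible := by
    rintro ⟨t₁, t₂, b₁, b₂, h₁, h₂, h₃, h₄, h₅⟩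
    exact hcut ⟨_, exists_isCut_of_isReducible hl h₁ h₂ h₃ h₄ h₅⟩
  have hrun : Reachable (true, c) := hreach.succ (by
    have hany : c.letters.any c.isCut = false := by
      by_contra hcon
      simp only [Bool.not_eq_false, List.any_eq_true] at hcon
      obtain ⟨i, -, hi⟩ := hcon
      exact hcut ⟨i, hi⟩
    simp [succ, hS', hany])
  have hstage : Stage.Ok H (c.pattern.form fun i => D.len (e i)) ⟨c, e, D, D.total⟩ := by
    refine ⟨hrun, h, rfl, hsize, fun p _ hp => ?_⟩
    have hm : e p ∈ D.top := by rw [hl.top_eq]; exact List.mem_map_of_mem (List.mem_range.2 hp)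
    exact (le_add_of_nonneg_left (leftEnd_nonneg hl.valid.pos _)).trans
      (leftEnd_add_le hl.valid.pos hm)
  obtain ⟨⟨c', e', D', q⟩, hy, hsteps, hsz, hind, hlen⟩ := hstage.exists_stop
  simp only at hsteps hsz hind hlen
  have h' := hy.tracks
  have hform := hy.form
  have hreach' := hy.reachable
  have hl' := h'.toLabels
  simp only at h' hform hreach' hl'
  have h₀ : c'.pattern.top ≠ [] := by
    change List.range c'.size ≠ []
    simp; omega
  have hb0 : c'.pattern.bot ≠ [] := fun h1 => h₀ (by
    have := hl'.perm; rw [h1] at this; exact this.nil_eq.symm)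
  -- it stops with the same letter at the end of both rows, or with different ones
  by_cases hdone : c'.pattern.lastTop = c'.pattern.lastBot
  · obtain ⟨t, ht⟩ := Pattern.eq_append_lastTop h₀
    obtain ⟨b, hb⟩ := Pattern.eq_append_lastBot hb0
    rw [← hdone] at hb
    set X := c'.pattern.lastTop with hX
    have hdone' : c'.done = true := by rw [done, beq_iff_eq, ← hdone]
    have hbp : b.Perm t := (List.perm_append_right_iff [X]).1 (hb ▸ ht ▸ hl'.perm)
    have hnd : (t ++ [X]).Nodup := ht ▸ hl'.nodup
    have htr : Pattern.Tracks H (c'.pattern.restrict t b) e' ⟨t.map e', b.map e', D'.k, D'.len⟩ :=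
      h'.restrict (by rw [ht]; exact List.subset_append_left _ _) (List.nodup_append.1 hnd).1 hbp
    have hss : c'.stopSame = (c'.pattern.restrict t b).code := by
      have h1 : List.range c'.size = t ++ [X] := ht
      have h2 : c'.bot = b ++ [X] := hb
      rw [stopSame, h1, h2, List.dropLast_concat, List.dropLast_concat]
    have hXmem : X < c'.size := by
      have : X ∈ c'.pattern.top := by rw [ht]; simp
      exact List.mem_range.1 this
    have hszs : c'.stopSame.size + 1 = c.size := by
      have h1 : (List.range c'.size).length = (t ++ [X]).length := congrArg List.length ht
      rw [hss, ← hsz]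
      simp at h1
      rw [h1]
      simp [size, Pattern.code, Pattern.restrict]
    have htr' := htr.code.1
    rw [← hss] at htr'
    obtain ⟨P, hP, hsP, -, hg⟩ := ih _ (by omega) c'.stopSame _ _ base rfl
      (hreach'.succ (by simp [succ, hdone'])) htr'
    have hD' : D' = ⟨t.map e' ++ [e' X], b.map e' ++ [e' X], D'.k, D'.len⟩ := by
      have h1 := hl'.top
      have h2 := hl'.bot
      rw [ht, List.map_append] at h1
      rw [hb, List.map_append] at h2
      exact (congrArg₂ (fun t b => (⟨t, b, D'.k, D'.len⟩ : ExchangeData A)) h1 h2)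
    refine ⟨_, .stop_same base D hS hirr (t.map e') (b.map e') (e' X) D'.k D'.len
      (by rw [← hD']; exact hsteps) P hP, fun p hp => ?_, fun _ => ?_, fun hi hH p hp => ?_⟩
    · rcases List.mem_append.1 hp with hp | hp
      · exact hsP p hp
      · rw [List.mem_singleton.1 hp]
        exact ⟨[([e' X], [e' X])], by simp, by simpa using .periodic _ (by simp), rfl, rfl⟩
    · exact ⟨_, List.mem_append_right _ (List.mem_singleton_self _), e' X,
        List.mem_singleton_self _, rfl⟩
    · rcases List.mem_append.1 hp with hp | hp
      · exact hg (by rw [hss, ← hi, ← hind]; rfl) hH p hp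
      · rw [List.mem_singleton.1 hp]
        intro a ha
        rw [List.mem_singleton.1 ha]
        refine .inl ⟨rfl, ?_⟩
        have hok' := hreach'.ok
        simp only [ok, hdone', cond_true, hind, hi, Bool.not_true, Bool.false_or] at hok'
        change D'.k (e' X) = -1
        rw [flip_eq hl' hXmem, hok']
        rfl
  · have hdone' : c'.done = false := by rw [done]; simpa using hdone
    obtain ⟨t, b, d, hD', hne, htr, hfm, hi'⟩ := h'.merge h₀ hdone hlen
    -- merging the letters keeps the value of the conserved form
    have hskip : c'.skip = false := by
      by_contra hcon
      simp only [Bool.not_eq_false, skip, Bool.and_eq_true, Bool.not_eq_true'] at hcon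
      obtain ⟨h1, h2⟩ := hcon
      simp only [Pattern.alive, List.any_eq_true, decide_eq_true_eq] at h1
      obtain ⟨i, hi, hdi⟩ := h1
      have h3 := h'.form.resolve_right fun h3 => hdi (h3 i hi)
      rw [← hfm] at h3
      rw [hasPos_of_form_pos htr.pos h3] at h2
      exact absurd h2 (by simp)
    have hszs : c'.stopDistinct.size + 1 = c.size := by
      rw [← hsz]
      simp [stopDistinct, Pattern.code, Pattern.merge, size, pattern]
      have : 0 < c'.size := by omega
      simp only [size] at this
      omega
    obtain ⟨P, hP, hsP, hf, hg⟩ := ih _ (by omega) c'.stopDistinct _ _ base rfl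
      (hreach'.succ (by simp [succ, hdone', hskip])) htr.code.1
    refine ⟨P, .stop_distinct base D hS hirr t b d _ _ D'.k D'.len hne hlen
      (by rw [← hD']; exact hsteps) P hP, hsP, fun hpos => hf ?_, fun hi hH => ?_⟩
    · rcases hpos with hpos | hpos
      · left
        have h1 := htr.code.2
        rw [hfm, hform] at h1
        exact h1.symm ▸ hpos
      · -- there are two different letters
        exfalso
        have h1 : c'.stopDistinct.size = 0 := by omega
        have h2 := (Reachable.ok (hreach'.succ (y := (false, c'.stopDistinct))
          (by simp [succ, hdone', hskip])))
        simp [ok, h1] at h2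
    · exact hg (hi' (hind.trans hi) hH) hH

end Code

/-! ### From the exchange to the map -/

section Transfer

variable {A : Type} [DecidableEq A] {f : ℝ → ℝ} {S : Set ℝ} {Q P : List (Piece A)}

/-- The exchanges of the pieces in `Q` describe the map `f` of `[0,1)`: they agree with `f` off the
cut points, and the orbits of the cut points are not regular. -/
structure Realizes (f : ℝ → ℝ) (S : Set ℝ) (Q : List (Piece A)) : Prop where
  step : ∀ x y, PStep Q x y → f x = y
  cut : ∀ x ∈ cutSet Q, ¬ OrbitAvoids f S x
  section_eq : sectionSet Q = Set.Ico 0 1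

theorem OrbitAvoids.iterate {X : Type} {f : X → X} {S : Set X} {x : X} (h : OrbitAvoids f S x)
    (n : ℕ) : OrbitAvoids f S (f^[n] x) := fun m => by
  rw [← Function.iterate_add_apply]; exact h _

theorem exists_iterate_of_reflTransGen {R : ℝ → ℝ → Prop} (hf : ∀ x y, R x y → f x = y) {x y : ℝ}
    (h : Relation.ReflTransGen R x y) : ∃ n, f^[n] x = y := by
  induction h with
  | refl => exact ⟨0, rfl⟩
  | tail _ h ih =>
    obtain ⟨n, rfl⟩ := ih
    exact ⟨n + 1, by rw [Function.iterate_succ_apply']; exact hf _ _ h⟩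

theorem Returns.isFirstReturn {R : ℝ → ℝ → Prop} {T : Set ℝ} (hf : ∀ x y, R x y → f x = y)
    {x y : ℝ} (h : Returns R T x y) : IsFirstReturn f T x y := by
  induction h with
  | last h hy => exact ⟨1, one_pos, hf _ _ h, hy, fun m h₁ h₂ => by omega⟩
  | @next x z y h hz _ ih =>
    obtain ⟨n, hn, h₁, h₂, h₃⟩ := ih
    have hxz := hf _ _ h
    refine ⟨n + 1, by omega, by rw [Function.iterate_succ_apply, hxz, h₁], h₂, fun m hm hmn => ?_⟩
    obtain ⟨m, rfl⟩ : ∃ m', m = m' + 1 := ⟨m - 1, by omega⟩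
    rw [Function.iterate_succ_apply, hxz]
    rcases Nat.eq_zero_or_pos m with rfl | hm'
    · exact hz
    · exact h₃ m hm' (by omega)

namespace Realizes

theorem exists_iterate (h : Realizes f S Q) {x y : ℝ}
    (hxy : Relation.ReflTransGen (PStep Q) x y) : ∃ n, f^[n] x = y :=
  exists_iterate_of_reflTransGen h.step hxy

theorem not_hits (h : Realizes f S Q) {x : ℝ} (hx : OrbitAvoids f S x) :
    ¬ Hits (PStep Q) (cutSet Q) x := by
  rintro ⟨y, hy, hxy⟩
  obtain ⟨n, rfl⟩ := h.exists_iterate hxy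
  exact h.cut _ hy (hx.iterate n)

theorem isFirstReturn (h : Realizes f S Q) (hi : Induces Q P) {x y : ℝ} (hxy : PStep P x y) :
    IsFirstReturn f (sectionSet P) x y := (hi.ret x y hxy).isFirstReturn h.step

theorem meets (h : Realizes f S Q) (hi : Induces Q P) {x : ℝ} (hx : x ∈ Set.Ico (0 : ℝ) 1)
    (hreg : OrbitAvoids f S x) : ∃ n, f^[n] x ∈ sectionSet P := by
  obtain ⟨y, hy, hxy⟩ := hi.meets x (h.section_eq ▸ hx)
  rcases hy with hy | hy
  · obtain ⟨n, rfl⟩ := h.exists_iterate hxy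
    exact ⟨n, hy⟩
  · exact absurd ⟨y, hy, hxy⟩ (h.not_hits hreg)

theorem isSimpleSection (h : Realizes f S Q) (hi : Induces Q P) (hv : ∀ p ∈ P, p.data.Valid)
    (hs : ∀ p ∈ P, p.data.IsSimple)
    (hd : P.Pairwise fun p q => Disjoint p.carrier q.carrier) : IsSimpleSection f S P where
  valid := hv
  simple := hs
  subset p hp x hx := h.section_eq ▸ hi.sub ⟨p, hp, hx⟩
  disjoint := hd
  meets x hx hreg := h.meets hi hx hreg
  firstReturn := ⟨∅, Set.finite_empty, fun p hp a ha x hx _ => h.isFirstReturn hi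
    ⟨p, hp, a, ha, Piece.mem_interval.2 (by simpa using hx), by simp⟩⟩

/-- A regular point of the section lies inside an interval of continuity. -/
theorem exists_mem_interval (h : Realizes f S Q) (hi : Induces Q P) (hv : ∀ p ∈ P, p.data.Valid)
    {x : ℝ} (hreg : OrbitAvoids f S x) {p : Piece A} (hp : p ∈ P) (hx : x ∈ p.carrier) :
    ∃ a ∈ p.data.top, x ∈ p.interval a := by
  obtain ⟨a, ha, h₁, h₂⟩ := exists_letter_of_mem_Ico (len := p.data.len) (hv p hp).nodup
    (x := x - p.start) (by linarith [hx.1])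
    (by have := hx.2; simp only [ExchangeData.total] at this; linarith)
  refine ⟨a, ha, ?_, ?_⟩
  · refine lt_of_le_of_ne (by simp only [ExchangeData.topLeft]; linarith) fun he => ?_
    exact h.not_hits hreg (hi.cut x ⟨p, hp, a, ha, he.symm⟩)
  · simp only [ExchangeData.topLeft]; linarith

theorem ne_cut (h : Realizes f S Q) (hi : Induces Q P) {x : ℝ} (hreg : OrbitAvoids f S x)
    {p : Piece A} (hp : p ∈ P) {a : A} (ha : a ∈ p.data.top) : x ≠ p.start + p.data.topLeft a :=
  fun he => h.not_hits hreg (hi.cut x ⟨p, hp, a, ha, he⟩)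

/-- No regular periodic orbit meets a rotation whose lengths are independent: its points in the
rotation would be pairwise different. -/
theorem not_periodic_of_isFreeRotation (h : Realizes f S Q) (hi : Induces Q P)
    (hv : ∀ p ∈ P, p.data.Valid) {z : ℝ} (hreg : OrbitAvoids f S z)
    (hper : z ∈ Function.periodicPts f)
    {p : Piece A} (hp : p ∈ P) {x y : A} (hr : p.data.IsFreeRotation x y)
    (hz : z ∈ p.interval x ∨ z ∈ p.interval y) : False := by
  have hstep : ∀ w a, a ∈ p.data.top → w ∈ p.interval a →
      ∃ n, f^[n] w = p.start + p.data.act a (w - p.start) := fun w a ha hw =>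
    h.exists_iterate (hi.ret _ _ ⟨p, hp, a, ha, hw, rfl⟩).reflTransGen
  have hT := hr.topLeft
  have hx := (hv p hp).pos x hr.left_mem
  have hy := (hv p hp).pos y hr.right_mem
  have horbit : ∀ j : ℕ, ∃ r s : ℕ, r + s = j ∧ ∃ n, f^[n] z = z + r * p.data.len y
      - s * p.data.len x ∧ (f^[n] z ∈ p.interval x ∨ f^[n] z ∈ p.interval y) := by
    intro j
    induction j with
    | zero => exact ⟨0, 0, rfl, 0, by simp, hz⟩
    | succ j ih =>
      obtain ⟨r, s, hrs, n, hn, hmem⟩ := ih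
      -- a regular point strictly inside the rotation is not the common end point of `x` and `y`
      have hsplit : ∀ m, p.start + p.data.topLeft x < f^[m] z →
          f^[m] z < p.start + p.data.topLeft x + p.data.len x + p.data.len y →
          (f^[m] z ∈ p.interval x ∨ f^[m] z ∈ p.interval y) := by
        intro m h₁ h₂
        have hne := h.ne_cut hi (hreg.iterate m) hp hr.right_mem
        simp only [Piece.interval, Set.mem_Ioo]
        rcases lt_or_gt_of_ne hne with h₃ | h₃
        · exact .inl ⟨h₁, by linarith⟩
        · exact .inr ⟨h₃, by linarith⟩
      rcases hmem with hmem | hmem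
      · obtain ⟨m, hm⟩ := hstep _ x hr.left_mem hmem
        rw [← Function.iterate_add_apply, ExchangeData.act, if_pos hr.left_sign,
          hr.botLeft_left] at hm
        refine ⟨r + 1, s, by omega, m + n, by rw [hm, hn]; push_cast; ring, hsplit _ ?_ ?_⟩ <;>
        · rw [hm]
          obtain ⟨h₁, h₂⟩ := hmem
          linarith
      · obtain ⟨m, hm⟩ := hstep _ y hr.right_mem hmem
        rw [← Function.iterate_add_apply, ExchangeData.act, if_pos hr.right_sign,
          hr.botLeft_right] at hm
        refine ⟨r, s + 1, by omega, m + n, by rw [hm, hn]; push_cast; linarith, hsplit _ ?_ ?_⟩ <;>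
        · rw [hm]
          obtain ⟨h₁, h₂⟩ := hmem
          linarith
  choose r s hrs n hn _ using horbit
  have hfin : (Set.range fun m => f^[m] z).Finite := by
    obtain ⟨m, hm, hper⟩ := hper
    refine (Set.finite_range fun i : Fin m => f^[i] z).subset ?_
    rintro _ ⟨k, rfl⟩
    exact Set.mem_range.2 ⟨⟨k % m, Nat.mod_lt _ hm⟩, hper.iterate_mod_apply k⟩
  refine Set.infinite_of_injective_forall_mem (f := fun j => f^[n j] z) (fun j k hjk => ?_)
    (fun j => Set.mem_range_self (n j)) hfin
  simp only [hn] at hjk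
  obtain ⟨h₁, h₂⟩ := hr.free ((s k : ℤ) - s j) ((r j : ℤ) - r k) (by push_cast; linarith)
  rw [← hrs j, ← hrs k]
  omega

/-- If the pieces are good, every regular periodic point in the section lies in an interval that is
flipped onto itself. -/
theorem exists_flipsOntoItself (h : Realizes f S Q) (hi : Induces Q P)
    (hv : ∀ p ∈ P, p.data.Valid) (hg : ∀ p ∈ P, p.data.IsGood) {z : ℝ}
    (hreg : OrbitAvoids f S z) (hper : z ∈ Function.periodicPts f) (hz : z ∈ sectionSet P) :
    ∃ p ∈ P, ∃ a, p.FlipsOntoItself a ∧ z ∈ p.interval a := by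
  obtain ⟨p, hp, hzp⟩ := hz
  obtain ⟨a, ha, hza⟩ := h.exists_mem_interval hi hv hreg hp hzp
  rcases hg p hp a ha with ⟨h₁, h₂⟩ | ⟨x, y, hxy, hr⟩
  · exact ⟨p, hp, a, ⟨ha, h₁, h₂⟩, hza⟩
  · refine (h.not_periodic_of_isFreeRotation hi hv hreg hper hp hr ?_).elim
    rcases hxy with rfl | rfl
    · exact .inl hza
    · exact .inr hza

/-- The points of an interval that the first return map carries onto itself are periodic. -/
theorem mem_periodicPts_of_fixed (h : Realizes f S Q) (hi : Induces Q P) {p : Piece A} (hp : p ∈ P)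
    {a : A} (ha : a ∈ p.data.top) (hfix : p.data.botLeft a = p.data.topLeft a) {z : ℝ}
    (hz : z ∈ p.interval a) : z ∈ Function.periodicPts f := by
  have hstep : ∀ w ∈ p.interval a, ∃ n, 0 < n ∧ f^[n] w = p.start + p.data.act a (w - p.start) :=
    fun w hw => by
      obtain ⟨n, hn, h', -⟩ := h.isFirstReturn hi ⟨p, hp, a, ha, hw, rfl⟩
      exact ⟨n, hn, h'⟩
  obtain ⟨h₁, h₂⟩ := hz
  obtain ⟨n, hn, h'⟩ := hstep z ⟨h₁, h₂⟩
  by_cases hk : p.data.k a = 1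
  · refine ⟨n, hn, ?_⟩
    rw [Function.IsPeriodicPt, Function.IsFixedPt, h', ExchangeData.act, if_pos hk, hfix]
    ring
  · have hw : f^[n] z ∈ p.interval a := by
      rw [h', ExchangeData.act, if_neg hk, hfix]
      constructor <;> linarith
    obtain ⟨m, hm, h''⟩ := hstep _ hw
    refine ⟨m + n, by omega, ?_⟩
    rw [Function.IsPeriodicPt, Function.IsFixedPt, Function.iterate_add_apply, h'', h',
      ExchangeData.act, ExchangeData.act, if_neg hk, if_neg hk, hfix]
    ring

end Realizes

end Transfer

/-! ### The family as interval exchanges -/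

theorem rep_coe (t : ℝ) : rep (t : UnitAddCircle) = Int.fract t := by
  rw [rep, AddCircle.coe_equivIco_mk_apply]
  simp

theorem rep_mem (X : UnitAddCircle) : rep X ∈ Set.Ico (0 : ℝ) 1 := by
  have h : rep X ∈ Set.Ico (0 : ℝ) (0 + 1) := (AddCircle.equivIco (1 : ℝ) 0 X).2
  rwa [zero_add] at h

theorem coe_rep (X : UnitAddCircle) : ((rep X : ℝ) : UnitAddCircle) = X :=
  AddCircle.coe_equivIco

theorem rep_coe_of_mem {t : ℝ} (ht : t ∈ Set.Ico (0 : ℝ) 1) : rep (t : UnitAddCircle) = t := by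
  rw [rep_coe]
  exact Int.fract_eq_self.2 ht

theorem rep_injective : Function.Injective rep := fun X Y h => by
  rw [← coe_rep X, ← coe_rep Y, h]

theorem onInterval_rep (F : UnitAddCircle → UnitAddCircle) (X : UnitAddCircle) :
    onInterval F (rep X) = rep (F X) := by rw [onInterval, coe_rep]

theorem iterate_onInterval_rep (F : UnitAddCircle → UnitAddCircle) (X : UnitAddCircle) (n : ℕ) :
    (onInterval F)^[n] (rep X) = rep (F^[n] X) := by
  induction n with
  | zero => rfl
  | succ n ih => rw [Function.iterate_succ_apply', Function.iterate_succ_apply', ih, onInterval_rep]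

theorem orbitAvoids_rep_iff {F : UnitAddCircle → UnitAddCircle} {S : Set UnitAddCircle}
    {X : UnitAddCircle} :
    OrbitAvoids (onInterval F) (rep '' S) (rep X) ↔ OrbitAvoids F S X := by
  simp only [OrbitAvoids, iterate_onInterval_rep, rep_injective.mem_set_image]

theorem mem_periodicPts_rep_iff {F : UnitAddCircle → UnitAddCircle} {X : UnitAddCircle} :
    rep X ∈ Function.periodicPts (onInterval F) ↔ X ∈ Function.periodicPts F := by
  simp only [Function.mem_periodicPts, Function.IsPeriodicPt, Function.IsFixedPt,
    iterate_onInterval_rep, rep_injective.eq_iff]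

section Family

variable {τ : ℝ} {l : Fin 3 → ℝ}

theorem onInterval_cetMap_eq {x y : ℝ} (hx : x ∈ Set.Ico (0 : ℝ) 1) (hy : y ∈ Set.Ico (0 : ℝ) 1)
    (z : ℤ) (h : (x < l 0 ∧ -x + l 0 + τ = y + z) ∨
      (l 0 ≤ x ∧ x < l 0 + l 1 ∧ -x + l 0 + (l 0 + l 1) + τ = y + z) ∨
      (l 0 ≤ x ∧ l 0 + l 1 ≤ x ∧ -x + (l 0 + l 1) + (l 0 + l 1 + l 2) + τ = y + z)) :
    onInterval (cetMap τ l) x = y := by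
  have hfr : Int.fract (y + z) = y := by
    rw [Int.fract_add_intCast]; exact Int.fract_eq_self.2 hy
  rw [onInterval, cetMap, rep_coe_of_mem hx]
  rcases h with ⟨h₁, h₂⟩ | ⟨h₁, h₂, h₃⟩ | ⟨h₁, h₂, h₃⟩
  · rw [if_pos h₁, rep_coe, h₂, hfr]
  · rw [if_neg (not_lt.2 h₁), if_pos h₂, rep_coe, h₃, hfr]
  · rw [if_neg (not_lt.2 h₁), if_neg (not_lt.2 h₂), rep_coe, h₃, hfr]

/-- The exchange with data `D` of `[0,1)` is the circle map, cut at `0` and at the preimage of `0`.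
On an interval the formula for the circle map exceeds the value of the exchange by an
integer `z`. -/
structure Presents (τ : ℝ) (l : Fin 3 → ℝ) (D : ExchangeData (Fin 4)) : Prop where
  valid : D.Valid
  total : D.total = 1
  step : ∀ a ∈ D.top, D.k a = -1 ∧ ∃ z : ℤ,
    ((D.topLeft a + D.len a ≤ l 0 ∧ l 0 + τ = D.botLeft a + D.len a + D.topLeft a + z) ∨
    (l 0 ≤ D.topLeft a ∧ D.topLeft a + D.len a ≤ l 0 + l 1 ∧
      l 0 + (l 0 + l 1) + τ = D.botLeft a + D.len a + D.topLeft a + z) ∨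
    (l 0 + l 1 ≤ D.topLeft a ∧
      (l 0 + l 1) + (l 0 + l 1 + l 2) + τ = D.botLeft a + D.len a + D.topLeft a + z))
  cut : ∀ a ∈ D.top, (D.topLeft a = 0 ∨ D.topLeft a = l 0 ∨ D.topLeft a = l 0 + l 1) ∨
    onInterval (cetMap τ l) (D.topLeft a) = 0

theorem Presents.realizes {D : ExchangeData (Fin 4)} (h : Presents τ l D) (hl : ∀ j, 0 < l j)
    (hsum : l 0 + l 1 + l 2 = 1) :
    Realizes (onInterval (cetMap τ l)) (rep '' cetSingularities l) [⟨0, D⟩] := by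
  obtain ⟨hD, htot, hstep, hcut⟩ := h
  have h0 := hl 0
  have h1 := hl 1
  have h2 := hl 2
  have hsec : sectionSet [(⟨0, D⟩ : Piece (Fin 4))] = Set.Ico 0 1 := by
    rw [sectionSet_singleton, Piece.carrier, htot, zero_add]
  have hmem : ∀ t, t = 0 ∨ t = l 0 ∨ t = l 0 + l 1 → t ∈ rep '' cetSingularities l := by
    rintro t ht
    refine ⟨(t : UnitAddCircle), ?_, rep_coe_of_mem ?_⟩
    · rcases ht with rfl | rfl | rfl <;> simp [cetSingularities]
    · rcases ht with rfl | rfl | rfl <;> constructor <;> linarith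
  refine ⟨?_, ?_, hsec⟩
  · rintro x y hxy
    have hy := hsec ▸ PStep.target_mem (by simpa using hD) hxy
    obtain ⟨p, hp, a, ha, hx, rfl⟩ := hxy
    rw [List.mem_singleton] at hp
    subst hp
    obtain ⟨h₁, h₂⟩ := hx
    simp only [zero_add] at h₁ h₂
    have h₃ := leftEnd_nonneg hD.pos a
    have h₄ := leftEnd_add_le hD.pos ha
    change D.topLeft a + D.len a ≤ D.total at h₄
    change 0 ≤ D.topLeft a at h₃
    obtain ⟨hk, z, hz⟩ := hstep a ha
    refine onInterval_cetMap_eq ⟨by linarith, by linarith⟩ hy z ?_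
    rw [ExchangeData.act, if_neg (by rw [hk]; decide)]
    simp only [zero_add, sub_zero]
    rcases hz with ⟨h₅, h₆⟩ | ⟨h₅, h₆, h₇⟩ | ⟨h₅, h₆⟩
    · exact .inl ⟨by linarith, by linarith⟩
    · exact .inr (.inl ⟨by linarith, by linarith, by linarith⟩)
    · exact .inr (.inr ⟨by linarith, by linarith, by linarith⟩)
  · rintro x ⟨p, hp, a, ha, rfl⟩ hreg
    rw [List.mem_singleton] at hp
    subst hp
    simp only [zero_add] at hreg
    rcases hcut a ha with h | h
    · exact hreg 0 (hmem _ h)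
    · refine hreg 1 (hmem _ (.inl ?_))
      exact h

theorem leftEnd_cons {A : Type} [DecidableEq A] (len : A → ℝ) (b : A) (w : List A) (a : A) :
    leftEnd len (b :: w) a = if b = a then 0 else len b + leftEnd len w a := by
  split_ifs with h
  · rw [h, leftEnd_cons_self]
  · rw [leftEnd_cons_of_ne h]

theorem presents_cetData (h₀ : 0 ≤ τ) (h₁ : τ < 1) (hl : ∀ j, 0 < l j)
    (hsum : l 0 + l 1 + l 2 = 1) : Presents τ l (cetData τ l) := by
  have l0 := hl 0
  have l1 := hl 1
  have l2 := hl 2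
  unfold cetData
  split_ifs with c1 c2 c3 c4 c5
  · refine ⟨⟨show [0, 1, 2].Nodup by decide, show [0, 1, 2].Perm [0, 1, 2] by decide, ?_⟩, ?_, ?_,
      ?_⟩
    · simp only [List.mem_cons, List.not_mem_nil, or_false, forall_eq_or_imp, forall_eq]
      refine ⟨?_, ?_, ?_⟩ <;> simp <;> linarith
    · simp [ExchangeData.total]; linarith
    · simp only [List.mem_cons, List.not_mem_nil, or_false, forall_eq_or_imp, forall_eq]
      refine ⟨⟨trivial, 0, .inl ⟨?_, ?_⟩⟩, ⟨trivial, 0, .inr (.inl ⟨?_, ?_, ?_⟩)⟩,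
          ⟨trivial, 0, .inr (.inr ⟨?_, ?_⟩)⟩⟩ <;>
        simp [ExchangeData.topLeft, ExchangeData.botLeft, leftEnd_cons] <;> linarith
    · simp only [List.mem_cons, List.not_mem_nil, or_false, forall_eq_or_imp, forall_eq]
      refine ⟨.inl (.inl ?_), .inl (.inr (.inl ?_)), .inl (.inr (.inr ?_))⟩ <;>
        simp [ExchangeData.topLeft, leftEnd_cons]
  · have h0 : 0 < τ := lt_of_le_of_ne h₀ (Ne.symm c1)
    refine ⟨⟨show [0, 1, 2, 3].Nodup by decide, show [2, 0, 1, 3].Perm [0, 1, 2, 3] by decide,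
        ?_⟩, ?_, ?_, ?_⟩
    · simp only [List.mem_cons, List.not_mem_nil, or_false, forall_eq_or_imp, forall_eq]
      refine ⟨?_, ?_, ?_, ?_⟩ <;> simp <;> linarith
    · simp [ExchangeData.total]; linarith
    · simp only [List.mem_cons, List.not_mem_nil, or_false, forall_eq_or_imp, forall_eq]
      refine ⟨⟨trivial, 0, .inl ⟨?_, ?_⟩⟩, ⟨trivial, 0, .inr (.inl ⟨?_, ?_, ?_⟩)⟩,
          ⟨trivial, 1, .inr (.inr ⟨?_, ?_⟩)⟩, ⟨trivial, 0, .inr (.inr ⟨?_, ?_⟩)⟩⟩ <;>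
        simp [ExchangeData.topLeft, ExchangeData.botLeft, leftEnd_cons] <;> linarith
    · simp only [List.mem_cons, List.not_mem_nil, or_false, forall_eq_or_imp, forall_eq]
      refine ⟨.inl (.inl ?_), .inl (.inr (.inl ?_)), .inl (.inr (.inr ?_)),
          .inr (onInterval_cetMap_eq ⟨?_, ?_⟩ ⟨le_rfl, one_pos⟩ 1 (.inr (.inr ⟨?_, ?_, ?_⟩)))⟩ <;>
        simp [ExchangeData.topLeft, leftEnd_cons] <;> linarith
  · refine ⟨⟨show [0, 1, 2].Nodup by decide, show [2, 0, 1].Perm [0, 1, 2] by decide, ?_⟩, ?_, ?_,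
      ?_⟩
    · simp only [List.mem_cons, List.not_mem_nil, or_false, forall_eq_or_imp, forall_eq]
      refine ⟨?_, ?_, ?_⟩ <;> simp <;> linarith
    · simp [ExchangeData.total]; linarith
    · simp only [List.mem_cons, List.not_mem_nil, or_false, forall_eq_or_imp, forall_eq]
      refine ⟨⟨trivial, 0, .inl ⟨?_, ?_⟩⟩, ⟨trivial, 0, .inr (.inl ⟨?_, ?_, ?_⟩)⟩,
          ⟨trivial, 1, .inr (.inr ⟨?_, ?_⟩)⟩⟩ <;>
        simp [ExchangeData.topLeft, ExchangeData.botLeft, leftEnd_cons] <;> linarith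
    · simp only [List.mem_cons, List.not_mem_nil, or_false, forall_eq_or_imp, forall_eq]
      refine ⟨.inl (.inl ?_), .inl (.inr (.inl ?_)), .inl (.inr (.inr ?_))⟩ <;>
        simp [ExchangeData.topLeft, leftEnd_cons]
  · have h0 : l 2 < τ := lt_of_le_of_ne (not_lt.1 c2) (Ne.symm c3)
    refine ⟨⟨show [0, 1, 2, 3].Nodup by decide, show [1, 3, 0, 2].Perm [0, 1, 2, 3] by decide,
        ?_⟩, ?_, ?_, ?_⟩
    · simp only [List.mem_cons, List.not_mem_nil, or_false, forall_eq_or_imp, forall_eq]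
      refine ⟨?_, ?_, ?_, ?_⟩ <;> simp <;> linarith
    · simp [ExchangeData.total]; linarith
    · simp only [List.mem_cons, List.not_mem_nil, or_false, forall_eq_or_imp, forall_eq]
      refine ⟨⟨trivial, 0, .inl ⟨?_, ?_⟩⟩, ⟨trivial, 1, .inr (.inl ⟨?_, ?_, ?_⟩)⟩,
          ⟨trivial, 0, .inr (.inl ⟨?_, ?_, ?_⟩)⟩, ⟨trivial, 1, .inr (.inr ⟨?_, ?_⟩)⟩⟩ <;>
        simp [ExchangeData.topLeft, ExchangeData.botLeft, leftEnd_cons] <;> linarith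
    · simp only [List.mem_cons, List.not_mem_nil, or_false, forall_eq_or_imp, forall_eq]
      refine ⟨.inl (.inl ?_), .inl (.inr (.inl ?_)),
          .inr (onInterval_cetMap_eq ⟨?_, ?_⟩ ⟨le_rfl, one_pos⟩ 1 (.inr (.inl ⟨?_, ?_, ?_⟩))),
          .inl (.inr (.inr ?_))⟩ <;>
        simp [ExchangeData.topLeft, leftEnd_cons] <;> linarith
  · refine ⟨⟨show [0, 1, 2].Nodup by decide, show [1, 2, 0].Perm [0, 1, 2] by decide, ?_⟩, ?_, ?_,
      ?_⟩
    · simp only [List.mem_cons, List.not_mem_nil, or_false, forall_eq_or_imp, forall_eq]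
      refine ⟨?_, ?_, ?_⟩ <;> simp <;> linarith
    · simp [ExchangeData.total]; linarith
    · simp only [List.mem_cons, List.not_mem_nil, or_false, forall_eq_or_imp, forall_eq]
      refine ⟨⟨trivial, 0, .inl ⟨?_, ?_⟩⟩, ⟨trivial, 1, .inr (.inl ⟨?_, ?_, ?_⟩)⟩,
          ⟨trivial, 1, .inr (.inr ⟨?_, ?_⟩)⟩⟩ <;>
        simp [ExchangeData.topLeft, ExchangeData.botLeft, leftEnd_cons] <;> linarith
    · simp only [List.mem_cons, List.not_mem_nil, or_false, forall_eq_or_imp, forall_eq]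
      refine ⟨.inl (.inl ?_), .inl (.inr (.inl ?_)), .inl (.inr (.inr ?_))⟩ <;>
        simp [ExchangeData.topLeft, leftEnd_cons]
  · have h0 : l 1 + l 2 < τ := lt_of_le_of_ne (not_lt.1 c4) (Ne.symm c5)
    refine ⟨⟨show [0, 1, 2, 3].Nodup by decide, show [0, 2, 3, 1].Perm [0, 1, 2, 3] by decide,
        ?_⟩, ?_, ?_, ?_⟩
    · simp only [List.mem_cons, List.not_mem_nil, or_false, forall_eq_or_imp, forall_eq]
      refine ⟨?_, ?_, ?_, ?_⟩ <;> simp <;> linarith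
    · simp [ExchangeData.total, ← hsum]
    · simp only [List.mem_cons, List.not_mem_nil, or_false, forall_eq_or_imp, forall_eq]
      refine ⟨⟨trivial, 1, .inl ⟨?_, ?_⟩⟩, ⟨trivial, 0, .inl ⟨?_, ?_⟩⟩,
          ⟨trivial, 1, .inr (.inl ⟨?_, ?_, ?_⟩)⟩, ⟨trivial, 1, .inr (.inr ⟨?_, ?_⟩)⟩⟩ <;>
        simp [ExchangeData.topLeft, ExchangeData.botLeft, leftEnd_cons] <;> linarith
    · simp only [List.mem_cons, List.not_mem_nil, or_false, forall_eq_or_imp, forall_eq]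
      refine ⟨.inl (.inl ?_), .inr (onInterval_cetMap_eq ⟨?_, ?_⟩ ⟨le_rfl, one_pos⟩ 1 (.inl ⟨?_,
          ?_⟩)), .inl (.inr (.inl ?_)), .inl (.inr (.inr ?_))⟩ <;>
        simp [ExchangeData.topLeft, leftEnd_cons] <;> linarith

end Family

/-! ### The section of a map of the family -/

section Start

variable {τ : ℝ} {l : Fin 3 → ℝ}

theorem eq_zero_of_linearIndependent (h : LinearIndependent ℚ l) {a b c : ℤ}
    (hs : (a : ℝ) * l 0 + b * l 1 + c * l 2 = 0) : a = 0 ∧ b = 0 ∧ c = 0 := by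
  have := Fintype.linearIndependent_iff.1 h ![(a : ℚ), b, c] (by
    simp only [Fin.sum_univ_three, Rat.smul_def]
    simpa using hs)
  have h0 := this 0
  have h1 := this 1
  have h2 := this 2
  simp at h0 h1 h2
  exact ⟨h0, h1, h2⟩

/-- The letter of the alphabet of the family with a given number. -/
def letter (i : ℕ) : Fin 4 := Fin.ofNat 4 i

theorem letter_inj {i j : ℕ} (hi : i < 4) (hj : j < 4) (h : letter i = letter j) : i = j := by
  have := congrArg Fin.val h
  simpa [letter, Nat.mod_eq_of_lt hi, Nat.mod_eq_of_lt hj] using this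

/-- The construction of the section succeeds for an exchange that starts from one of the codes of
the family. As both signs of the conserved form occur among these codes, the form is only required
not to vanish. -/
theorem exists_section_of_start {bot : List ℕ} {v d : List ℤ} {D : ExchangeData (Fin 4)} {H : Prop}
    {n : ℕ} (hn : n ≤ 4) (hv : v.length = n) (hd : d.length = n)
    (hstart : ∀ σ : ℤ, σ = 1 ∨ σ = -1 → Code.start bot v d σ ∈ Code.starts)
    (hp : bot.Perm (List.range n)) (ht : D.top = (List.range n).map letter)
    (hb : D.bot = bot.map letter) (hk : ∀ a, D.k a = -1) (hD : D.Valid)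
    (hform : ∑ i ∈ Finset.range n, (d.getD i 0 : ℝ) * D.len (letter i) ≠ 0)
    (hind : H → ∀ r : ℕ → ℤ, ∑ i ∈ Finset.range n, r i * v.getD i 0 = 0 →
      ∑ i ∈ Finset.range n, (r i : ℝ) * D.len (letter i) = 0 → ∀ i < n, r i = 0) :
    ∃ P, IsPoincareRauzySection 0 D P ∧ (∀ p ∈ P, p.data.IsSimple) ∧
      (∃ p ∈ P, p.data.HasFixed) ∧ (H → ∀ p ∈ P, p.data.IsGood) := by
  obtain ⟨σ, hσ, hpos⟩ : ∃ σ : ℤ, (σ = 1 ∨ σ = -1) ∧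
      0 < σ * ∑ i ∈ Finset.range n, (d.getD i 0 : ℝ) * D.len (letter i) := by
    rcases lt_or_gt_of_ne hform with h | h
    · exact ⟨-1, .inr rfl, by push_cast; linarith⟩
    · exact ⟨1, .inl rfl, by push_cast; linarith⟩
  set c : Code := (Code.start bot v d σ).2 with hc
  have hsize : c.size = n := by simp [hc, Code.start, Code.size, hv, hd]
  have hm : ∀ i < n, c.pattern.mark i = ⟨true, v.getD i 0, σ * d.getD i 0⟩ := by
    intro i hi
    simp [hc, Code.start, Code.pattern, hv, hd, hi]
  have htop : c.pattern.top = List.range n := by rw [← hsize]; rfl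
  have hset : c.pattern.top.toFinset = Finset.range n := by rw [htop, List.toFinset_range]
  have hF : c.pattern.form (fun i => D.len (letter i))
      = σ * ∑ i ∈ Finset.range n, (d.getD i 0 : ℝ) * D.len (letter i) := by
    rw [Pattern.form, hset, Finset.mul_sum]
    refine Finset.sum_congr rfl fun i hi => ?_
    rw [hm i (Finset.mem_range.1 hi)]
    push_cast
    ring
  have htr : Pattern.Tracks H c.pattern letter D := by
    refine ⟨⟨htop ▸ List.nodup_range, htop ▸ hp, ?_, htop ▸ ht, hb, ?_, ?_⟩, .inl (hF ▸ hpos), ?_⟩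
    · simp only [htop, List.mem_range]
      exact fun i hi j hj => letter_inj (by omega) (by omega)
    · simp only [htop, List.mem_range]
      intro i hi
      rw [hk, hm i hi]
      rfl
    · intro i hi
      exact hD.pos _ (by rw [ht]; exact List.mem_map_of_mem (htop ▸ hi))
    · intro _ hH r hr hx
      rw [hset] at hr hx
      simp only [htop, List.mem_range]
      refine hind hH r (Eq.trans (Finset.sum_congr rfl fun i hi => ?_) hr) hx
      rw [hm i (Finset.mem_range.1 hi)]
  obtain ⟨P, h₁, h₂, h₃, h₄⟩ := Code.exists_isPoincareRauzySection n c letter D 0 hsize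
    (Code.reachable_of_mem_starts (hstart σ hσ)) htr
  exact ⟨P, h₁, h₂, h₃ (.inl (hF ▸ hpos)), h₄ rfl⟩

/-- As `τ ≠ 1 / 2`, the conserved form `± (1 - 2 * τ)` does not vanish, and the construction of the
section succeeds for all exchanges of the family. -/
theorem exists_section_cetData (h₀ : 0 ≤ τ) (h₁ : τ < 1) (hl : ∀ j, 0 < l j)
    (hsum : l 0 + l 1 + l 2 = 1) (hτ : τ ≠ 1 / 2) :
    ∃ P, IsPoincareRauzySection 0 (cetData τ l) P ∧ (∀ p ∈ P, p.data.IsSimple) ∧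
      (∃ p ∈ P, p.data.HasFixed) ∧ (LinearIndependent ℚ l → ∀ p ∈ P, p.data.IsGood) := by
  have hval := (presents_cetData h₀ h₁ hl hsum).valid
  have hne : 1 - 2 * τ ≠ 0 := fun h => hτ (by linarith)
  have e0 : letter 0 = 0 := rfl
  have e1 : letter 1 = 1 := rfl
  have e2 : letter 2 = 2 := rfl
  have e3 : letter 3 = 3 := rfl
  unfold cetData at hval ⊢
  split_ifs at hval ⊢ with c1 c2 c3 c4 c5
  -- for `τ = 0` each of the three intervals is flipped onto itself
  · refine ⟨_, .simple _ _ ⟨[([0, 1, 2], [0, 1, 2])], by simp, ?_, rfl, rfl⟩, ?_, ?_, ?_⟩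
    · simpa using .periodic _ (by simp)
    · simpa using
        ⟨[([0, 1, 2], [0, 1, 2])], by simp, by simpa using .periodic _ (by simp), rfl, rfl⟩
    · exact ⟨_, List.mem_singleton_self _, 0, by simp, rfl⟩
    · simp only [List.mem_singleton, forall_eq]
      exact fun _ a _ => .inl ⟨rfl, rfl⟩
  · refine exists_section_of_start (bot := [2, 0, 1, 3]) (v := [0, 0, 1, -1]) (d := [1, 1, -1, 1])
      (n := 4) (by norm_num) rfl rfl ?_ (by decide) rfl rfl (fun _ => rfl) hval ?_
      fun hli r hr hx => ?_
    · rintro σ (rfl | rfl) <;> simp [Code.starts]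
    · simp [Finset.sum_range_succ, e0, e1, e2, e3]
      exact fun h => hne (by linarith)
    · simp [Finset.sum_range_succ, e0, e1, e2, e3] at hr hx
      have h : (r 2 : ℝ) = r 3 := by
        have : r 2 = r 3 := by linarith
        rw [this]
      obtain ⟨h0, h1, h2⟩ := eq_zero_of_linearIndependent hli
        (a := r 0) (b := r 1) (c := r 2) (by linear_combination hx + (l 2 - τ) * h)
      intro i hi
      interval_cases i <;> linarith
  · refine exists_section_of_start (bot := [2, 0, 1]) (v := [0, 0, 0]) (d := [1, 1, -1])
      (n := 3) (by norm_num) rfl rfl ?_ (by decide) rfl rfl (fun _ => rfl) hval ?_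
      fun hli r hr hx => ?_
    · rintro σ (rfl | rfl) <;> simp [Code.starts]
    · simp [Finset.sum_range_succ, e0, e1, e2]
      exact fun h => hne (by linarith)
    · simp [Finset.sum_range_succ, e0, e1, e2] at hr hx
      obtain ⟨h0, h1, h2⟩ := eq_zero_of_linearIndependent hli
        (a := r 0) (b := r 1) (c := r 2) (by linear_combination hx)
      intro i hi
      interval_cases i <;> linarith
  · refine exists_section_of_start (bot := [1, 3, 0, 2]) (v := [0, 1, -1, 0]) (d := [1, -1, 1, -1])
      (n := 4) (by norm_num) rfl rfl ?_ (by decide) rfl rfl (fun _ => rfl) hval ?_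
      fun hli r hr hx => ?_
    · rintro σ (rfl | rfl) <;> simp [Code.starts]
    · simp [Finset.sum_range_succ, e0, e1, e2, e3]
      exact fun h => hne (by linarith)
    · simp [Finset.sum_range_succ, e0, e1, e2, e3] at hr hx
      have h : (r 1 : ℝ) = r 2 := by
        have : r 1 = r 2 := by linarith
        rw [this]
      obtain ⟨h0, h1, h2⟩ := eq_zero_of_linearIndependent hli
        (a := r 0) (b := r 1) (c := r 3) (by linear_combination hx + (l 1 + l 2 - τ) * h)
      intro i hi
      interval_cases i <;> linarith
  · refine exists_section_of_start (bot := [1, 2, 0]) (v := [0, 0, 0]) (d := [1, -1, -1])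
      (n := 3) (by norm_num) rfl rfl ?_ (by decide) rfl rfl (fun _ => rfl) hval ?_
      fun hli r hr hx => ?_
    · rintro σ (rfl | rfl) <;> simp [Code.starts]
    · simp [Finset.sum_range_succ, e0, e1, e2]
      exact fun h => hne (by linarith)
    · simp [Finset.sum_range_succ, e0, e1, e2] at hr hx
      obtain ⟨h0, h1, h2⟩ := eq_zero_of_linearIndependent hli
        (a := r 0) (b := r 1) (c := r 2) (by linear_combination hx)
      intro i hi
      interval_cases i <;> linarith
  · refine exists_section_of_start (bot := [0, 2, 3, 1]) (v := [1, -1, 0, 0]) (d := [-1, 1, -1, -1])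
      (n := 4) (by norm_num) rfl rfl ?_ (by decide) rfl rfl (fun _ => rfl) hval ?_
      fun hli r hr hx => ?_
    · rintro σ (rfl | rfl) <;> simp [Code.starts]
    · simp [Finset.sum_range_succ, e0, e1, e2, e3]
      exact fun h => hne (by linarith)
    · simp [Finset.sum_range_succ, e0, e1, e2, e3] at hr hx
      have h : (r 0 : ℝ) = r 1 := by
        have : r 0 = r 1 := by linarith
        rw [this]
      obtain ⟨h0, h1, h2⟩ := eq_zero_of_linearIndependent hli
        (a := r 0) (b := r 2) (c := r 3) (by linear_combination hx + (1 - τ) * h + r 0 * hsum)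
      intro i hi
      interval_cases i <;> linarith

end Start

/-! ### Renaming letters -/

section Rename

variable {A B : Type} {e : A → B} {g : B → A}

/-- Rename the letters of a piece by means of a map `e` with left inverse `g`. -/
def Piece.rename (e : A → B) (g : B → A) (p : Piece A) : Piece B :=
  ⟨p.start, ⟨p.data.top.map e, p.data.bot.map e, p.data.k ∘ g, p.data.len ∘ g⟩⟩

theorem wordLength_map (h : Function.LeftInverse g e) (len : A → ℝ) (w : List A) :
    wordLength (len ∘ g) (w.map e) = wordLength len w := by
  have : (len ∘ g) ∘ e = len := by ext a; simp [h a]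
  rw [wordLength, wordLength, List.map_map, this]

theorem leftEnd_map [DecidableEq A] [DecidableEq B] (h : Function.LeftInverse g e) (len : A → ℝ)
    (w : List A) (a : A) : leftEnd (len ∘ g) (w.map e) (e a) = leftEnd len w a := by
  induction w with
  | nil => rfl
  | cons b w ih =>
    rw [List.map_cons, leftEnd_cons, leftEnd_cons, ih]
    simp [h.injective.eq_iff, h b]

theorem IsSimpleBlock.map {k : A → ℤˣ} (h : Function.LeftInverse g e) {u w : List A}
    (hb : IsSimpleBlock k u w) : IsSimpleBlock (k ∘ g) (u.map e) (w.map e) := by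
  have hk : ∀ w : List A, (∀ a ∈ w, k a = 1) → ∀ b ∈ w.map e, (k ∘ g) b = 1 := by
    intro w hw b hb
    obtain ⟨a, ha, rfl⟩ := List.mem_map.1 hb
    simpa [h a] using hw a ha
  cases hb with
  | periodic w hw => exact .periodic _ (by simpa using hw)
  | rotation x y hx hy hxy =>
    have := hk _ hxy
    simp only [List.map_append] at this ⊢
    exact .rotation _ _ (by simpa using hx) (by simpa using hy) this
  | marked_zyx x y z hx hy hz hxy =>
    have := hk _ hxy
    simp only [List.map_append] at this ⊢
    exact .marked_zyx _ _ _ (by simpa using hx) (by simpa using hy) (by simpa using hz) this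
  | marked_zxy x y z hx hy hz hxy =>
    have := hk _ hxy
    simp only [List.map_append] at this ⊢
    exact .marked_zxy _ _ _ (by simpa using hx) (by simpa using hy) (by simpa using hz) this
  | marked_yzx x y z hx hy hz hxy =>
    have := hk _ hxy
    simp only [List.map_append] at this ⊢
    exact .marked_yzx _ _ _ (by simpa using hx) (by simpa using hy) (by simpa using hz) this

theorem Piece.rename_isSimple (h : Function.LeftInverse g e) {p : Piece A}
    (hp : p.data.IsSimple) : (p.rename e g).data.IsSimple := by
  obtain ⟨blocks, h₁, h₂, h₃, h₄⟩ := hp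
  refine ⟨blocks.map fun q => (q.1.map e, q.2.map e), by simpa using h₁, ?_, ?_, ?_⟩
  · intro q' hq'
    obtain ⟨q, hq, rfl⟩ := List.mem_map.1 hq'
    exact (h₂ q hq).map h
  · simp only [rename, h₃, List.map_flatten, List.map_map]; rfl
  · simp only [rename, h₄, List.map_flatten, List.map_map]; rfl

theorem Piece.rename_valid (h : Function.LeftInverse g e) {p : Piece A} (hp : p.data.Valid) :
    (p.rename e g).data.Valid := by
  refine ⟨hp.nodup.map h.injective, hp.perm.map e, fun b hb => ?_⟩
  obtain ⟨a, ha, rfl⟩ := List.mem_map.1 hb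
  simpa [rename, h a] using hp.pos a ha

theorem Piece.rename_carrier (h : Function.LeftInverse g e) (p : Piece A) :
    (p.rename e g).carrier = p.carrier := by
  simp only [carrier, rename, ExchangeData.total, wordLength_map h]

theorem sectionSet_rename (h : Function.LeftInverse g e) (P : List (Piece A)) :
    sectionSet (P.map (Piece.rename e g)) = sectionSet P := by
  ext x
  simp [sectionSet, Piece.rename_carrier h]

theorem IsSimpleSection.rename [DecidableEq A] [DecidableEq B] (h : Function.LeftInverse g e)
    {f : ℝ → ℝ} {S : Set ℝ} {P : List (Piece A)} (hP : IsSimpleSection f S P) :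
    IsSimpleSection f S (P.map (Piece.rename e g)) := by
  obtain ⟨E, hE, hret⟩ := hP.firstReturn
  refine ⟨?_, ?_, ?_, ?_, ?_, E, hE, ?_⟩
  · intro q hq
    obtain ⟨p, hp, rfl⟩ := List.mem_map.1 hq
    exact Piece.rename_valid h (hP.valid p hp)
  · intro q hq
    obtain ⟨p, hp, rfl⟩ := List.mem_map.1 hq
    exact Piece.rename_isSimple h (hP.simple p hp)
  · intro q hq
    obtain ⟨p, hp, rfl⟩ := List.mem_map.1 hq
    rw [Piece.rename_carrier h]
    exact hP.subset p hp
  · rw [List.pairwise_map]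
    simpa only [Piece.rename_carrier h] using hP.disjoint
  · rw [sectionSet_rename h]
    exact hP.meets
  · intro q hq b hb x hx hxE
    obtain ⟨p, hp, rfl⟩ := List.mem_map.1 hq
    obtain ⟨a, ha, rfl⟩ := List.mem_map.1 hb
    have htop : (p.rename e g).data.topLeft (e a) = p.data.topLeft a := leftEnd_map h _ _ _
    have hbot : (p.rename e g).data.botLeft (e a) = p.data.botLeft a := leftEnd_map h _ _ _
    have hlen : (p.rename e g).data.len (e a) = p.data.len a := by simp [Piece.rename, h a]
    have hk : (p.rename e g).data.k (e a) = p.data.k a := by simp [Piece.rename, h a]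
    rw [ExchangeData.topInterval, htop, hlen] at hx
    rw [sectionSet_rename h, ExchangeData.act, hbot, htop, hlen, hk]
    exact hret p hp a ha x hx hxE

end Rename

/-! ### Minimality -/

section Minimality

/-- A countable set of points of the circle does not contain an interval. -/
theorem exists_notMem_of_countable {C : Set UnitAddCircle} (hC : C.Countable) {a b : ℝ}
    (h₀ : 0 ≤ a) (h₁ : b ≤ 1) (hab : a < b) : ∃ X ∉ C, rep X ∈ Set.Ioo a b := by
  obtain ⟨x, hx, hxC⟩ := ((hC.image rep).dense_compl ℝ).exists_mem_open isOpen_Ioo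
    (Set.nonempty_Ioo.2 hab)
  have hmem : rep (x : UnitAddCircle) = x :=
    rep_coe_of_mem ⟨h₀.trans hxC.1.le, hxC.2.trans_le h₁⟩
  exact ⟨x, fun h => hx ⟨_, h, hmem⟩, hmem.symm ▸ hxC⟩

/-- The orbits that run into the singularities start in a countable set. -/
theorem countable_setOf_not_orbitAvoids (τ : ℝ) (l : Fin 3 → ℝ) :
    {X | ¬ OrbitAvoids (cetMap τ l) (cetSingularities l) X}.Countable := by
  have hpre : ∀ C : Set UnitAddCircle, C.Countable → (cetMap τ l ⁻¹' C).Countable := by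
    intro C hC
    refine (((hC.image fun Y => ((l 0 + τ : ℝ) : UnitAddCircle) - Y).union
      (hC.image fun Y => ((l 0 + (l 0 + l 1) + τ : ℝ) : UnitAddCircle) - Y)).union
      (hC.image fun Y => (((l 0 + l 1) + (l 0 + l 1 + l 2) + τ : ℝ) : UnitAddCircle) - Y)).mono ?_
    intro X hX
    have key : ∀ c : ℝ, cetMap τ l X = ((-rep X + c : ℝ) : UnitAddCircle) →
        (c : UnitAddCircle) - cetMap τ l X = X := by
      intro c hc
      rw [hc, AddCircle.coe_add, AddCircle.coe_neg, coe_rep]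
      abel
    by_cases h₁ : rep X < l 0
    · exact .inl (.inl ⟨_, hX, key _ (by rw [cetMap, if_pos h₁]; congr 1; ring)⟩)
    · by_cases h₂ : rep X < l 0 + l 1
      · exact .inl (.inr ⟨_, hX, key _ (by rw [cetMap, if_neg h₁, if_pos h₂]; congr 1; ring)⟩)
      · exact .inr ⟨_, hX, key _ (by rw [cetMap, if_neg h₁, if_neg h₂]; congr 1; ring)⟩
  have hiter : ∀ n, ((cetMap τ l)^[n] ⁻¹' cetSingularities l).Countable := by
    intro n
    induction n with
    | zero => exact Set.Finite.countable (by simp [cetSingularities])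
    | succ n ih => rw [Function.iterate_succ]; exact hpre _ ih
  refine (Set.countable_iUnion hiter).mono fun X hX => ?_
  simp only [OrbitAvoids, Set.mem_ofPred_eq, not_forall, not_not] at hX
  exact Set.mem_iUnion.2 hX

theorem not_isMinimalOnCircle_of_periodic {F : UnitAddCircle → UnitAddCircle}
    {S : Set UnitAddCircle} {X : UnitAddCircle} (hreg : OrbitAvoids F S X)
    (hper : X ∈ Function.periodicPts F) : ¬ IsMinimalOnCircle F S := by
  intro hmin
  obtain ⟨m, hm, hper⟩ := hper
  have hfin : (Set.range fun n => F^[n] X).Finite := by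
    refine (Set.finite_range fun i : Fin m => F^[i] X).subset ?_
    rintro _ ⟨k, rfl⟩
    exact Set.mem_range.2 ⟨⟨k % m, Nat.mod_lt _ hm⟩, hper.iterate_mod_apply k⟩
  have huniv := (hmin X hreg).closure_eq
  rw [hfin.isClosed.closure_eq] at huniv
  obtain ⟨Y, hY, -⟩ := exists_notMem_of_countable hfin.countable le_rfl le_rfl one_pos
  exact hY (huniv ▸ Set.mem_univ Y)

end Minimality

end FlipExchange

end

/-- Let `F = F_{τ, l₁, l₂, l₃}` be a fully flipped three-interval exchange of the circle with
`τ ≠ 1/2`. Then `F` is integrable and not minimal. If moreover `l₁, l₂, l₃` are linearly independent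
over `ℚ`, then the Poincaré-Rauzy section is a Poincaré section of `F` with simple first return map,
and the orbit of every periodic point (avoiding the singularities) meets this section, each time
inside an interval that the first return map flips onto itself. -/
theorem mainTheorem4 (τ : ℝ) (l : Fin 3 → ℝ) (hτ₀ : 0 ≤ τ) (hτ₁ : τ < 1)
    (hl : ∀ j, 0 < l j) (hsum : l 0 + l 1 + l 2 = 1) (hτ : τ ≠ 1 / 2) :
    FlipExchange.IsIntegrableOnCircle (FlipExchange.cetMap τ l)
        (FlipExchange.cetSingularities l) ∧
    ¬ FlipExchange.IsMinimalOnCircle (FlipExchange.cetMap τ l)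
        (FlipExchange.cetSingularities l) ∧
    (LinearIndependent ℚ l →
      ∃ P : List (FlipExchange.Piece (Fin 4)),
        FlipExchange.IsPoincareRauzySection 0 (FlipExchange.cetData τ l) P ∧
        FlipExchange.IsSimpleSection (FlipExchange.onInterval (FlipExchange.cetMap τ l))
          (FlipExchange.rep '' FlipExchange.cetSingularities l) P ∧
        ∀ x ∈ Function.periodicPts (FlipExchange.cetMap τ l),
          FlipExchange.OrbitAvoids (FlipExchange.cetMap τ l)
            (FlipExchange.cetSingularities l) x →
          (∃ n : ℕ, FlipExchange.rep ((FlipExchange.cetMap τ l)^[n] x)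
            ∈ FlipExchange.sectionSet P) ∧
          ∀ n : ℕ, FlipExchange.rep ((FlipExchange.cetMap τ l)^[n] x)
              ∈ FlipExchange.sectionSet P →
            ∃ p ∈ P, ∃ a : Fin 4, p.FlipsOntoItself a ∧
              FlipExchange.rep ((FlipExchange.cetMap τ l)^[n] x) ∈ p.interval a) := by
  open FlipExchange in
  obtain ⟨P, hPR, hsimple, ⟨p, hp, a, ha, hfix⟩, hgood⟩ :=
    exists_section_cetData hτ₀ hτ₁ hl hsum hτ
  have hpres := presents_cetData hτ₀ hτ₁ hl hsum
  have hreal := hpres.realizes hl hsum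
  obtain ⟨hv, hd, hi⟩ := hPR.induces hpres.valid
  have hsec := hreal.isSimpleSection hi hv hsimple hd
  -- integrability asks for letters in `ℕ`, the section of the family has letters in `Fin 4`
  refine ⟨⟨_, hsec.rename (e := Fin.val) (g := Fin.ofNat 4) fun i => by simp⟩, ?_, fun hli =>
    ⟨P, hPR, hsec, fun x hx hreg => ⟨?_, fun n hn => ?_⟩⟩⟩
  -- all regular points of the interval that is mapped onto itself are periodic
  · have hsub := hsec.subset p hp
    have h₁ := leftEnd_nonneg (hv p hp).pos a
    have h₂ := leftEnd_add_le (hv p hp).pos ha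
    have h₃ := (hv p hp).pos a ha
    have hends : 0 ≤ p.start ∧ p.start + p.data.total ≤ 1 :=
      (Set.Ico_subset_Ico_iff (by simp only [ExchangeData.total]; linarith)).1 hsub
    simp only [ExchangeData.total] at hends
    obtain ⟨X, hX, hXint⟩ := exists_notMem_of_countable (countable_setOf_not_orbitAvoids τ l)
      (a := p.start + p.data.topLeft a) (b := p.start + p.data.topLeft a + p.data.len a)
      (by simp only [ExchangeData.topLeft]; linarith)
      (by simp only [ExchangeData.topLeft]; linarith) (by linarith)
    exact not_isMinimalOnCircle_of_periodic (not_not.1 hX)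
      (mem_periodicPts_rep_iff.1 (hreal.mem_periodicPts_of_fixed hi hp ha hfix hXint))
  · obtain ⟨n, hn⟩ := hreal.meets hi (rep_mem x) (orbitAvoids_rep_iff.2 hreg)
    exact ⟨n, by rwa [iterate_onInterval_rep] at hn⟩
  · refine hreal.exists_flipsOntoItself hi hv (hgood hli)
      (orbitAvoids_rep_iff.2 (hreg.iterate n)) (mem_periodicPts_rep_iff.2 ?_) hn
    obtain ⟨m, hm, hper⟩ := hx
    exact ⟨m, hm, hper.apply_iterate n⟩
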